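/- Let $(F,g)$ be an oriented smooth Riemannian manifold without boundary (Hausdorff, second countable, not necessarily complete, compact or connected; the orientation is in fact not needed) of dimension $f$, and let $c>0$ be a real number. Let $C^*(F)=(0,1)\times F$ with the metric $$g_c = dr\otimes dr + r^{2c}\,\pi^*g,$$ where $r$ and $\pi$ are the projections of $(0,1)\times F$ to $(0,1)$ and to $F$. For a Riemannian manifold $(M,h)$ let $L^2\Omega^i(M,h)$ be the space of measurable $i$-forms $\omega$ with $\int_M|\omega|_h^2\,d\mathrm{vol}_h<\infty$, modulo equality almost everywhere, and let $d_{max,i}$ be the maximal extension of the exterior derivative: its domain consists of all $\omega\in L^2\Omega^i(M,h)$ whose distributional exterior derivative is represented by a form $\eta\in L^2\Omega^{i+1}(M,h)$, and $d_{max,i}\,\omega=\eta$. Put $H^i_{2,max}(M,h)=\ker d_{max,i}/\operatorname{ran} d_{max,i-1}$ (with $\operatorname{ran} d_{max,-1}=0$). Then for every integer $i\ge 0$: 1. if $i<\frac f2+\frac1{2c}$, then $H^i_{2,max}(C^*(F),g_c)\cong H^i_{2,max}(F,g)$ as real vector spaces; 2. if $i>\frac f2+1-\frac1{2c}$ and $i\ge\frac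 f2+\frac1{2c}$, so that case 1 does not apply, then $H^i_{2,max}(C^*(F),g_c)=0$. (For $c\ge 1$ the second of these inequalities follows from the first; for $c<1$ the first follows from the second.) -/

import Mathlib

open MeasureTheory
open scoped Manifold ContDiff ENNReal Nat

set_option linter.unusedSectionVars false

noncomputable section

namespace L2deRham

/-! ### Linear algebra on one tangent space -/

section Pointwise

variable {V : Type*} [AddCommGroup V] [Module ℝ V] [TopologicalSpace V]

/-- The squared norm `|α|²` of an alternating `k`-form `α` on a finite-dimensional space with inner
product `B`, that is `(1/k!) ∑_{i₁,…,iₖ} α(e_{i₁},…,e_{iₖ})² = ∑_{i₁<⋯<iₖ} α(e_{i₁},…,e_{iₖ})²`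
for a `B`-orthonormal basis `e`. All orthonormal bases give the same value, so taking the supremum
over them only avoids choosing one. -/
def formNormSq {k : ℕ} (B : V →L[ℝ] V →L[ℝ] ℝ) (α : V [⋀^Fin k]→L[ℝ] ℝ) : ℝ≥0∞ :=
  ⨆ (e : Fin (Module.finrank ℝ V) → V) (_ : ∀ a b, B (e a) (e b) = if a = b then 1 else 0),
    ENNReal.ofReal ((∑ s : Fin k → Fin (Module.finrank ℝ V), α (fun j => e (s j)) ^ 2) / (k ! : ℝ))

/-- The pullback `(u, w) ↦ B (A u) (A w)` of a bilinear form `B` by a linear map `A`. -/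
def pullbackBilin {W : Type*} [AddCommGroup W] [Module ℝ W] [TopologicalSpace W]
    (B : V →L[ℝ] V →L[ℝ] ℝ) (A : W →L[ℝ] V) : W →L[ℝ] W →L[ℝ] ℝ :=
  (ContinuousLinearMap.precomp ℝ A).comp (B.comp A)

@[simp] theorem pullbackBilin_apply {W : Type*} [AddCommGroup W] [Module ℝ W] [TopologicalSpace W]
    (B : V →L[ℝ] V →L[ℝ] ℝ) (A : W →L[ℝ] V) (u w : W) :
    pullbackBilin B A u w = B (A u) (A w) := rfl

theorem formNormSq_add_le {k : ℕ} (B : V →L[ℝ] V →L[ℝ] ℝ) (α β : V [⋀^Fin k]→L[ℝ] ℝ) :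
    formNormSq B (α + β) ≤ 2 * (formNormSq B α + formNormSq B β) := by
  refine iSup₂_le fun e he => ?_
  have h1 := le_iSup₂ (f := fun (e : Fin (Module.finrank ℝ V) → V)
    (_ : ∀ a b, B (e a) (e b) = if a = b then 1 else 0) => ENNReal.ofReal
      ((∑ s : Fin k → Fin (Module.finrank ℝ V), α (fun j => e (s j)) ^ 2) / (k ! : ℝ))) e he
  have h2 := le_iSup₂ (f := fun (e : Fin (Module.finrank ℝ V) → V)
    (_ : ∀ a b, B (e a) (e b) = if a = b then 1 else 0) => ENNReal.ofReal
      ((∑ s : Fin k → Fin (Module.finrank ℝ V), β (fun j => e (s j)) ^ 2) / (k ! : ℝ))) e he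
  refine le_trans ?_ (mul_le_mul_right (add_le_add h1 h2) 2)
  rw [← ENNReal.ofReal_add (by positivity) (by positivity),
    ← ENNReal.ofReal_ofNat 2, ← ENNReal.ofReal_mul (by norm_num)]
  refine ENNReal.ofReal_le_ofReal ?_
  rw [← add_div, ← mul_div_assoc, ← Finset.sum_add_distrib, Finset.mul_sum]
  gcongr with s
  rw [ContinuousAlternatingMap.add_apply]
  nlinarith [sq_nonneg (α (fun j => e (s j)) - β (fun j => e (s j)))]

theorem formNormSq_smul_le {k : ℕ} (B : V →L[ℝ] V →L[ℝ] ℝ) (a : ℝ) (α : V [⋀^Fin k]→L[ℝ] ℝ) :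
    formNormSq B (a • α) ≤ ENNReal.ofReal (a ^ 2) * formNormSq B α := by
  refine iSup₂_le fun e he => ?_
  have h1 := le_iSup₂ (f := fun (e : Fin (Module.finrank ℝ V) → V)
    (_ : ∀ a b, B (e a) (e b) = if a = b then 1 else 0) => ENNReal.ofReal
      ((∑ s : Fin k → Fin (Module.finrank ℝ V), α (fun j => e (s j)) ^ 2) / (k ! : ℝ))) e he
  refine le_trans ?_ (mul_le_mul_right h1 _)
  rw [← ENNReal.ofReal_mul (by positivity)]
  refine ENNReal.ofReal_le_ofReal (le_of_eq ?_)
  rw [← mul_div_assoc, Finset.mul_sum]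
  congr 1
  refine Finset.sum_congr rfl fun s _ => ?_
  rw [ContinuousAlternatingMap.smul_apply, smul_eq_mul, mul_pow]

theorem formNormSq_zero {k : ℕ} (B : V →L[ℝ] V →L[ℝ] ℝ) :
    formNormSq B (0 : V [⋀^Fin k]→L[ℝ] ℝ) = 0 := by
  simp [formNormSq]

end Pointwise

/-! ### `L²` differential forms on a manifold without boundary -/

variable {E : Type*} [NormedAddCommGroup E] [NormedSpace ℝ E] [FiniteDimensional ℝ E]
  [MeasurableSpace E] [BorelSpace E] {H : Type*} [TopologicalSpace H]
  {I : ModelWithCorners ℝ E H} {M : Type*} [TopologicalSpace M] [ChartedSpace H M]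

variable (I M) in
/-- A field of bilinear forms on the tangent spaces of `M`. -/
abbrev BilinField : Type _ :=
  ∀ x : M, TangentSpace I x →L[ℝ] TangentSpace I x →L[ℝ] ℝ

variable (I M) in
/-- A differential `k`-form on `M`, without any regularity. -/
def Form (k : ℕ) : Type _ :=
  ∀ x : M, TangentSpace I x [⋀^Fin k]→L[ℝ] ℝ

instance (k : ℕ) : AddCommGroup (Form I M k) :=
  inferInstanceAs (AddCommGroup (∀ x : M, TangentSpace I x [⋀^Fin k]→L[ℝ] ℝ))

instance (k : ℕ) : Module ℝ (Form I M k) :=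
  inferInstanceAs (Module ℝ (∀ x : M, TangentSpace I x [⋀^Fin k]→L[ℝ] ℝ))

variable (E) in
/-- Lebesgue measure on the model space, in the coordinates of a fixed basis. -/
def modelMeasure : Measure E := (Module.finBasis ℝ E).addHaar

variable (I) in
/-- The domain of coordinates, an open subset of `E`, of the preferred chart at `x`. -/
def coordDomain (x : M) : Set E := (extChartAt I x).target

variable (I) in
/-- The differential at `y` of the parametrization of `M` inverse to the preferred chart at `x`. -/
def coordFrame (x : M) (y : E) : E →L[ℝ] TangentSpace I ((extChartAt I x).symm y) :=
  mfderiv 𝓘(ℝ, E) I (extChartAt I x).symm y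

/-- The form `α` in the coordinates of the preferred chart at `x`: the pullback of `α` by the
inverse of the chart. -/
def coordForm {k : ℕ} (α : Form I M k) (x : M) (y : E) : E [⋀^Fin k]→L[ℝ] ℝ :=
  (α ((extChartAt I x).symm y)).compContinuousLinearMap (coordFrame I x y)

/-- The matrix of the metric `g` in the coordinates of the preferred chart at `x`. -/
def coordGram (g : BilinField I M) (x : M) (y : E) :
    Matrix (Fin (Module.finrank ℝ E)) (Fin (Module.finrank ℝ E)) ℝ :=
  Matrix.of fun a b => g ((extChartAt I x).symm y)
    (coordFrame I x y (Module.finBasis ℝ E a)) (coordFrame I x y (Module.finBasis ℝ E b))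

/-- The Riemannian volume of the domain of the preferred chart at `x`: the image on `M` of
`√det(g_{ab}) dy`. -/
def localVolume [MeasurableSpace M] (g : BilinField I M) (x : M) : Measure M :=
  (((modelMeasure E).withDensity
      (fun y => ENNReal.ofReal (Real.sqrt (coordGram g x y).det))).restrict
    (coordDomain I x)).map (extChartAt I x).symm

/-- The Riemannian volume measure of `(M, g)`. The measures `localVolume g x` are the restrictions
of one measure to the members of an open cover; on a second countable manifold that measure is
their least upper bound. -/
def volumeMeasure [MeasurableSpace M] (g : BilinField I M) : Measure M :=
  ⨆ x : M, localVolume g x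

/-- `α` is measurable: its coefficients in the charts are Lebesgue measurable. -/
def MeasurableForm {k : ℕ} (α : Form I M k) : Prop :=
  ∀ (x : M) (v : Fin k → E),
    AEMeasurable (fun y => coordForm α x y v) ((modelMeasure E).restrict (coordDomain I x))

theorem coordForm_add {k : ℕ} (α β : Form I M k) (x : M) (y : E) :
    coordForm (α + β) x y = coordForm α x y + coordForm β x y := rfl

theorem coordForm_smul {k : ℕ} (a : ℝ) (α : Form I M k) (x : M) (y : E) :
    coordForm (a • α) x y = a • coordForm α x y := rfl

theorem coordForm_zero {k : ℕ} (x : M) (y : E) :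
    coordForm (0 : Form I M k) x y = 0 := rfl

/-- The measurable `k`-forms with `∫_M |α|² dvol < ∞`. (Finiteness of the integral is expressed
by an integrable majorant of the function `|α|²`.) -/
def squareIntegrableForms [MeasurableSpace M] (g : BilinField I M) (k : ℕ) :
    Submodule ℝ (Form I M k) where
  carrier := {α | MeasurableForm α ∧ ∃ h : M → ℝ≥0∞, Measurable h ∧
    ∫⁻ x, h x ∂(volumeMeasure g) < ⊤ ∧ ∀ x, formNormSq (g x) (α x) ≤ h x}
  zero_mem' := by
    refine ⟨fun x v => ?_, 0, measurable_zero, by simp, fun x => ?_⟩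
    · exact aemeasurable_const (b := (0 : ℝ))
    · exact (formNormSq_zero (g x)).le
  add_mem' := by
    rintro α β ⟨hα, h, hm, hi, hle⟩ ⟨hβ, h', hm', hi', hle'⟩
    refine ⟨fun x v => ?_, fun x => 2 * (h x + h' x), (hm.add hm').const_mul 2, ?_, fun x => ?_⟩
    · simp only [coordForm_add, ContinuousAlternatingMap.add_apply]
      exact (hα x v).add (hβ x v)
    · beta_reduce
      rw [lintegral_const_mul 2 (by fun_prop), lintegral_add_left hm]
      exact ENNReal.mul_lt_top (by simp) (ENNReal.add_lt_top.2 ⟨hi, hi'⟩)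
    · exact (formNormSq_add_le (g x) (α x) (β x)).trans
        (mul_le_mul_right (add_le_add (hle x) (hle' x)) 2)
  smul_mem' := by
    rintro a α ⟨hα, h, hm, hi, hle⟩
    refine ⟨fun x v => ?_, fun x => ENNReal.ofReal (a ^ 2) * h x, hm.const_mul _, ?_, fun x => ?_⟩
    · simp only [coordForm_smul, ContinuousAlternatingMap.smul_apply]
      exact (hα x v).const_smul a
    · rw [lintegral_const_mul _ hm]
      exact ENNReal.mul_lt_top ENNReal.ofReal_lt_top hi
    · exact (formNormSq_smul_le (g x) a (α x)).trans (mul_le_mul_right (hle x) _)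

/-- The square integrable forms that vanish almost everywhere. -/
def nullForms [MeasurableSpace M] (g : BilinField I M) (k : ℕ) :
    Submodule ℝ (squareIntegrableForms g k) where
  carrier := {α | ∀ᵐ x ∂(volumeMeasure g), α.1 x = 0}
  zero_mem' := by
    change ∀ᵐ x ∂(volumeMeasure g), (0 : Form I M k) x = 0
    exact Filter.Eventually.of_forall fun _ => rfl
  add_mem' := by
    intro α β hα hβ
    change ∀ᵐ x ∂(volumeMeasure g), (α + β).1 x = 0
    filter_upwards [Set.mem_ofPred_eq ▸ hα, Set.mem_ofPred_eq ▸ hβ] with x h1 h2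
    change α.1 x + β.1 x = 0
    rw [h1, h2, add_zero]
  smul_mem' := by
    intro a α hα
    change ∀ᵐ x ∂(volumeMeasure g), (a • α).1 x = 0
    filter_upwards [Set.mem_ofPred_eq ▸ hα] with x h1
    change a • α.1 x = 0
    rw [h1, smul_zero]

/-- The space `L²Ω^k(M, g)` of square integrable `k`-forms modulo equality almost everywhere. -/
abbrev L2Form [MeasurableSpace M] (g : BilinField I M) (k : ℕ) : Type _ :=
  squareIntegrableForms g k ⧸ nullForms g k

/-! ### The maximal extension of the exterior derivative and its cohomology -/

/-- The coefficients of `α` in the charts are locally integrable. -/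
def LocIntegrableForm {k : ℕ} (α : Form I M k) : Prop :=
  ∀ (x : M) (v : Fin k → E),
    LocallyIntegrableOn (fun y => coordForm α x y v) (coordDomain I x) (modelMeasure E)

/-- `β` is the exterior derivative of `α` in the sense of distributions: in every chart, for all
test functions `ψ` and all constant vector fields `v₀, …, v_k`, the form `β` satisfies the identity
that results from `dα(v₀, …, v_k) = ∑ⱼ (-1)^j ∂_{vⱼ} (α(v₀, …, v̂ⱼ, …, v_k))` after multiplication
by `ψ` and integration by parts. -/
def IsWeakExtDeriv {k : ℕ} (α : Form I M k) (β : Form I M (k + 1)) : Prop :=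
  LocIntegrableForm α ∧ LocIntegrableForm β ∧
  ∀ (x : M) (ψ : E → ℝ), ContDiff ℝ ∞ ψ → HasCompactSupport ψ → tsupport ψ ⊆ coordDomain I x →
    ∀ v : Fin (k + 1) → E,
      ∫ y, ψ y * coordForm β x y v ∂(modelMeasure E) =
        -∑ j : Fin (k + 1), (-1 : ℝ) ^ (j : ℕ) *
          ∫ y, fderiv ℝ ψ y (v j) * coordForm α x y (fun l => v (j.succAbove l))
            ∂(modelMeasure E)

theorem integrable_mul_of_locallyIntegrableOn {U : Set E} {θ u : E → ℝ} {μ : Measure E}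
    (hθ : Continuous θ) (hc : HasCompactSupport θ) (hs : tsupport θ ⊆ U)
    (hu : LocallyIntegrableOn u U μ) : Integrable (fun y => θ y * u y) μ := by
  have h1 : IntegrableOn u (tsupport θ) μ := hu.integrableOn_compact_subset hs hc
  have h2 : IntegrableOn (fun y => θ y * u y) (tsupport θ) μ :=
    h1.continuousOn_mul hθ.continuousOn hc
  refine (integrableOn_iff_integrable_of_support_subset ?_).1 h2
  intro y hy
  refine subset_tsupport θ ?_
  intro h
  exact hy (by simp [h])

theorem integrable_test {k : ℕ} {α : Form I M k} (hα : LocIntegrableForm α) (x : M) {ψ : E → ℝ}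
    (hψ : Continuous ψ) (hc : HasCompactSupport ψ) (hs : tsupport ψ ⊆ coordDomain I x)
    (v : Fin k → E) : Integrable (fun y => ψ y * coordForm α x y v) (modelMeasure E) :=
  integrable_mul_of_locallyIntegrableOn hψ hc hs (hα x v)

theorem integrable_fderiv_test {k : ℕ} {α : Form I M k} (hα : LocIntegrableForm α) (x : M)
    {ψ : E → ℝ} (hψ : ContDiff ℝ ∞ ψ) (hc : HasCompactSupport ψ)
    (hs : tsupport ψ ⊆ coordDomain I x) (w : E) (v : Fin k → E) :
    Integrable (fun y => fderiv ℝ ψ y w * coordForm α x y v) (modelMeasure E) := by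
  have hsub : tsupport (fun y => fderiv ℝ ψ y w) ⊆ tsupport ψ := by
    refine closure_minimal (fun y hy => support_fderiv_subset ℝ (f := ψ) ?_) (isClosed_tsupport ψ)
    intro h
    exact hy (by simp [h])
  refine integrable_mul_of_locallyIntegrableOn
    ((hψ.continuous_fderiv (by simp)).clm_apply continuous_const) ?_ (hsub.trans hs) (hα x v)
  exact IsCompact.of_isClosed_subset hc (isClosed_tsupport _) hsub

/-- The pairs of square integrable forms `(α, β)` with `dα = β` in the sense of distributions. -/
def weakDerivPairs [MeasurableSpace M] (g : BilinField I M) (k : ℕ) :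
    Submodule ℝ (squareIntegrableForms g k × squareIntegrableForms g (k + 1)) where
  carrier := {p | IsWeakExtDeriv p.1.1 p.2.1}
  zero_mem' := by
    refine ⟨fun x v => ?_, fun x v => ?_, fun x ψ _ _ _ v => ?_⟩
    · exact locallyIntegrableOn_zero
    · exact locallyIntegrableOn_zero
    · simp [coordForm_zero]
  add_mem' := by
    rintro ⟨α, β⟩ ⟨α', β'⟩ ⟨h1, h2, h3⟩ ⟨h1', h2', h3'⟩
    refine ⟨fun x v => (h1 x v).add (h1' x v), fun x v => (h2 x v).add (h2' x v),
      fun x ψ hψ hc hs v => ?_⟩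
    have e1 := h3 x ψ hψ hc hs v
    have e2 := h3' x ψ hψ hc hs v
    simp only [Prod.mk_add_mk, Submodule.coe_add, coordForm_add,
      ContinuousAlternatingMap.add_apply, mul_add] at e1 e2 ⊢
    rw [integral_add (integrable_test h2 x hψ.continuous hc hs v)
      (integrable_test h2' x hψ.continuous hc hs v), e1, e2, ← neg_add, ← Finset.sum_add_distrib]
    congr 1
    refine Finset.sum_congr rfl fun j _ => ?_
    rw [integral_add (integrable_fderiv_test h1 x hψ hc hs _ _)
      (integrable_fderiv_test h1' x hψ hc hs _ _), mul_add]
  smul_mem' := by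
    rintro a ⟨α, β⟩ ⟨h1, h2, h3⟩
    refine ⟨fun x v => (h1 x v).smul a, fun x v => (h2 x v).smul a, fun x ψ hψ hc hs v => ?_⟩
    have e1 := h3 x ψ hψ hc hs v
    simp only [Prod.smul_mk, Submodule.coe_smul, coordForm_smul,
      ContinuousAlternatingMap.smul_apply, smul_eq_mul, mul_left_comm _ a, integral_const_mul]
      at e1 ⊢
    rw [e1, ← Finset.mul_sum, mul_neg]

/-- The graph of the maximal extension `d_max` of the exterior derivative: the pairs `(u, w)` in
`L²Ω^k × L²Ω^{k+1}` such that `w` is the distributional exterior derivative of `u`. -/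
def dMaxGraph [MeasurableSpace M] (g : BilinField I M) (k : ℕ) :
    Submodule ℝ (L2Form g k × L2Form g (k + 1)) :=
  (weakDerivPairs g k).map ((nullForms g k).mkQ.prodMap (nullForms g (k + 1)).mkQ)

/-- The kernel of `d_max` in degree `k`. -/
def dMaxKer [MeasurableSpace M] (g : BilinField I M) (k : ℕ) : Submodule ℝ (L2Form g k) :=
  (dMaxGraph g k).comap (LinearMap.inl ℝ _ _)

/-- The range of `d_max` in degree `k` (it is zero in degree `0`). -/
def dMaxRange [MeasurableSpace M] (g : BilinField I M) : ∀ k : ℕ, Submodule ℝ (L2Form g k)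
  | 0 => ⊥
  | k + 1 => (dMaxGraph g k).map (LinearMap.snd ℝ _ _)

/-- The maximal `L²` cohomology `H^k_{2,max}(M, g) = ker d_max / ran d_max`. -/
abbrev MaxL2Cohomology [MeasurableSpace M] (g : BilinField I M) (k : ℕ) : Type _ :=
  dMaxKer g k ⧸ (dMaxRange g k).submoduleOf (dMaxKer g k)

/-! ### The cone -/

/-- The interval `(0, 1)`, as a manifold of dimension one. -/
def interval01 : TopologicalSpace.Opens ℝ := ⟨Set.Ioo 0 1, isOpen_Ioo⟩

section Cone

/-- The cone metric `g_c = dr ⊗ dr + r^{2c} π^* g` on `(0, 1) × M`, where `r` and `π` are the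
projections to the factors. -/
def coneMetric (c : ℝ) (g : BilinField I M) :
    BilinField (𝓘(ℝ, ℝ).prod I) (interval01 × M) := fun q =>
  let dr : TangentSpace (𝓘(ℝ, ℝ).prod I) q →L[ℝ] ℝ :=
    mfderiv (𝓘(ℝ, ℝ).prod I) 𝓘(ℝ, ℝ) (fun p : interval01 × M => (p.1 : ℝ)) q
  let dπ : TangentSpace (𝓘(ℝ, ℝ).prod I) q →L[ℝ] TangentSpace I q.2 :=
    mfderiv (𝓘(ℝ, ℝ).prod I) I (Prod.snd : interval01 × M → M) q
  pullbackBilin (ContinuousLinearMap.mul ℝ ℝ) dr +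
    ((q.1 : ℝ) ^ (2 * c)) • pullbackBilin (g q.2) dπ

end Cone

end L2deRham

end

open L2deRham

/-! Put `w_k = c (f - 2k)`. A `k`-form pulled back from `F` satisfies `|π^*ξ|² = r^{-2ck} |ξ|²`, and
the volume of the cone is `r^{cf} dr dvol_g`. Hence `r^{w_k}` is the weight with which the
tangential part of a `k`-form enters its `L²` norm; it is also the weight of the radial part of a
`(k+1)`-form, since `∂_r` has length one. Case 1 is the condition `w_i > -1`. Case 2 says that `w_i
≤ -1` and `w_{i-1} < 1`.

Case 1. Take a smooth cutoff `X`, equal to `1` near `0` and to `0` near `1`, and let `χ = -X'`. The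
average `avg ω = ∫ χ(s) ω_s ds` of the slices is bounded in `L²`, because `χ` lives away from both
ends; it commutes with `d` and is a left inverse of `π^*`, which is bounded exactly because `w_i >
-1`. For a closed form of positive degree, `ω - π^* avg ω = d K ω`, where `K ω (r) = ∫ (1_{s<r} -
X(s)) (∂_r ⌟ ω)(s) ds`. The kernel of `K` is bounded and vanishes for `s < a r`, where `X = 1` on
`(-∞, a]`. Therefore its square is integrable against `r^w s^{-w}` for every `w > -1`, in particular
for `w = w_{i-1} > w_i`, and Cauchy–Schwarz along the rays bounds `K`. A closed function is almost
everywhere the pullback of its average. So `π^*` induces an isomorphism on cohomology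
(`isExactForm_pull_iff`, `isExactForm_sub_pull_avgForm`).

Case 2. Take `X = 0`, so that `K` integrates from the tip. Its boundedness now comes from `∫ s^{-w}
ds < ∞` with `w = w_{i-1} < 1`. The formula `ω = d K ω` would have a boundary term at `r = 0`. It is
reached as the limit of the previous formula for the cutoffs `X((n+1)s)`, and the error `∫ X_n' ω_s`
tends to zero because `w_i ≤ -1` makes `s⁻¹ |ω_s|²` locally integrable (`tendsto_cutoff_error`,
`weakDeriv_homFlat_zero`).

No form is ever smoothed. In a chart `(0,1) × U` the identities hold in the sense of distributions
and are proved by duality: the transpose `testKern` of `K` sends test functions to test functions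
when `X` is a cutoff, and its partial derivatives are explicit. The operators are defined on the
manifold by integrals in the radial variable only, and so are compatible with all charts of `F`. The
estimates use that the volume of the cone is, up to a constant, a product measure. -/

noncomputable section

namespace L2deRham

/-! ### Pointwise norms of alternating forms -/

section LinearAlgebra

variable {V : Type*} [AddCommGroup V] [Module ℝ V] [TopologicalSpace V]

/-- A symmetric positive definite bilinear form. -/
structure IsInnerForm (B : V →L[ℝ] V →L[ℝ] ℝ) : Prop where
  symm : ∀ v w, B v w = B w v
  pos : ∀ v, v ≠ 0 → 0 < B v v

theorem IsInnerForm.nonneg {B : V →L[ℝ] V →L[ℝ] ℝ} (hB : IsInnerForm B) (v : V) : 0 ≤ B v v := by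
  by_cases h : v = 0
  · simp [h]
  · exact (hB.pos v h).le

/-- `formNormSq` is a supremum over orthonormal frames, so a bound from below needs one frame.
Taking `B` itself as the inner product reduces this to the standard orthonormal basis; only
algebraic facts about it are kept. -/
theorem IsInnerForm.exists_orthonormal_basis [FiniteDimensional ℝ V] {B : V →L[ℝ] V →L[ℝ] ℝ}
    (hB : IsInnerForm B) :
    ∃ e : Module.Basis (Fin (Module.finrank ℝ V)) ℝ V,
      ∀ a b, B (e a) (e b) = if a = b then 1 else 0 := by
  let core : InnerProductSpace.Core ℝ V :=
    { inner := fun v w => B v w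
      conj_inner_symm := fun v w => by simpa using hB.symm w v
      re_inner_nonneg := fun v => by simpa using hB.nonneg v
      add_left := fun u v w => by simp
      smul_left := fun u v r => by simp
      definite := fun v h => by
        by_contra hne
        exact absurd h (hB.pos v hne).ne' }
  let _ : NormedAddCommGroup V := core.toNormedAddCommGroup
  let _ : InnerProductSpace ℝ V := InnerProductSpace.ofCore core.toCore
  refine ⟨(stdOrthonormalBasis ℝ V).toBasis, fun a b => ?_⟩
  have := orthonormal_iff_ite.1 (stdOrthonormalBasis ℝ V).orthonormal a b
  rw [OrthonormalBasis.coe_toBasis]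
  exact this

theorem sum_repr_sq_eq {B : V →L[ℝ] V →L[ℝ] ℝ} {ι : Type*}
    [Fintype ι] [DecidableEq ι] (e : Module.Basis ι ℝ V)
    (he : ∀ a b, B (e a) (e b) = if a = b then 1 else 0) (v : V) :
    ∑ a, (e.repr v a) ^ 2 = B v v := by
  have h : B v v = B (∑ a, e.repr v a • e a) (∑ a, e.repr v a • e a) := by rw [e.sum_repr]
  rw [h]
  simp only [map_sum, map_smul, sum_apply, smul_apply,
    smul_eq_mul, he]
  simp [pow_two]

theorem map_eq_sum_basis {k : ℕ} {ι : Type*} [Fintype ι] [DecidableEq ι]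
    (e : Module.Basis ι ℝ V) (α : V [⋀^Fin k]→ₗ[ℝ] ℝ) (v : Fin k → V) :
    α v = ∑ s : Fin k → ι, (∏ j, e.repr (v j) (s j)) * α (fun j => e (s j)) := by
  have h := α.toMultilinearMap.map_sum (fun j (a : ι) => e.repr (v j) a • e a)
  simp only [e.sum_repr, AlternatingMap.coe_multilinearMap] at h
  rw [h]
  refine Finset.sum_congr rfl fun s _ => ?_
  rw [← smul_eq_mul, ← α.coe_multilinearMap, ← MultilinearMap.map_smul_univ]

/-- Expand `α v` in an orthonormal basis and apply Cauchy–Schwarz. By Parseval the squared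
coefficients sum to `∏ B (v j) (v j)`, and `k!` undoes the normalisation in `formNormSq`. -/
theorem apply_sq_le_formNormSq [FiniteDimensional ℝ V] {B : V →L[ℝ] V →L[ℝ] ℝ}
    (hB : IsInnerForm B) {k : ℕ} (α : V [⋀^Fin k]→L[ℝ] ℝ) (v : Fin k → V) :
    ENNReal.ofReal (α v ^ 2) ≤ (k ! : ℝ≥0∞) * ENNReal.ofReal (∏ j, B (v j) (v j)) *
      formNormSq B α := by
  obtain ⟨e, he⟩ := hB.exists_orthonormal_basis
  have h1 : ENNReal.ofReal
      ((∑ s : Fin k → Fin (Module.finrank ℝ V), α (fun j => e (s j)) ^ 2) / (k ! : ℝ)) ≤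
      formNormSq B α := le_iSup₂ (f := fun (e : Fin (Module.finrank ℝ V) → V)
    (_ : ∀ a b, B (e a) (e b) = if a = b then 1 else 0) => ENNReal.ofReal
      ((∑ s : Fin k → Fin (Module.finrank ℝ V), α (fun j => e (s j)) ^ 2) / (k ! : ℝ))) e he
  refine le_trans ?_ (mul_le_mul_right h1 _)
  have hP : 0 ≤ ∏ j, B (v j) (v j) := Finset.prod_nonneg fun j _ => hB.nonneg _
  rw [← ENNReal.ofReal_natCast, ← ENNReal.ofReal_mul (by positivity),
    ← ENNReal.ofReal_mul (by positivity)]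
  refine ENNReal.ofReal_le_ofReal ?_
  have h2 := map_eq_sum_basis e α.toAlternatingMap v
  simp only [ContinuousAlternatingMap.coe_toAlternatingMap] at h2
  have h3 : ∏ j, B (v j) (v j) =
      ∑ s : Fin k → Fin (Module.finrank ℝ V), (∏ j, e.repr (v j) (s j)) ^ 2 := by
    simp only [← sum_repr_sq_eq e he, Finset.prod_univ_sum, Fintype.piFinset_univ, Finset.prod_pow]
  rw [h2, h3]
  refine (Finset.sum_mul_sq_le_sq_mul_sq _ _ _).trans (le_of_eq ?_)
  have : (k ! : ℝ) ≠ 0 := by positivity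
  field_simp

/-- A crude converse, sufficient because only finiteness of integrals matters: `1 / k!` is dropped
and the power of the dimension counts the tuples of frame vectors. -/
theorem formNormSq_le {B : V →L[ℝ] V →L[ℝ] ℝ} {k : ℕ} (α : V [⋀^Fin k]→L[ℝ] ℝ) (c : ℝ≥0∞)
    (h : ∀ v : Fin k → V, (∀ j, B (v j) (v j) = 1) → ENNReal.ofReal (α v ^ 2) ≤ c) :
    formNormSq B α ≤ (Module.finrank ℝ V : ℝ≥0∞) ^ k * c := by
  refine iSup₂_le fun e he => ?_
  have h1 : (∑ s : Fin k → Fin (Module.finrank ℝ V), α (fun j => e (s j)) ^ 2) / (k ! : ℝ) ≤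
      ∑ s : Fin k → Fin (Module.finrank ℝ V), α (fun j => e (s j)) ^ 2 :=
    div_le_self (Finset.sum_nonneg fun _ _ => sq_nonneg _)
      (by exact_mod_cast Nat.one_le_iff_ne_zero.2 k.factorial_ne_zero)
  refine (ENNReal.ofReal_le_ofReal h1).trans ?_
  rw [ENNReal.ofReal_sum_of_nonneg fun _ _ => sq_nonneg _]
  refine (Finset.sum_le_card_nsmul _ _ c fun s _ => h _ fun j => by simp [he]).trans ?_
  simp

end LinearAlgebra

/-! ### Forms on `ℝ × E` for a warped metric -/

section ProductForms

variable {E : Type*} [NormedAddCommGroup E] [NormedSpace ℝ E]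

/-- The metric `dr² + ρ B` on `ℝ × E`. -/
def warpedForm (ρ : ℝ) (B : E →L[ℝ] E →L[ℝ] ℝ) : (ℝ × E) →L[ℝ] (ℝ × E) →L[ℝ] ℝ :=
  pullbackBilin (ContinuousLinearMap.mul ℝ ℝ) (ContinuousLinearMap.fst ℝ ℝ E) +
    ρ • pullbackBilin B (ContinuousLinearMap.snd ℝ ℝ E)

theorem warpedForm_apply (ρ : ℝ) (B : E →L[ℝ] E →L[ℝ] ℝ) (v w : ℝ × E) :
    warpedForm ρ B v w = v.1 * w.1 + ρ * B v.2 w.2 := rfl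

theorem isInnerForm_warpedForm {ρ : ℝ} (hρ : 0 < ρ) {B : E →L[ℝ] E →L[ℝ] ℝ} (hB : IsInnerForm B) :
    IsInnerForm (warpedForm ρ B) where
  symm v w := by simp only [warpedForm_apply, hB.symm v.2 w.2, mul_comm]
  pos := by
    rintro ⟨t, v⟩ h
    rw [warpedForm_apply]
    by_cases hv : v = 0
    · have ht : t ≠ 0 := by rintro rfl; exact h (by simp [hv])
      have := mul_self_pos.2 ht
      simpa [hv] using this
    · have := mul_pos hρ (hB.pos v hv)
      have := mul_self_nonneg t
      simp only
      linarith

/-- The restriction of a form on `ℝ × E` to `E`. -/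
def sliceForm {k : ℕ} (η : (ℝ × E) [⋀^Fin k]→L[ℝ] ℝ) : E [⋀^Fin k]→L[ℝ] ℝ :=
  η.compContinuousLinearMap (ContinuousLinearMap.inr ℝ ℝ E)

/-- The form on `E` obtained by contracting a form on `ℝ × E` with `∂_r`. -/
def radialForm {k : ℕ} (η : (ℝ × E) [⋀^Fin (k + 1)]→L[ℝ] ℝ) : E [⋀^Fin k]→L[ℝ] ℝ :=
  sliceForm (η.curryLeft (1, 0))

/-- The pullback to `ℝ × E` of a form on `E`. -/
def cylForm {k : ℕ} (θ : E [⋀^Fin k]→L[ℝ] ℝ) : (ℝ × E) [⋀^Fin k]→L[ℝ] ℝ :=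
  θ.compContinuousLinearMap (ContinuousLinearMap.snd ℝ ℝ E)

@[simp] theorem sliceForm_apply {k : ℕ} (η : (ℝ × E) [⋀^Fin k]→L[ℝ] ℝ) (v : Fin k → E) :
    sliceForm η v = η (fun j => (0, v j)) := rfl

theorem radialForm_apply {k : ℕ} (η : (ℝ × E) [⋀^Fin (k + 1)]→L[ℝ] ℝ) (v : Fin k → E) :
    radialForm η v = η (Fin.cons (1, 0) (fun j => (0, v j))) := rfl

@[simp] theorem cylForm_apply {k : ℕ} (θ : E [⋀^Fin k]→L[ℝ] ℝ) (v : Fin k → ℝ × E) :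
    cylForm θ v = θ (fun j => (v j).2) := rfl

@[simp] theorem sliceForm_cylForm {k : ℕ} (θ : E [⋀^Fin k]→L[ℝ] ℝ) :
    sliceForm (cylForm θ) = θ := rfl

theorem cylForm_cons {k : ℕ} (θ : E [⋀^Fin (k + 1)]→L[ℝ] ℝ) (v : Fin k → E) :
    cylForm θ (Fin.cons (1, 0) (fun j => (0, v j))) = 0 :=
  θ.map_coord_zero 0 rfl

/-- An alternating form on `ℝ × E` is determined by its values on tuples of vectors of `E` and on
tuples consisting of `∂_r` and vectors of `E`. -/
theorem alternating_eq_zero_of_prod [FiniteDimensional ℝ E] {k : ℕ}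
    (T : (ℝ × E) [⋀^Fin (k + 1)]→ₗ[ℝ] ℝ)
    (h0 : ∀ v : Fin (k + 1) → E, T (fun j => (0, v j)) = 0)
    (h1 : ∀ v : Fin k → E, T (Fin.cons (1, 0) (fun j => (0, v j))) = 0) : T = 0 := by
  let b : Module.Basis (Unit ⊕ Fin (Module.finrank ℝ E)) ℝ (ℝ × E) :=
    (Module.Basis.singleton Unit ℝ).prod (Module.finBasis ℝ E)
  have key : ∀ v : Fin (k + 1) → Unit ⊕ Fin (Module.finrank ℝ E), Function.Injective v →
      v 0 = Sum.inl () → T (fun i => b (v i)) = 0 := by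
    intro v hv h
    have : (fun i => b (v i)) = Fin.cons (1, 0) (fun j : Fin k => (0, (b (v j.succ)).2)) := by
      refine funext fun i => ?_
      refine Fin.cases ?_ (fun j => ?_) i
      · simp [h, b]
      · have hj : v j.succ ≠ Sum.inl () := fun hh => Fin.succ_ne_zero j (hv (hh.trans h.symm))
        rcases hvj : v j.succ with u | a
        · exact absurd hvj hj
        · simp [hvj, b]
    rw [this]
    exact h1 _
  refine b.ext_alternating fun v hv => ?_
  rw [AlternatingMap.zero_apply]
  by_cases hex : ∃ j, v j = Sum.inl ()
  · obtain ⟨j, hj⟩ := hex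
    by_cases hj0 : j = 0
    · exact key v hv (hj0 ▸ hj)
    -- A tuple of distinct basis vectors contains `∂_r` at most once; a transposition brings it to
    -- the first slot at the cost of a sign.
    · have hs := T.map_swap (fun i => b (v i)) (i := 0) (j := j) (Ne.symm hj0)
      have := key (v ∘ Equiv.swap 0 j) (hv.comp (Equiv.injective _)) (by simpa using hj)
      have e : (fun i => b (v i)) ∘ Equiv.swap 0 j = fun i => b ((v ∘ Equiv.swap 0 j) i) := rfl
      rw [e, this] at hs
      linarith
  · push Not at hex
    have : (fun i => b (v i)) = fun j => (0, (b (v j)).2) := by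
      funext j
      rcases hvj : v j with u | a
      · exact absurd hvj (hex j)
      · simp [b]
    rw [this]
    exact h0 _

variable [FiniteDimensional ℝ E]

/-- Each of the `k` vectors `(0, v j)` has squared length `ρ B (v j) (v j)`, whence the factor `ρ ^
k`. -/
theorem slice_sq_le {ρ : ℝ} (hρ : 0 < ρ) {B : E →L[ℝ] E →L[ℝ] ℝ} (hB : IsInnerForm B) {k : ℕ}
    (η : (ℝ × E) [⋀^Fin k]→L[ℝ] ℝ) (v : Fin k → E) :
    ENNReal.ofReal (sliceForm η v ^ 2) ≤ (k ! : ℝ≥0∞) * ENNReal.ofReal (∏ j, B (v j) (v j)) *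
      (ENNReal.ofReal (ρ ^ k) * formNormSq (warpedForm ρ B) η) := by
  refine (apply_sq_le_formNormSq (isInnerForm_warpedForm hρ hB) η (fun j => (0, v j))).trans
    (le_of_eq ?_)
  simp only [warpedForm_apply, mul_zero, zero_add, Finset.prod_mul_distrib, Finset.prod_const,
    Finset.card_univ, Fintype.card_fin]
  rw [ENNReal.ofReal_mul (by positivity)]
  ring

/-- Since `∂_r` has length one, a form of degree `k + 1` produces only `ρ ^ k` here. This shift by
one degree is the source of the two different exponents in the theorem. -/
theorem radial_sq_le {ρ : ℝ} (hρ : 0 < ρ) {B : E →L[ℝ] E →L[ℝ] ℝ} (hB : IsInnerForm B) {k : ℕ}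
    (η : (ℝ × E) [⋀^Fin (k + 1)]→L[ℝ] ℝ) (v : Fin k → E) :
    ENNReal.ofReal (radialForm η v ^ 2) ≤
      ((k + 1) ! : ℝ≥0∞) * ENNReal.ofReal (∏ j, B (v j) (v j)) *
      (ENNReal.ofReal (ρ ^ k) * formNormSq (warpedForm ρ B) η) := by
  refine (apply_sq_le_formNormSq (isInnerForm_warpedForm hρ hB) η
    (Fin.cons (1, 0) (fun j => (0, v j)))).trans (le_of_eq ?_)
  simp only [warpedForm_apply, Fin.prod_univ_succ, Fin.cons_zero, Fin.cons_succ, mul_zero, zero_add,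
    Finset.prod_mul_distrib, Finset.prod_const, Finset.card_univ, Fintype.card_fin, map_zero,
    add_zero, mul_one, one_mul]
  rw [ENNReal.ofReal_mul (by positivity)]
  ring

/-- The `E`-component of a unit vector of `dr² + ρ B` has squared `B`-length at most `ρ⁻¹`. -/
theorem formNormSq_cylForm_le {ρ : ℝ} (hρ : 0 < ρ) {B : E →L[ℝ] E →L[ℝ] ℝ} (hB : IsInnerForm B)
    {k : ℕ} (θ : E [⋀^Fin k]→L[ℝ] ℝ) :
    formNormSq (warpedForm ρ B) (cylForm θ) ≤
      ((Module.finrank ℝ (ℝ × E) : ℝ≥0∞) ^ k * (k ! : ℝ≥0∞)) *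
        (ENNReal.ofReal ((ρ ^ k)⁻¹) * formNormSq B θ) := by
  rw [mul_assoc]
  refine formNormSq_le _ _ fun v hv => ?_
  refine (apply_sq_le_formNormSq hB θ (fun j => (v j).2)).trans ?_
  rw [mul_assoc]
  gcongr
  calc ∏ j, B (v j).2 (v j).2 ≤ ∏ _j : Fin k, ρ⁻¹ := by
        refine Finset.prod_le_prod (fun j _ => hB.nonneg _) fun j _ => ?_
        have h1 := hv j
        rw [warpedForm_apply] at h1
        have h2 := mul_self_nonneg (v j).1
        rw [← one_div, le_div_iff₀ hρ]
        linarith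
    _ = (ρ ^ k)⁻¹ := by simp

end ProductForms

/-! ### Integrals of families of forms -/

section IntegralForms

variable {E : Type*} [NormedAddCommGroup E] [NormedSpace ℝ E] [FiniteDimensional ℝ E]
  {Ω : Type*} [MeasurableSpace Ω]

theorem continuous_alternatingMap {k : ℕ} (α : E [⋀^Fin k]→ₗ[ℝ] ℝ) : Continuous α := by
  have h : (α : (Fin k → E) → ℝ) = fun v => ∑ s : Fin k → Fin (Module.finrank ℝ E),
      (∏ j, (Module.finBasis ℝ E).repr (v j) (s j)) * α (fun j => Module.finBasis ℝ E (s j)) :=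
    funext fun v => map_eq_sum_basis _ _ _
  rw [h]
  refine continuous_finsetSum _ fun s _ => Continuous.mul (continuous_finsetProd _ fun j _ => ?_)
    continuous_const
  exact (LinearMap.continuous_of_finiteDimensional ((Module.finBasis ℝ E).coord (s j))).comp
    (continuous_apply j)

open Classical in
/-- The integral of a family of alternating forms all of whose coefficients are integrable (and zero
otherwise). -/
def intForm {k : ℕ} (ν : Measure Ω) (a : Ω → E [⋀^Fin k]→L[ℝ] ℝ) : E [⋀^Fin k]→L[ℝ] ℝ :=
  if h : ∀ v, Integrable (fun s => a s v) ν then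
    let A : E [⋀^Fin k]→ₗ[ℝ] ℝ :=
      { toFun := fun v => ∫ s, a s v ∂ν
        map_update_add' := fun v i x y => by
          simp only [ContinuousAlternatingMap.map_update_add]
          exact integral_add (h _) (h _)
        map_update_smul' := fun v i c x => by
          simp only [ContinuousAlternatingMap.map_update_smul]
          exact integral_smul c _
        map_eq_zero_of_eq' := fun v i j hv hij => by
          simp only [ContinuousAlternatingMap.map_eq_zero_of_eq _ v hv hij]
          exact integral_zero _ _ }
    { A with cont := continuous_alternatingMap A }
  else 0

theorem intForm_apply {k : ℕ} {ν : Measure Ω} {a : Ω → E [⋀^Fin k]→L[ℝ] ℝ}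
    (h : ∀ v, Integrable (fun s => a s v) ν) (v : Fin k → E) :
    intForm ν a v = ∫ s, a s v ∂ν := by
  rw [intForm, dif_pos h]
  rfl

theorem intForm_of_not {k : ℕ} {ν : Measure Ω} {a : Ω → E [⋀^Fin k]→L[ℝ] ℝ}
    (h : ¬ ∀ v, Integrable (fun s => a s v) ν) : intForm ν a = 0 := by
  rw [intForm, dif_neg h]

/-- Compatibility with changes of coordinates. Invertibility of `A` is what makes the default value
`0` compatible as well: the pulled back family has integrable coefficients only if the original one
does. -/
theorem intForm_comp {k : ℕ} {ν : Measure Ω} (a : Ω → E [⋀^Fin k]→L[ℝ] ℝ) (A : E ≃L[ℝ] E) :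
    (intForm ν a).compContinuousLinearMap (A : E →L[ℝ] E) =
      intForm ν (fun s => (a s).compContinuousLinearMap (A : E →L[ℝ] E)) := by
  by_cases h : ∀ v, Integrable (fun s => a s v) ν
  · ext v
    have h1 := intForm_apply (ν := ν)
      (a := fun s => (a s).compContinuousLinearMap (A : E →L[ℝ] E)) (fun v => h _) v
    rw [h1]
    exact intForm_apply h _
  · rw [intForm_of_not h, intForm_of_not]
    · rfl
    · intro h'
      refine h fun v => ?_
      have := h' (fun j => A.symm (v j))
      have e : (A ∘ fun j => A.symm (v j)) = v := by ext j; simp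
      simpa [e] using this

theorem intForm_congr {k : ℕ} {ν : Measure Ω} {a b : Ω → E [⋀^Fin k]→L[ℝ] ℝ}
    (h : ∀ᵐ s ∂ν, a s = b s) : intForm ν a = intForm ν b := by
  have h' : ∀ v, (fun s => a s v) =ᵐ[ν] fun s => b s v := fun v => h.mono fun s hs => by simp [hs]
  by_cases hb : ∀ v, Integrable (fun s => b s v) ν
  · ext v
    rw [intForm_apply hb, intForm_apply fun v => (hb v).congr (h' v).symm]
    exact integral_congr_ae (h' v)
  · rw [intForm_of_not hb, intForm_of_not]
    exact fun ha => hb fun v => (ha v).congr (h' v)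

theorem integrable_of_basis {k : ℕ} {ν : Measure Ω} {a : Ω → E [⋀^Fin k]→L[ℝ] ℝ}
    (h : ∀ s : Fin k → Fin (Module.finrank ℝ E),
      Integrable (fun p => a p (fun j => Module.finBasis ℝ E (s j))) ν) (v : Fin k → E) :
    Integrable (fun p => a p v) ν := by
  have e : (fun p => a p v) = fun p => ∑ s : Fin k → Fin (Module.finrank ℝ E),
      (∏ j, (Module.finBasis ℝ E).repr (v j) (s j)) * a p (fun j => Module.finBasis ℝ E (s j)) :=
    funext fun p => map_eq_sum_basis _ (a p).toAlternatingMap v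
  rw [e]
  exact integrable_finsetSum _ fun s _ => (h s).const_mul _

variable {Y : Type*} [MeasurableSpace Y]

/-- Fubini gives one exceptional null set for each `v`. Finitely many tuples of basis vectors
determine a form, so a single null set serves all `v`. -/
theorem ae_intForm_apply {k : ℕ} {ν : Measure Ω} [SFinite ν] {τ : Measure Y} [SFinite τ]
    {a : Ω → Y → E [⋀^Fin k]→L[ℝ] ℝ}
    (h : ∀ v, Integrable (fun p : Ω × Y => a p.1 p.2 v) (ν.prod τ)) :
    ∀ᵐ y ∂τ, ∀ v, intForm ν (fun s => a s y) v = ∫ s, a s y v ∂ν := by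
  have h1 : ∀ᵐ y ∂τ, ∀ s : Fin k → Fin (Module.finrank ℝ E),
      Integrable (fun p => a p y (fun j => Module.finBasis ℝ E (s j))) ν :=
    ae_all_iff.2 fun s => (h _).prod_left_ae
  filter_upwards [h1] with y hy v
  exact intForm_apply (integrable_of_basis hy) v

theorem integrable_intForm {k : ℕ} {ν : Measure Ω} [SFinite ν] {τ : Measure Y} [SFinite τ]
    {a : Ω → Y → E [⋀^Fin k]→L[ℝ] ℝ}
    (h : ∀ v, Integrable (fun p : Ω × Y => a p.1 p.2 v) (ν.prod τ)) (v : Fin k → E) :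
    Integrable (fun y => intForm ν (fun s => a s y) v) τ :=
  (h v).integral_prod_right.congr
    ((ae_intForm_apply h).mono fun _ hy => (hy v).symm)

/-- A pointwise bound for the norm of an integral of forms, from the Cauchy–Schwarz inequality. -/
theorem formNormSq_intForm_le {k : ℕ} {ν : Measure Ω} (B : E →L[ℝ] E →L[ℝ] ℝ) (κ : Ω → ℝ)
    (hκ : Measurable κ) (ρ : Ω → ℝ) (hρ : Measurable ρ) (hpos : ∀ᵐ s ∂ν, 0 < ρ s)
    (b : Ω → E [⋀^Fin k]→L[ℝ] ℝ) (h : Ω → ℝ≥0∞) (hm : AEMeasurable h ν)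
    (hb : ∀ᵐ s ∂ν, ∀ v : Fin k → E, (∀ j, B (v j) (v j) = 1) → ENNReal.ofReal (b s v ^ 2) ≤ h s) :
    formNormSq B (intForm ν fun s => κ s • b s) ≤
      (Module.finrank ℝ E : ℝ≥0∞) ^ k *
        ((∫⁻ s, ENNReal.ofReal (κ s ^ 2 * (ρ s)⁻¹) ∂ν) * ∫⁻ s, ENNReal.ofReal (ρ s) * h s ∂ν) := by
  refine formNormSq_le _ _ fun v hv => ?_
  -- If some coefficient is not integrable, `intForm` is zero and the bound is trivial.
  by_cases hi : ∀ v, Integrable (fun s => (κ s • b s) v) ν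
  swap
  · rw [intForm_of_not hi]; simp
  rw [intForm_apply hi]
  -- Cauchy–Schwarz for the splitting `|κ b| = (|κ| ρ^{-1/2}) (ρ^{1/2} |b|)`, with a weight `ρ` to
  -- be chosen later.
  have hCS := ENNReal.lintegral_mul_le_Lp_mul_Lq ν Real.HolderConjugate.two_two
    (f := fun s => ENNReal.ofReal (κ s ^ 2 * (ρ s)⁻¹) ^ (1 / 2 : ℝ))
    (g := fun s => (ENNReal.ofReal (ρ s) * h s) ^ (1 / 2 : ℝ))
    (by fun_prop) (by fun_prop)
  have e2 : ∀ x : ℝ≥0∞, (x ^ (1 / 2 : ℝ)) ^ (2 : ℝ) = x := fun x => by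
    rw [← ENNReal.rpow_mul]; norm_num
  simp only [e2, Pi.mul_apply] at hCS
  have h1 : ‖∫ s, (κ s • b s) v ∂ν‖ₑ ≤ ∫⁻ s, ENNReal.ofReal (κ s ^ 2 * (ρ s)⁻¹) ^ (1 / 2 : ℝ) *
      (ENNReal.ofReal (ρ s) * h s) ^ (1 / 2 : ℝ) ∂ν := by
    refine (enorm_integral_le_lintegral_enorm _).trans (lintegral_mono_ae ?_)
    filter_upwards [hpos, hb] with s hs hbs
    have h2 := hbs v hv
    rw [← ENNReal.mul_rpow_of_nonneg _ _ (by norm_num)]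
    have h3 : ‖(κ s • b s) v‖ₑ = (ENNReal.ofReal (κ s ^ 2 * b s v ^ 2)) ^ (1 / 2 : ℝ) := by
      rw [ENNReal.ofReal_rpow_of_nonneg (by positivity) (by norm_num), ← mul_pow,
        ← Real.sqrt_eq_rpow, Real.sqrt_sq_eq_abs, ← Real.norm_eq_abs, ofReal_norm]
      rfl
    rw [h3]
    refine ENNReal.rpow_le_rpow ?_ (by norm_num)
    calc ENNReal.ofReal (κ s ^ 2 * b s v ^ 2)
        = ENNReal.ofReal (κ s ^ 2 * (ρ s)⁻¹) * (ENNReal.ofReal (ρ s) *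
            ENNReal.ofReal (b s v ^ 2)) := by
          rw [← ENNReal.ofReal_mul hs.le, ← ENNReal.ofReal_mul (by positivity)]
          congr 1
          field_simp
      _ ≤ _ := by gcongr
  have h4 : ENNReal.ofReal ((∫ s, (κ s • b s) v ∂ν) ^ 2) = ‖∫ s, (κ s • b s) v ∂ν‖ₑ ^ (2 : ℝ) := by
    rw [← ofReal_norm, ENNReal.ofReal_rpow_of_nonneg (norm_nonneg _) (by norm_num)]
    congr 1
    rw [Real.norm_eq_abs, Real.rpow_two, sq_abs]
  rw [h4]
  refine (ENNReal.rpow_le_rpow (h1.trans hCS) (by norm_num)).trans (le_of_eq ?_)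
  rw [ENNReal.mul_rpow_of_nonneg _ _ (by norm_num), e2, e2]

end IntegralForms

/-! ### Weak exterior derivative on open subsets of a vector space -/

section Weak

variable {W : Type*} [NormedAddCommGroup W] [NormedSpace ℝ W] [MeasurableSpace W]

/-- The coefficients of a form on an open subset of a vector space are locally integrable. -/
def LocInt {k : ℕ} (μ : Measure W) (U : Set W) (a : W → W [⋀^Fin k]→L[ℝ] ℝ) : Prop :=
  ∀ v, LocallyIntegrableOn (fun y => a y v) U μ

/-- A test function on `U`. -/
structure IsTest (U : Set W) (ψ : W → ℝ) : Prop where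
  smooth : ContDiff ℝ ∞ ψ
  compact : HasCompactSupport ψ
  supp : tsupport ψ ⊆ U

/-- The weak identity for `da = b` tested on the function `ψ` and the constant vectors `v`. -/
def WeakIdentity {k : ℕ} (μ : Measure W) (a : W → W [⋀^Fin k]→L[ℝ] ℝ)
    (b : W → W [⋀^Fin (k + 1)]→L[ℝ] ℝ) (ψ : W → ℝ) (v : Fin (k + 1) → W) : Prop :=
  ∫ y, ψ y * b y v ∂μ = -∑ j : Fin (k + 1), (-1 : ℝ) ^ (j : ℕ) *
    ∫ y, fderiv ℝ ψ y (v j) * a y (fun l => v (j.succAbove l)) ∂μ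

/-- `da = b` on `U` in the sense of distributions. -/
def WeakDeriv {k : ℕ} (μ : Measure W) (U : Set W) (a : W → W [⋀^Fin k]→L[ℝ] ℝ)
    (b : W → W [⋀^Fin (k + 1)]→L[ℝ] ℝ) : Prop :=
  LocInt μ U a ∧ LocInt μ U b ∧ ∀ ψ, IsTest U ψ → ∀ v, WeakIdentity μ a b ψ v

variable [BorelSpace W]

theorem IsTest.integrable_mul {U : Set W} {ψ : W → ℝ} (hψ : IsTest U ψ) {μ : Measure W} {u : W → ℝ}
    (hu : LocallyIntegrableOn u U μ) : Integrable (fun y => ψ y * u y) μ := by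
  have h1 : IntegrableOn u (tsupport ψ) μ := hu.integrableOn_compact_subset hψ.supp hψ.compact
  have h2 : IntegrableOn (fun y => ψ y * u y) (tsupport ψ) μ :=
    h1.continuousOn_mul hψ.smooth.continuous.continuousOn hψ.compact
  refine (integrableOn_iff_integrable_of_support_subset fun y hy => subset_tsupport ψ ?_).1 h2
  intro h
  exact hy (by simp [h])

theorem IsTest.fderiv {U : Set W} {ψ : W → ℝ} (hψ : IsTest U ψ) (w : W) :
    IsTest U (fun y => fderiv ℝ ψ y w) := by
  have hsub : tsupport (fun y => _root_.fderiv ℝ ψ y w) ⊆ tsupport ψ := by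
    refine closure_minimal (fun y hy => support_fderiv_subset ℝ (f := ψ) ?_) (isClosed_tsupport ψ)
    intro h
    exact hy (by simp [h])
  exact ⟨(hψ.smooth.fderiv_right (m := ∞) (by simp)).clm_apply contDiff_const,
    IsCompact.of_isClosed_subset hψ.compact (isClosed_tsupport _) hsub, hsub.trans hψ.supp⟩

theorem LocInt.congr_ae {k : ℕ} {μ : Measure W} {U : Set W} {a a' : W → W [⋀^Fin k]→L[ℝ] ℝ}
    (hU : MeasurableSet U) (h : LocInt μ U a) (he : ∀ᵐ y ∂μ, y ∈ U → a y = a' y) :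
    LocInt μ U a' := by
  intro v y hy
  obtain ⟨s, hs, hi⟩ := h v y hy
  refine ⟨s ∩ U, Filter.inter_mem hs self_mem_nhdsWithin, ?_⟩
  refine (hi.mono_set Set.inter_subset_left).congr ?_
  have h1 : ∀ᵐ y ∂(μ.restrict U), a y = a' y := (ae_restrict_iff' hU).2 he
  have h2 : ∀ᵐ y ∂(μ.restrict (s ∩ U)), a y = a' y :=
    h1.filter_mono (ae_mono (Measure.restrict_mono Set.inter_subset_right le_rfl))
  exact h2.mono fun y hy => by simp only [hy]

theorem IsTest.integral_congr_ae {U : Set W} {ψ : W → ℝ} (hψ : IsTest U ψ) {μ : Measure W}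
    {u u' : W → ℝ} (he : ∀ᵐ y ∂μ, y ∈ U → u y = u' y) :
    ∫ y, ψ y * u y ∂μ = ∫ y, ψ y * u' y ∂μ := by
  refine MeasureTheory.integral_congr_ae (he.mono fun y hy => ?_)
  beta_reduce
  by_cases h : ψ y = 0
  · simp [h]
  · rw [hy (hψ.supp (subset_tsupport ψ h))]

theorem WeakDeriv.congr_ae {k : ℕ} {μ : Measure W} {U : Set W} (hU : MeasurableSet U)
    {a a' : W → W [⋀^Fin k]→L[ℝ] ℝ} {b b' : W → W [⋀^Fin (k + 1)]→L[ℝ] ℝ}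
    (h : WeakDeriv μ U a b) (ha : ∀ᵐ y ∂μ, y ∈ U → a y = a' y)
    (hb : ∀ᵐ y ∂μ, y ∈ U → b y = b' y) : WeakDeriv μ U a' b' := by
  refine ⟨h.1.congr_ae hU ha, h.2.1.congr_ae hU hb, fun ψ hψ v => ?_⟩
  have h3 := h.2.2 ψ hψ v
  have e1 := hψ.integral_congr_ae (μ := μ) (u := fun y => b y v) (u' := fun y => b' y v)
    (hb.mono fun y hy hyU => by rw [hy hyU])
  unfold WeakIdentity at h3 ⊢
  rw [← e1, h3]
  congr 1
  refine Finset.sum_congr rfl fun j _ => ?_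
  congr 1
  exact (hψ.fderiv (v j)).integral_congr_ae (ha.mono fun y hy hyU => by rw [hy hyU])

/-- Both sides of the weak identity scale alike. This absorbs the constant between the model measure
of `ℝ × E`, which depends on a choice of basis, and the product measure. -/
theorem weakDeriv_smul_measure {k : ℕ} {μ : Measure W} {U : Set W} {a : W → W [⋀^Fin k]→L[ℝ] ℝ}
    {b : W → W [⋀^Fin (k + 1)]→L[ℝ] ℝ} {c : ℝ≥0∞} (hc0 : c ≠ 0) (hc : c ≠ ⊤) :
    WeakDeriv (c • μ) U a b ↔ WeakDeriv μ U a b := by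
  have hl : ∀ u : W → ℝ, LocallyIntegrableOn u U (c • μ) ↔ LocallyIntegrableOn u U μ := by
    intro u
    refine forall₂_congr fun y _ => exists_congr fun s => and_congr_right fun _ => ?_
    rw [IntegrableOn, Measure.restrict_smul, integrable_smul_measure hc0 hc]
    rfl
  unfold WeakDeriv LocInt WeakIdentity
  simp only [hl, integral_smul_measure, smul_eq_mul, mul_left_comm _ c.toReal, ← Finset.mul_sum]
  have hr : c.toReal ≠ 0 := ENNReal.toReal_ne_zero.2 ⟨hc0, hc⟩
  simp only [← mul_neg, mul_right_inj' hr]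

end Weak

/-! ### Reduction of weak identities on a product -/

section WeakProd

variable {E : Type*} [NormedAddCommGroup E] [NormedSpace ℝ E] [FiniteDimensional ℝ E]
  [MeasurableSpace E] [BorelSpace E]

/-- The weak identities on `ℝ × E` have to be checked only for tuples of vectors of `E`, and for
tuples consisting of `∂_r` and vectors of `E`. -/
theorem weakIdentity_of_prod {k : ℕ} {μ : Measure (ℝ × E)} {U : Set (ℝ × E)}
    {a : ℝ × E → (ℝ × E) [⋀^Fin k]→L[ℝ] ℝ} {b : ℝ × E → (ℝ × E) [⋀^Fin (k + 1)]→L[ℝ] ℝ}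
    (ha : LocInt μ U a) (hb : LocInt μ U b) {ψ : ℝ × E → ℝ} (hψ : IsTest U ψ)
    (h0 : ∀ v : Fin (k + 1) → E, WeakIdentity μ a b ψ (fun j => (0, v j)))
    (h1 : ∀ v : Fin k → E, WeakIdentity μ a b ψ (Fin.cons (1, 0) (fun j => (0, v j))))
    (v : Fin (k + 1) → ℝ × E) : WeakIdentity μ a b ψ v := by
  -- `T` is `ψ b + dψ ∧ a`. The weak identity at `v` says that the integral of `T` vanishes on `v`,
  -- and this integral is an alternating form, so it may be tested on the two kinds of tuples only.
  let T : ℝ × E → (ℝ × E) [⋀^Fin (k + 1)]→L[ℝ] ℝ := fun y => ψ y • b y +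
    ContinuousAlternatingMap.alternatizeUncurryFin ((fderiv ℝ ψ y).smulRight (a y))
  have hT : ∀ y v, T y v = ψ y * b y v + ∑ j : Fin (k + 1), (-1 : ℝ) ^ (j : ℕ) *
      (fderiv ℝ ψ y (v j) * a y (fun l => v (j.succAbove l))) := by
    intro y v
    simp only [T, ContinuousAlternatingMap.add_apply, ContinuousAlternatingMap.smul_apply,
      ContinuousAlternatingMap.alternatizeUncurryFin_apply, smul_eq_mul,
      ContinuousLinearMap.smulRight_apply, zsmul_eq_mul, Int.cast_pow, Int.cast_neg, Int.cast_one]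
    rfl
  have i1 : ∀ v, Integrable (fun y => ψ y * b y v) μ := fun v => hψ.integrable_mul (hb v)
  have i2 : ∀ (v : Fin (k + 1) → ℝ × E) (j : Fin (k + 1)), Integrable
      (fun y => (-1 : ℝ) ^ (j : ℕ) * (fderiv ℝ ψ y (v j) * a y (fun l => v (j.succAbove l)))) μ :=
    fun v j => ((hψ.fderiv (v j)).integrable_mul (ha _)).const_mul _
  have hi : ∀ v, Integrable (fun y => T y v) μ := by
    intro v
    simp only [hT]
    exact (i1 v).add (integrable_finsetSum _ fun j _ => i2 v j)
  have hI : ∀ v, intForm μ T v = ∫ y, ψ y * b y v ∂μ + ∑ j : Fin (k + 1), (-1 : ℝ) ^ (j : ℕ) *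
      ∫ y, fderiv ℝ ψ y (v j) * a y (fun l => v (j.succAbove l)) ∂μ := by
    intro v
    rw [intForm_apply hi]
    simp only [hT]
    rw [integral_add (i1 v) (integrable_finsetSum _ fun j _ => i2 v j),
      integral_finsetSum _ fun j _ => i2 v j]
    simp only [integral_const_mul]
  have hz : (intForm μ T).toAlternatingMap = 0 := by
    refine alternating_eq_zero_of_prod _ (fun v => ?_) (fun v => ?_)
    · have := h0 v
      unfold WeakIdentity at this
      rw [ContinuousAlternatingMap.coe_toAlternatingMap, hI, this]
      ring
    · have := h1 v
      unfold WeakIdentity at this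
      rw [ContinuousAlternatingMap.coe_toAlternatingMap, hI, this]
      ring
  have hv := hI v
  have : intForm μ T v = 0 := DFunLike.congr_fun hz v
  unfold WeakIdentity
  linarith

end WeakProd

/-! ### Pullback and averaging on the cylinder `(0,1) × U` -/

section Cylinder

variable {E : Type*} [NormedAddCommGroup E] [NormedSpace ℝ E] [FiniteDimensional ℝ E]
  [MeasurableSpace E] [BorelSpace E] {μ : Measure E} [μ.IsAddHaarMeasure] {U : Set E}

/-- The cylinder `(0, 1) × U`. -/
def cyl (U : Set E) : Set (ℝ × E) := Set.Ioo (0 : ℝ) 1 ×ˢ U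

theorem isOpen_cyl (hU : IsOpen U) : IsOpen (cyl U) := isOpen_Ioo.prod hU

theorem exists_box_of_isCompact {K' : Set (ℝ × E)} (hK : IsCompact K') (hs : K' ⊆ cyl U) :
    ∃ δ : ℝ, 0 < δ ∧ ∃ K ⊆ U, IsCompact K ∧ K' ⊆ Set.Icc δ (1 - δ) ×ˢ K := by
  rcases K'.eq_empty_or_nonempty with rfl | hne
  · exact ⟨1, one_pos, ∅, Set.empty_subset _, isCompact_empty, Set.empty_subset _⟩
  obtain ⟨p, hp, hpm⟩ := hK.exists_isMinOn hne continuous_fst.continuousOn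
  obtain ⟨q, hq, hqm⟩ := hK.exists_isMaxOn hne continuous_fst.continuousOn
  refine ⟨min p.1 (1 - q.1), lt_min (hs hp).1.1 (by linarith [(hs hq).1.2]), Prod.snd '' K', ?_,
    hK.image continuous_snd, fun z hz => ⟨⟨?_, ?_⟩, z, hz, rfl⟩⟩
  · rintro _ ⟨z, hz, rfl⟩
    exact (hs hz).2
  · exact (min_le_left _ _).trans (hpm hz)
  · have h1 : z.1 ≤ q.1 := hqm hz
    have h2 := min_le_right p.1 (1 - q.1)
    linarith

theorem Icc_subset_Ioo01 {δ : ℝ} (hδ : 0 < δ) : Set.Icc δ (1 - δ) ⊆ Set.Ioo 0 1 :=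
  fun _ ht => ⟨hδ.trans_le ht.1, ht.2.trans_lt (by linarith)⟩

theorem locallyIntegrableOn_cyl_iff (hU : IsOpen U) {u : ℝ × E → ℝ} {m : Measure (ℝ × E)} :
    LocallyIntegrableOn u (cyl U) m ↔
      ∀ δ : ℝ, 0 < δ → ∀ K ⊆ U, IsCompact K → IntegrableOn u (Set.Icc δ (1 - δ) ×ˢ K) m := by
  rw [locallyIntegrableOn_iff (isOpen_cyl hU).isLocallyClosed]
  refine ⟨fun h δ hδ K hKU hK => h _ ?_ (isCompact_Icc.prod hK), fun h K' hs hK' => ?_⟩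
  · exact Set.prod_mono (Icc_subset_Ioo01 hδ) hKU
  · obtain ⟨δ, hδ, K, hKU, hK, hsub⟩ := exists_box_of_isCompact hK' hs
    exact (h δ hδ K hKU hK).mono_set hsub

theorem IsTest.eq_zero {W : Type*} [NormedAddCommGroup W] [NormedSpace ℝ W] {U : Set W} {ψ : W → ℝ}
    (hψ : IsTest U ψ) {y : W} (hy : y ∉ U) : ψ y = 0 := by
  by_contra h
  exact hy (hψ.supp (subset_tsupport ψ h))

theorem IsTest.slice {ψ : ℝ × E → ℝ} (hψ : IsTest (cyl U) ψ) (t : ℝ) :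
    IsTest U (fun y => ψ (t, y)) := by
  have hsub : tsupport (fun y => ψ (t, y)) ⊆ (fun y => (t, y)) ⁻¹' tsupport ψ :=
    closure_minimal (fun y hy => subset_tsupport ψ hy)
      ((isClosed_tsupport ψ).preimage (by fun_prop))
  have hsub' : tsupport (fun y => ψ (t, y)) ⊆ Prod.snd '' tsupport ψ :=
    fun y hy => ⟨(t, y), hsub hy, rfl⟩
  exact ⟨hψ.smooth.comp (by fun_prop), IsCompact.of_isClosed_subset
    (hψ.compact.image continuous_snd) (isClosed_tsupport _) hsub',
    fun y hy => (hψ.supp (hsub hy)).2⟩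

theorem fderiv_slice {ψ : ℝ × E → ℝ} (hψ : Differentiable ℝ ψ) (t : ℝ) (y e : E) :
    fderiv ℝ (fun y => ψ (t, y)) y e = fderiv ℝ ψ (t, y) (0, e) := by
  have h1 : HasFDerivAt (fun y : E => ((t, y) : ℝ × E)) (ContinuousLinearMap.inr ℝ ℝ E) y :=
    hasFDerivAt_prodMk_right t y
  have h2 := (hψ (t, y)).hasFDerivAt.comp y h1
  have h3 : fderiv ℝ (fun y => ψ (t, y)) y = _ := h2.fderiv
  rw [h3]
  simp

theorem IsTest.vertical {ψ : ℝ × E → ℝ} (hψ : IsTest (cyl U) ψ) (y : E) :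
    IsTest (Set.Ioo (0 : ℝ) 1) (fun t => ψ (t, y)) := by
  have hsub : tsupport (fun t => ψ (t, y)) ⊆ (fun t => (t, y)) ⁻¹' tsupport ψ :=
    closure_minimal (fun y hy => subset_tsupport ψ hy)
      ((isClosed_tsupport ψ).preimage (by fun_prop))
  have hsub' : tsupport (fun t => ψ (t, y)) ⊆ Prod.fst '' tsupport ψ :=
    fun t ht => ⟨(t, y), hsub ht, rfl⟩
  exact ⟨hψ.smooth.comp (by fun_prop), IsCompact.of_isClosed_subset
    (hψ.compact.image continuous_fst) (isClosed_tsupport _) hsub',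
    fun t ht => (hψ.supp (hsub ht)).1⟩

theorem deriv_vertical {ψ : ℝ × E → ℝ} (hψ : Differentiable ℝ ψ) (t : ℝ) (y : E) :
    deriv (fun t => ψ (t, y)) t = fderiv ℝ ψ (t, y) (1, 0) := by
  have h1 : HasFDerivAt (fun t : ℝ => ((t, y) : ℝ × E)) (ContinuousLinearMap.inl ℝ ℝ E) t :=
    hasFDerivAt_prodMk_left t y
  have h2 := ((hψ (t, y)).hasFDerivAt.comp t h1).hasDerivAt
  have h3 : deriv (fun t => ψ (t, y)) t = _ := h2.deriv
  rw [h3]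
  simp

theorem IsTest.integral_deriv {χ : ℝ → ℝ} (hχ : IsTest (Set.Ioo (0 : ℝ) 1) χ) :
    ∫ t, deriv χ t = 0 := by
  have h1 := hχ.compact.integral_Ioi_deriv_eq (hχ.smooth.of_le (by simp)) 0
  have h2 := hχ.compact.integral_Iic_deriv_eq (hχ.smooth.of_le (by simp)) 0
  have h3 : Integrable (deriv χ) := (hχ.smooth.continuous_deriv
      (by simp)).integrable_of_hasCompactSupport
    hχ.compact.deriv
  rw [← integral_add_compl (measurableSet_Iic (a := (0 : ℝ))) h3, Set.compl_Iic, h1, h2]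
  ring

theorem IsTest.mul {χ : ℝ → ℝ} {ψ : E → ℝ} (hχ : IsTest (Set.Ioo (0 : ℝ) 1) χ) (hψ : IsTest U ψ) :
    IsTest (cyl U) (fun q => χ q.1 * ψ q.2) := by
  have hsub : tsupport (fun q : ℝ × E => χ q.1 * ψ q.2) ⊆ tsupport χ ×ˢ tsupport ψ := by
    refine closure_minimal (fun q hq => ?_) ((isClosed_tsupport χ).prod (isClosed_tsupport ψ))
    exact ⟨subset_tsupport χ (left_ne_zero_of_mul hq), subset_tsupport ψ (right_ne_zero_of_mul hq)⟩
  exact ⟨(hχ.smooth.comp contDiff_fst).mul (hψ.smooth.comp contDiff_snd),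
    IsCompact.of_isClosed_subset (hχ.compact.isCompact.prod hψ.compact.isCompact)
      (isClosed_tsupport _) hsub,
    hsub.trans (Set.prod_mono hχ.supp hψ.supp)⟩

theorem fderiv_mul_slice {χ : ℝ → ℝ} {ψ : E → ℝ} (hχ : IsTest (Set.Ioo (0 : ℝ) 1) χ)
    (hψ : IsTest U ψ) (q : ℝ × E) (e : E) :
    fderiv ℝ (fun q : ℝ × E => χ q.1 * ψ q.2) q (0, e) = χ q.1 * fderiv ℝ ψ q.2 e := by
  have hd : Differentiable ℝ (fun q : ℝ × E => χ q.1 * ψ q.2) :=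
    (hχ.mul hψ).smooth.differentiable (by simp)
  have h := fderiv_slice hd q.1 q.2 e
  rw [← h]
  have h2 := (hψ.smooth.differentiable (by simp) q.2).hasFDerivAt.const_mul (χ q.1)
  have h3 : fderiv ℝ (fun y => χ q.1 * ψ y) q.2 = _ := h2.fderiv
  simp only [h3]
  rfl

theorem locInt_cylForm (hU : IsOpen U) {k : ℕ} {a : E → E [⋀^Fin k]→L[ℝ] ℝ} (ha : LocInt μ U a) :
    LocInt (volume.prod μ) (cyl U) (fun q => cylForm (a q.2)) := by
  intro v
  rw [locallyIntegrableOn_cyl_iff hU]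
  intro δ _ K hKU hK
  have h1 : IntegrableOn (fun y => a y fun j => (v j).2) K μ :=
    (ha _).integrableOn_compact_subset hKU hK
  rw [IntegrableOn, ← Measure.prod_restrict]
  exact Integrable.comp_snd h1 _

/-- The pullback of forms to the cylinder commutes with the weak exterior derivative. -/
theorem weakDeriv_cylForm (hU : IsOpen U) {k : ℕ} {a : E → E [⋀^Fin k]→L[ℝ] ℝ}
    {b : E → E [⋀^Fin (k + 1)]→L[ℝ] ℝ} (h : WeakDeriv μ U a b) :
    WeakDeriv (volume.prod μ) (cyl U) (fun q => cylForm (a q.2)) (fun q => cylForm (b q.2)) := by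
  have la := locInt_cylForm hU h.1
  have lb := locInt_cylForm hU h.2.1
  refine ⟨la, lb, fun ψ hψ => weakIdentity_of_prod la lb hψ (fun v => ?_) (fun v => ?_)⟩
  · have e1 := integral_prod _ (hψ.integrable_mul (lb fun j => (0, v j)))
    have e2 := fun j => integral_prod _ ((hψ.fderiv ((0 : ℝ), v j)).integrable_mul
      (la fun l => (0, v (j.succAbove l))))
    have i2 := fun j => ((hψ.fderiv ((0 : ℝ), v j)).integrable_mul
      (la fun l => (0, v (j.succAbove l)))).integral_prod_left
    unfold WeakIdentity
    have e3 := integral_finsetSum Finset.univ fun j _ => (i2 j).const_mul ((-1 : ℝ) ^ (j : ℕ))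
    simp only [integral_const_mul, cylForm_apply] at e1 e2 e3 ⊢
    simp only [e2]
    rw [e1, ← e3, ← integral_neg]
    refine integral_congr_ae (Filter.Eventually.of_forall fun t => ?_)
    have h3 := h.2.2 _ (hψ.slice t) v
    unfold WeakIdentity at h3
    simp only [fderiv_slice (hψ.smooth.differentiable (by simp))] at h3
    exact h3
  · unfold WeakIdentity
    have z1 : ∀ y : ℝ × E, cylForm (b y.2) (Fin.cons (1, 0) fun j => (0, v j)) = 0 :=
      fun y => cylForm_cons _ _
    rw [Fin.sum_univ_succ]
    -- Deleting a slot other than the first leaves `∂_r` among the arguments, and a pullback from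
    -- `E` vanishes on it. Only the term with `∂_r ψ` remains, and that integrates to zero over `r`.
    have z2 : ∀ (j : Fin k) (y : ℝ × E), cylForm (a y.2) (fun l =>
        (Fin.cons (1, 0) fun j => (0, v j) : Fin (k + 1) → ℝ × E) (j.succ.succAbove l)) = 0 := by
      intro j y
      cases k with
      | zero => exact j.elim0
      | succ k => exact (a y.2).map_coord_zero 0 (by simp)
    simp only [z1, z2, mul_zero, integral_zero, Finset.sum_const_zero, add_zero, Fin.val_zero,
      pow_zero, one_mul, Fin.cons_zero, Fin.succAbove_zero, Fin.cons_succ, cylForm_apply]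
    have e1 := integral_prod_symm _ ((hψ.fderiv ((1 : ℝ), (0 : E))).integrable_mul
      (la fun l => (0, v l)))
    simp only [cylForm_apply] at e1
    symm
    rw [neg_eq_zero, e1]
    refine integral_eq_zero_of_ae (Filter.Eventually.of_forall fun y => ?_)
    simp only [← deriv_vertical (hψ.smooth.differentiable (by simp)),
      integral_mul_const, (hψ.vertical y).integral_deriv, zero_mul, Pi.zero_apply]

/-- The average `∫ χ(s) ω_s ds` of the slices of a form on the cylinder. -/
def avgFlat {k : ℕ} (χ : ℝ → ℝ) (η : ℝ × E → (ℝ × E) [⋀^Fin k]→L[ℝ] ℝ) (y : E) :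
    E [⋀^Fin k]→L[ℝ] ℝ :=
  intForm (volume.restrict (Set.Ioo 0 1)) (fun s => χ s • sliceForm (η (s, y)))

/-- The support of `χ` is compact in `(0, 1)`, so local integrability on the open cylinder is
enough, with no control near the ends. -/
theorem integrable_avg {k : ℕ} {χ : ℝ → ℝ} (hχ : IsTest (Set.Ioo (0 : ℝ) 1) χ)
    {η : ℝ × E → (ℝ × E) [⋀^Fin k]→L[ℝ] ℝ} (h : LocInt (volume.prod μ) (cyl U) η)
    {K : Set E} (hK : IsCompact K) (hKU : K ⊆ U) (v : Fin k → E) :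
    Integrable (fun p : ℝ × E => (χ p.1 • sliceForm (η (p.1, p.2))) v)
      ((volume.restrict (Set.Ioo 0 1)).prod (μ.restrict K)) := by
  rw [Measure.prod_restrict]
  have h1 : IntegrableOn (fun q => η q fun j => (0, v j)) (tsupport χ ×ˢ K) (volume.prod μ) :=
    (h _).integrableOn_compact_subset (Set.prod_mono hχ.supp hKU) (hχ.compact.isCompact.prod hK)
  have h2 : IntegrableOn (fun q : ℝ × E => χ q.1 * η q fun j => (0, v j)) (tsupport χ ×ˢ K)
      (volume.prod μ) := h1.continuousOn_mul (hχ.smooth.continuous.comp continuous_fst).continuousOn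
        (hχ.compact.isCompact.prod hK)
  refine h2.of_forall_sdiff_eq_zero (measurableSet_Ioo.prod hK.measurableSet) fun q hq => ?_
  have : χ q.1 = 0 := by
    by_contra h0
    exact hq.2 ⟨subset_tsupport χ h0, hq.1.2⟩
  simp [this]

theorem locInt_avgFlat (hU : IsOpen U) {k : ℕ} {χ : ℝ → ℝ} (hχ : IsTest (Set.Ioo (0 : ℝ) 1) χ)
    {η : ℝ × E → (ℝ × E) [⋀^Fin k]→L[ℝ] ℝ} (h : LocInt (volume.prod μ) (cyl U) η) :
    LocInt μ U (avgFlat χ η) := by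
  intro v
  rw [locallyIntegrableOn_iff hU.isLocallyClosed]
  intro K hKU hK
  exact integrable_intForm (fun v => integrable_avg hχ h hK hKU v) v

/-- Fubini: averaging is the transpose of `θ ↦ χ ⊗ θ`. All weak identities for averages follow by
testing with such products. -/
theorem integral_mul_avgFlat {k : ℕ} {χ : ℝ → ℝ}
    (hχ : IsTest (Set.Ioo (0 : ℝ) 1) χ) {η : ℝ × E → (ℝ × E) [⋀^Fin k]→L[ℝ] ℝ}
    (h : LocInt (volume.prod μ) (cyl U) η) {θ : E → ℝ} (hθ : IsTest U θ) (v : Fin k → E) :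
    ∫ y, θ y * avgFlat χ η y v ∂μ =
      ∫ q : ℝ × E, (χ q.1 * θ q.2) * η q (fun j => (0, v j)) ∂(volume.prod μ) := by
  have hK := hθ.compact.isCompact
  have hi := integrable_avg hχ h hK hθ.supp
  have zθ : ∀ y ∉ tsupport θ, θ y = 0 := fun y hy => image_eq_zero_of_notMem_tsupport hy
  rw [integral_prod_symm _ ((hχ.mul hθ).integrable_mul (h fun j => (0, v j))),
    ← setIntegral_eq_integral_of_forall_compl_eq_zero (μ := μ) (s := tsupport θ)
      (f := fun y => θ y * avgFlat χ η y v) (fun y hy => by simp [zθ y hy]),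
    ← setIntegral_eq_integral_of_forall_compl_eq_zero (μ := μ) (s := tsupport θ)
      (f := fun y => ∫ s, (χ s * θ y) * η (s, y) (fun j => (0, v j)))
      (fun y hy => by simp [zθ y hy])]
  refine integral_congr_ae ?_
  filter_upwards [ae_intForm_apply (a := fun s y => χ s • sliceForm (η (s, y))) hi] with y hy
  rw [avgFlat, hy v, ← integral_const_mul,
    ← setIntegral_eq_integral_of_forall_compl_eq_zero (μ := volume) (s := Set.Ioo (0 : ℝ) 1)
      (f := fun s => (χ s * θ y) * η (s, y) (fun j => (0, v j)))
      (fun s hs => by simp [hχ.eq_zero hs])]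
  refine integral_congr_ae (Filter.Eventually.of_forall fun s => ?_)
  simp only [ContinuousAlternatingMap.smul_apply, sliceForm_apply, smul_eq_mul]
  ring

/-- Averaging commutes with the weak exterior derivative. -/
theorem weakDeriv_avgFlat (hU : IsOpen U) {k : ℕ} {χ : ℝ → ℝ} (hχ : IsTest (Set.Ioo (0 : ℝ) 1) χ)
    {η : ℝ × E → (ℝ × E) [⋀^Fin k]→L[ℝ] ℝ} {η' : ℝ × E → (ℝ × E) [⋀^Fin (k + 1)]→L[ℝ] ℝ}
    (h : WeakDeriv (volume.prod μ) (cyl U) η η') :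
    WeakDeriv μ U (avgFlat χ η) (avgFlat χ η') := by
  refine ⟨locInt_avgFlat hU hχ h.1, locInt_avgFlat hU hχ h.2.1, fun ψ hψ v => ?_⟩
  have h3 := h.2.2 _ (hχ.mul hψ) (fun j => (0, v j))
  unfold WeakIdentity at h3 ⊢
  simp only [fderiv_mul_slice hχ hψ] at h3
  rw [integral_mul_avgFlat hχ h.2.1 hψ, h3]
  congr 1
  refine Finset.sum_congr rfl fun j _ => ?_
  rw [integral_mul_avgFlat hχ h.1 (hψ.fderiv (v j))]

end Cylinder

/-! ### The transposed homotopy operator on test functions -/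

section Primitive

variable {E : Type*} [NormedAddCommGroup E] [NormedSpace ℝ E] [FiniteDimensional ℝ E]
  [MeasurableSpace E] [BorelSpace E]

/-- Convolution in the first variable. -/
def radialConv (f : ℝ → ℝ) (θ : ℝ × E → ℝ) (q : ℝ × E) : ℝ := ∫ t, f t * θ (q.1 - t, q.2)

theorem exists_compact_radial {θ : ℝ × E → ℝ} (hc : HasCompactSupport θ) :
    ∃ k : Set ℝ, IsCompact k ∧ ∀ (y : E) (r : ℝ), r ∉ k → θ (r, y) = 0 :=
  ⟨Prod.fst '' tsupport θ, hc.isCompact.image continuous_fst, fun y r hr =>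
    image_eq_zero_of_notMem_tsupport fun h => hr ⟨(r, y), h, rfl⟩⟩

theorem contDiff_radialConv {f : ℝ → ℝ} (hf : LocallyIntegrable f) {θ : ℝ × E → ℝ}
    (hθ : ContDiff ℝ ∞ θ) (hc : HasCompactSupport θ) : ContDiff ℝ ∞ (radialConv f θ) := by
  obtain ⟨k, hk, hz⟩ := exists_compact_radial hc
  have h := contDiffOn_convolution_right_with_param (μ := volume) (n := ⊤) (s := Set.univ)
    (ContinuousLinearMap.mul ℝ ℝ) (g := fun (y : E) (r : ℝ) => θ (r, y)) isOpen_univ hk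
    (fun y r _ hr => hz y r hr) hf (hθ.comp (contDiff_snd.prodMk contDiff_fst)).contDiffOn
  rw [Set.univ_prod_univ, contDiffOn_univ] at h
  exact h.comp (contDiff_snd.prodMk contDiff_fst)

/-- The derivatives fall on `θ`, so `f` may be discontinuous; this is needed for the step function
`negInd`. -/
theorem fderiv_radialConv {f : ℝ → ℝ} (hf : LocallyIntegrable f) {θ : ℝ × E → ℝ}
    (hθ : ContDiff ℝ ∞ θ) (hc : HasCompactSupport θ) (q w : ℝ × E) :
    fderiv ℝ (radialConv f θ) q w = radialConv f (fun p => fderiv ℝ θ p w) q := by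
  obtain ⟨k, hk, hz⟩ := exists_compact_radial hc
  have h := hasFDerivAt_convolution_right_with_param (μ := volume) (s := Set.univ)
    (ContinuousLinearMap.mul ℝ ℝ) (g := fun (y : E) (r : ℝ) => θ (r, y)) isOpen_univ hk
    (fun y r _ hr => hz y r hr) hf ((hθ.comp (contDiff_snd.prodMk contDiff_fst)).of_le
      (by simp)).contDiffOn
    (q.2, q.1) (Set.mem_univ _)
  have hsw : HasFDerivAt (fun q : ℝ × E => (q.2, q.1))
      ((ContinuousLinearMap.snd ℝ ℝ E).prod (ContinuousLinearMap.fst ℝ ℝ E)) q :=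
    hasFDerivAt_snd.prodMk hasFDerivAt_fst
  have h2 := HasFDerivAt.comp (f := fun q : ℝ × E => (q.2, q.1)) q h hsw
  change HasFDerivAt (radialConv f θ) _ q at h2
  have hd : ∀ p : ℝ × E, fderiv ℝ (fun p : E × ℝ => θ (p.2, p.1)) (p.2, p.1) (w.2, w.1) =
      fderiv ℝ θ p w := by
    intro p
    have hsw' : HasFDerivAt (fun q : E × ℝ => (q.2, q.1))
        ((ContinuousLinearMap.snd ℝ E ℝ).prod (ContinuousLinearMap.fst ℝ E ℝ)) (p.2, p.1) :=
      hasFDerivAt_snd.prodMk hasFDerivAt_fst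
    have h3 := ((hθ.differentiable (by simp) p).hasFDerivAt).comp (p.2, p.1) hsw'
    have h4 : fderiv ℝ (fun p : E × ℝ => θ (p.2, p.1)) (p.2, p.1) = _ := h3.fderiv
    rw [h4]
    rfl
  rw [h2.fderiv]
  change (convolution f (fun x => fderiv ℝ (fun p : E × ℝ => θ (p.2, p.1)) (q.2, x))
    (ContinuousLinearMap.precompR (E × ℝ) (ContinuousLinearMap.mul ℝ ℝ)) volume q.1) (w.2, w.1) = _
  have hcs : HasCompactSupport (fun x => fderiv ℝ (fun p : E × ℝ => θ (p.2, p.1)) (q.2, x)) := by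
    have h5 : HasCompactSupport (fun p : E × ℝ => θ (p.2, p.1)) :=
      hc.comp_homeomorph (Homeomorph.prodComm E ℝ)
    have h6 := h5.fderiv (𝕜 := ℝ)
    exact HasCompactSupport.intro (h6.isCompact.image continuous_snd) fun x hx =>
      image_eq_zero_of_notMem_tsupport fun h => hx ⟨(q.2, x), h, rfl⟩
  have hcont : Continuous (fun x => fderiv ℝ (fun p : E × ℝ => θ (p.2, p.1)) (q.2, x)) :=
    ((hθ.comp (contDiff_snd.prodMk contDiff_fst)).continuous_fderiv (by simp)).comp (by fun_prop)
  rw [convolution_precompR_apply _ hf hcs hcont]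
  simp only [radialConv, convolution]
  refine integral_congr_ae (Filter.Eventually.of_forall fun t => ?_)
  beta_reduce
  rw [← hd]
  rfl

theorem radialConv_one (θ : ℝ × E → ℝ) (q : ℝ × E) :
    radialConv (fun _ => 1) θ q = ∫ r, θ (r, q.2) := by
  simp only [radialConv, one_mul]
  exact integral_sub_left_eq_self (fun r => θ (r, q.2)) volume q.1

/-- The kernel `1_{s < r} - X(s)` of the homotopy operator. -/
def kern (X : ℝ → ℝ) (r s : ℝ) : ℝ := (if s < r then 1 else 0) - X s

/-- The dual of the homotopy operator, acting on test functions. -/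
def testKern (X : ℝ → ℝ) (θ : ℝ × E → ℝ) (p : ℝ × E) : ℝ := ∫ r, θ (r, p.2) * kern X r p.1

/-- The indicator function of the negative half-line. -/
def negInd : ℝ → ℝ := Set.indicator (Set.Iio 0) (fun _ => 1)

theorem locallyIntegrable_negInd : LocallyIntegrable negInd :=
  (locallyIntegrable_const (1 : ℝ)).indicator measurableSet_Iio

theorem radialConv_negInd (θ : ℝ × E → ℝ) (q : ℝ × E) :
    radialConv negInd θ q = ∫ r in Set.Ioi q.1, θ (r, q.2) := by
  have h := integral_sub_left_eq_self (fun r => negInd (q.1 - r) * θ (r, q.2)) volume q.1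
  simp only [sub_sub_cancel] at h
  rw [radialConv, h, ← integral_indicator measurableSet_Ioi]
  refine integral_congr_ae (Filter.Eventually.of_forall fun r => ?_)
  simp only [negInd, Set.indicator_apply, Set.mem_Iio, Set.mem_Ioi, sub_neg]
  split_ifs <;> simp

variable {U : Set E}

theorem IsTest.integrable_vertical {θ : ℝ × E → ℝ} (hθ : IsTest (cyl U) θ) (y : E) :
    Integrable (fun r => θ (r, y)) :=
  (hθ.vertical y).smooth.continuous.integrable_of_hasCompactSupport (hθ.vertical y).compact

/-- The step part of the kernel is a convolution with `1_{(-∞,0)}`, the other part is `X` times the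
integral along the ray. Smoothness and derivatives of `testKern` are read off from this form. -/
theorem testKern_eq (X : ℝ → ℝ) {θ : ℝ × E → ℝ} (hθ : IsTest (cyl U) θ) :
    testKern X θ = fun p => radialConv negInd θ p - X p.1 * radialConv (fun _ => 1) θ p := by
  funext p
  have hi := hθ.integrable_vertical p.2
  rw [radialConv_negInd, radialConv_one, ← integral_indicator measurableSet_Ioi,
    ← integral_const_mul, ← integral_sub (hi.indicator measurableSet_Ioi) (hi.const_mul _)]
  refine integral_congr_ae (Filter.Eventually.of_forall fun r => ?_)
  simp only [kern, Set.indicator_apply, Set.mem_Ioi]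
  split_ifs <;> ring

/-- A smooth function equal to `1` on `(-∞, a]` and to `0` on `[b, ∞)`. -/
structure IsCutoff (a b : ℝ) (X : ℝ → ℝ) : Prop where
  smooth : ContDiff ℝ ∞ X
  nonneg : ∀ s, 0 ≤ X s
  le_one : ∀ s, X s ≤ 1
  eq_one : ∀ s, s ≤ a → X s = 1
  eq_zero : ∀ s, b ≤ s → X s = 0

theorem fderiv_testKern_slice {X : ℝ → ℝ} (hX : Differentiable ℝ X) {θ : ℝ × E → ℝ}
    (hθ : IsTest (cyl U) θ) (hθ' : ∀ e : E, IsTest (cyl U) fun p => fderiv ℝ θ p (0, e))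
    (p : ℝ × E) (e : E) :
    fderiv ℝ (testKern X θ) p (0, e) = testKern X (fun q => fderiv ℝ θ q (0, e)) p := by
  have h1 : HasFDerivAt (fun p : ℝ × E => X p.1) _ p :=
    (hX p.1).hasFDerivAt.comp p hasFDerivAt_fst
  have d1 := ((contDiff_radialConv locallyIntegrable_negInd hθ.smooth hθ.compact).differentiable
    (by simp) p).hasFDerivAt
  have d2 := ((contDiff_radialConv (locallyIntegrable_const (1 : ℝ)) hθ.smooth
    hθ.compact).differentiable (by simp) p).hasFDerivAt
  rw [testKern_eq X hθ, testKern_eq X (hθ' e)]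
  have h3 : HasFDerivAt (fun p => radialConv negInd θ p - X p.1 * radialConv
      (fun _ => 1) θ p) _ p :=
    d1.sub (h1.mul d2)
  beta_reduce
  rw [h3.fderiv, ← fderiv_radialConv locallyIntegrable_negInd hθ.smooth hθ.compact,
    ← fderiv_radialConv (locallyIntegrable_const (1 : ℝ)) hθ.smooth hθ.compact]
  simp

/-- The fundamental theorem of calculus gives `∫_{r > s} ∂_r θ = -θ(s)`, and the integral of `∂_r θ`
over the whole ray, which multiplies `X`, is zero. -/
theorem testKern_fderiv_radial (X : ℝ → ℝ) {θ : ℝ × E → ℝ} (hθ : IsTest (cyl U) θ)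
    (hθ' : IsTest (cyl U) fun p => fderiv ℝ θ p (1, 0)) (p : ℝ × E) :
    testKern X (fun q => fderiv ℝ θ q (1, 0)) p = -θ p := by
  rw [testKern_eq X hθ']
  beta_reduce
  rw [radialConv_negInd, radialConv_one]
  have hd : Differentiable ℝ θ := hθ.smooth.differentiable (by simp)
  have hv := hθ.vertical p.2
  have h0 := hv.integral_deriv
  have h1 := hv.compact.integral_Ioi_deriv_eq (hv.smooth.of_le (by simp)) p.1
  simp only [← deriv_vertical hd, h0, h1]
  simp

/-- Here the derivative also hits `X`. The comparison with `testKern_fderiv_radial` leaves the term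
with `X'`, which is dual to `π^* avg` for `χ = -X'`. -/
theorem fderiv_testKern_radial {X : ℝ → ℝ} (hX : Differentiable ℝ X) {θ : ℝ × E → ℝ}
    (hθ : IsTest (cyl U) θ) (hθ' : IsTest (cyl U) fun p => fderiv ℝ θ p (1, 0)) (p : ℝ × E) :
    fderiv ℝ (testKern X θ) p (1, 0) = -θ p - deriv X p.1 * ∫ r, θ (r, p.2) := by
  have h1 : HasFDerivAt (fun p : ℝ × E => X p.1) _ p :=
    (hX p.1).hasFDerivAt.comp p hasFDerivAt_fst
  have d1 := ((contDiff_radialConv locallyIntegrable_negInd hθ.smooth hθ.compact).differentiable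
    (by simp) p).hasFDerivAt
  have d2 := ((contDiff_radialConv (locallyIntegrable_const (1 : ℝ)) hθ.smooth
    hθ.compact).differentiable (by simp) p).hasFDerivAt
  have h4 := testKern_fderiv_radial X hθ hθ' p
  rw [testKern_eq X hθ'] at h4
  rw [testKern_eq X hθ]
  have h3 : HasFDerivAt (fun p => radialConv negInd θ p - X p.1 * radialConv
      (fun _ => 1) θ p) _ p :=
    d1.sub (h1.mul d2)
  rw [h3.fderiv]
  simp only [← fderiv_radialConv locallyIntegrable_negInd hθ.smooth hθ.compact,
    ← fderiv_radialConv (locallyIntegrable_const (1 : ℝ)) hθ.smooth hθ.compact] at h4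
  simp only [sub_apply, add_apply, smul_apply, smul_eq_mul, ContinuousLinearMap.comp_apply,
    ContinuousLinearMap.coe_fst', fderiv_eq_smul_deriv, one_mul, radialConv_one θ p] at h4 ⊢
  linarith

/-- This is the reason for the cutoff: `1_{s<r}` alone would leave a function that does not vanish
near `s = 0`. -/
theorem isTest_testKern {a b : ℝ} (ha : 0 < a) (hb : b < 1) {X : ℝ → ℝ} (hX : IsCutoff a b X)
    {θ : ℝ × E → ℝ} (hθ : IsTest (cyl U) θ) : IsTest (cyl U) (testKern X θ) := by
  have hsm : ContDiff ℝ ∞ (testKern X θ) := by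
    rw [testKern_eq X hθ]
    exact (contDiff_radialConv locallyIntegrable_negInd hθ.smooth hθ.compact).sub
      ((hX.smooth.comp contDiff_fst).mul
        (contDiff_radialConv (locallyIntegrable_const (1 : ℝ)) hθ.smooth hθ.compact))
  obtain ⟨δ, hδ, K, hKU, hK, hsub⟩ := exists_box_of_isCompact hθ.compact hθ.supp
  -- Below `ε` both `X = 1` and `s < r` for every `r` in the support; above `1 - ε` both `X = 0` and
  -- `s ≥ r`. In either range the kernel vanishes.
  have hε : 0 < min (min a δ) (1 - b) := lt_min (lt_min ha hδ) (by linarith)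
  set ε := min (min a δ) (1 - b) with hεd
  have e1 : ε ≤ a := (min_le_left _ _).trans (min_le_left _ _)
  have e2 : ε ≤ δ := (min_le_left _ _).trans (min_le_right _ _)
  have e3 : ε ≤ 1 - b := min_le_right _ _
  have hzero : ∀ p : ℝ × E, p ∉ Set.Icc ε (1 - ε) ×ˢ K → testKern X θ p = 0 := by
    intro p hp
    refine integral_eq_zero_of_ae (Filter.Eventually.of_forall fun r => ?_)
    by_contra hne
    have hθr : θ (r, p.2) ≠ 0 := left_ne_zero_of_mul hne
    have hk : kern X r p.1 ≠ 0 := right_ne_zero_of_mul hne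
    obtain ⟨hr, hK'⟩ := hsub (subset_tsupport θ hθr)
    refine hp ⟨⟨?_, ?_⟩, hK'⟩
    · by_contra hlt
      push Not at hlt
      refine hk ?_
      have : p.1 < r := hlt.trans_le (e2.trans hr.1)
      rw [kern, if_pos this, hX.eq_one _ (hlt.le.trans e1), sub_self]
    · by_contra hlt
      push Not at hlt
      refine hk ?_
      have h5 : r ≤ 1 - δ := hr.2
      rw [kern, if_neg (by linarith), hX.eq_zero _ (by linarith), sub_self]
  have hbox : IsCompact (Set.Icc ε (1 - ε) ×ˢ K) := isCompact_Icc.prod hK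
  have hts : tsupport (testKern X θ) ⊆ Set.Icc ε (1 - ε) ×ˢ K :=
    closure_minimal (fun p hp => by_contra fun h => hp (hzero p h)) hbox.isClosed
  exact ⟨hsm, HasCompactSupport.intro hbox fun p hp => hzero p hp,
    hts.trans (Set.prod_mono (Icc_subset_Ioo01 hε) hKU)⟩

end Primitive

/-! ### The homotopy operator and its transpose -/

section Homotopy

variable {E : Type*} [NormedAddCommGroup E] [NormedSpace ℝ E] [FiniteDimensional ℝ E]
  [MeasurableSpace E] [BorelSpace E] {μ : Measure E} [μ.IsAddHaarMeasure] {U : Set E}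

theorem measurePreserving_leftComm {α β γ : Type*} [MeasurableSpace α] [MeasurableSpace β]
    [MeasurableSpace γ] (ν : Measure α) (τ : Measure β) (ρ : Measure γ) [SFinite ν] [SFinite τ]
    [SFinite ρ] : MeasurePreserving (fun p : α × (β × γ) => (p.2.1, (p.1, p.2.2)))
      (ν.prod (τ.prod ρ)) (τ.prod (ν.prod ρ)) := by
  have h1 : MeasurePreserving MeasurableEquiv.prodAssoc ((ν.prod τ).prod ρ) (ν.prod (τ.prod ρ)) :=
    ⟨MeasurableEquiv.prodAssoc.measurable, Measure.prodAssoc_prod⟩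
  have h2 : MeasurePreserving MeasurableEquiv.prodAssoc ((τ.prod ν).prod ρ) (τ.prod (ν.prod ρ)) :=
    ⟨MeasurableEquiv.prodAssoc.measurable, Measure.prodAssoc_prod⟩
  have h3 : MeasurePreserving (Prod.map Prod.swap id) ((ν.prod τ).prod ρ) ((τ.prod ν).prod ρ) :=
    Measure.measurePreserving_swap.prod (MeasurePreserving.id ρ)
  exact h2.comp (h3.comp (h1.symm MeasurableEquiv.prodAssoc))

/-- The functions `X` for which the kernel `1_{s < r} - X(s)` is used. -/
structure IsKernelFn (b : ℝ) (X : ℝ → ℝ) : Prop where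
  meas : Measurable X
  nonneg : ∀ s, 0 ≤ X s
  le_one : ∀ s, X s ≤ 1
  eq_zero : ∀ s, b ≤ s → X s = 0

theorem IsCutoff.isKernelFn {a b : ℝ} {X : ℝ → ℝ} (h : IsCutoff a b X) : IsKernelFn b X :=
  ⟨h.smooth.continuous.measurable, h.nonneg, h.le_one, h.eq_zero⟩

theorem isKernelFn_zero (b : ℝ) : IsKernelFn b (fun _ => 0) :=
  ⟨measurable_const, fun _ => le_rfl, fun _ => zero_le_one, fun _ _ => rfl⟩

theorem measurable_kern {X : ℝ → ℝ} (hX : Measurable X) :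
    Measurable (fun p : ℝ × ℝ => kern X p.1 p.2) :=
  (Measurable.ite (measurableSet_lt measurable_snd measurable_fst) measurable_const
    measurable_const).sub (hX.comp measurable_snd)

/-- For `s < r` the kernel is `1 - X(s)`. Otherwise it is `-X(s)`, which is nonzero only for `δ ≤ s
< b`. The first summand is controlled by `RadialInt`, the second by local integrability on a compact
box. -/
theorem IsKernelFn.abs_kern_le {b : ℝ} {X : ℝ → ℝ} (hX : IsKernelFn b X) {δ r s : ℝ}
    (hr : δ ≤ r) :
    |kern X r s| ≤ (1 - X s) + Set.indicator (Set.Icc (min δ (1 - b)) (1 - min δ (1 - b)))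
      (fun _ => 1) s := by
  have h0 : (0 : ℝ) ≤ Set.indicator (Set.Icc (min δ (1 - b)) (1 - min δ (1 - b)))
      (fun _ => 1) s := Set.indicator_nonneg (fun _ _ => zero_le_one) _
  have h1 := hX.nonneg s
  have h2 := hX.le_one s
  unfold kern
  by_cases hs : s < r
  · rw [if_pos hs, abs_of_nonneg (by linarith)]
    linarith
  · rw [if_neg hs, zero_sub, abs_neg, abs_of_nonneg h1]
    push Not at hs
    by_cases hsb : b ≤ s
    · rw [hX.eq_zero s hsb]
      linarith
    · push Not at hsb
      rw [Set.indicator_of_mem]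
      · linarith
      · exact ⟨(min_le_left _ _).trans (hr.trans hs), by linarith [min_le_right δ (1 - b)]⟩

/-- The homotopy operator: integration of `∂_r ⌟ ω` against the kernel `1_{s < r} - X(s)`. -/
def homFlat {k : ℕ} (X : ℝ → ℝ) (η : ℝ × E → (ℝ × E) [⋀^Fin (k + 1)]→L[ℝ] ℝ) (q : ℝ × E) :
    E [⋀^Fin k]→L[ℝ] ℝ :=
  intForm (volume.restrict (Set.Ioo 0 1)) (fun s => kern X q.1 s • radialForm (η (s, q.2)))

/-- The integrability near `r = 0` that the homotopy operator needs. -/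
def RadialInt {k : ℕ} (μ : Measure E) (U : Set E) (X : ℝ → ℝ)
    (η : ℝ × E → (ℝ × E) [⋀^Fin (k + 1)]→L[ℝ] ℝ) : Prop :=
  ∀ K ⊆ U, IsCompact K → ∀ v, IntegrableOn (fun p : ℝ × E => (1 - X p.1) * radialForm (η p) v)
    (Set.Ioo 0 1 ×ˢ K) (volume.prod μ)

variable {k : ℕ} {η : ℝ × E → (ℝ × E) [⋀^Fin (k + 1)]→L[ℝ] ℝ} {b : ℝ} {X : ℝ → ℝ}

theorem LocInt.aestronglyMeasurable_radial
    (hη : LocInt (volume.prod μ) (cyl U) η) {K : Set E} (hKU : K ⊆ U)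
    (v : Fin k → E) : AEStronglyMeasurable (fun p : ℝ × E => radialForm (η p) v)
      ((volume.restrict (Set.Ioo 0 1)).prod (μ.restrict K)) := by
  have h := (hη (Fin.cons (1, 0) fun j => (0, v j))).aestronglyMeasurable
  rw [Measure.prod_restrict]
  exact h.mono_measure (Measure.restrict_mono (Set.prod_mono le_rfl hKU) le_rfl)

theorem integrable_hom_aux (hU : IsOpen U) (hX : IsKernelFn b X) (hb : b < 1)
    (hη : LocInt (volume.prod μ) (cyl U) η) (hr : RadialInt μ U X η) {δ : ℝ} (hδ : 0 < δ)
    {K : Set E} (hK : IsCompact K) (hKU : K ⊆ U) (v : Fin k → E) :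
    Integrable (fun p : ℝ × (ℝ × E) => kern X p.1 p.2.1 * radialForm (η p.2) v)
      ((volume.restrict (Set.Icc δ (1 - δ))).prod
        ((volume.restrict (Set.Ioo 0 1)).prod (μ.restrict K))) := by
  set δ' := min δ (1 - b) with hδ'
  have hδ'0 : 0 < δ' := lt_min hδ (by linarith)
  have hm := hη.aestronglyMeasurable_radial hKU v
  have h1 : Integrable (fun p : ℝ × E => (1 - X p.1) * radialForm (η p) v)
      ((volume.restrict (Set.Ioo 0 1)).prod (μ.restrict K)) := by
    rw [Measure.prod_restrict]
    exact hr K hKU hK v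
  have h2 : Integrable (fun p : ℝ × E => Set.indicator (Set.Icc δ' (1 - δ')) (fun _ =>
      (1 : ℝ)) p.1 *
      radialForm (η p) v) ((volume.restrict (Set.Ioo 0 1)).prod (μ.restrict K)) := by
    rw [Measure.prod_restrict]
    have h3 : IntegrableOn (fun p : ℝ × E => radialForm (η p) v) (Set.Icc δ' (1 - δ') ×ˢ K)
        (volume.prod μ) := (locallyIntegrableOn_cyl_iff hU).1 (hη _) δ' hδ'0 K hKU hK
    have h4 : IntegrableOn (fun p : ℝ × E => Set.indicator (Set.Icc δ' (1 - δ'))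
        (fun _ => (1 : ℝ)) p.1 * radialForm (η p) v) (Set.Icc δ' (1 - δ') ×ˢ K)
        (volume.prod μ) := by
      refine h3.congr_fun (fun p hp => ?_) (measurableSet_Icc.prod hK.measurableSet)
      simp [Set.indicator_of_mem hp.1]
    refine h4.of_forall_sdiff_eq_zero (measurableSet_Ioo.prod hK.measurableSet) fun q hq => ?_
    have : q.1 ∉ Set.Icc δ' (1 - δ') := fun h => hq.2 ⟨h, hq.1.2⟩
    simp [Set.indicator_of_notMem this]
  have h5 := (h1.norm.add h2.norm).comp_snd (volume.restrict (Set.Icc δ (1 - δ)))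
  have hk : Measurable (fun p : ℝ × (ℝ × E) => kern X p.1 p.2.1) :=
    (measurable_kern hX.meas).comp (by fun_prop : Measurable fun p : ℝ × (ℝ × E) => (p.1, p.2.1))
  refine h5.mono (hk.aestronglyMeasurable.mul (hm.comp_snd (μ := volume.restrict (Set.Icc δ
      (1 - δ))))) ?_
  have hae : ∀ᵐ p ∂((volume.restrict (Set.Icc δ (1 - δ))).prod
      ((volume.restrict (Set.Ioo (0 : ℝ) 1)).prod (μ.restrict K))), p.1 ∈ Set.Icc δ (1 - δ) :=
    Measure.quasiMeasurePreserving_fst.ae (ae_restrict_mem measurableSet_Icc)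
  filter_upwards [hae] with p hp
  have h6 := hX.abs_kern_le (s := p.2.1) hp.1
  have h7 := hX.le_one p.2.1
  have h8 : (0 : ℝ) ≤ Set.indicator (Set.Icc δ' (1 - δ')) (fun _ => (1 : ℝ)) p.2.1 :=
    Set.indicator_nonneg (fun _ _ => zero_le_one) _
  simp only [Pi.add_apply, Real.norm_eq_abs, abs_mul]
  rw [abs_of_nonneg (by linarith : 0 ≤ 1 - X p.2.1), abs_of_nonneg h8, ← add_mul, abs_mul, abs_abs]
  exact mul_le_mul_of_nonneg_right (h6.trans (le_abs_self _)) (abs_nonneg _)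

theorem integrable_hom (hU : IsOpen U) (hX : IsKernelFn b X) (hb : b < 1)
    (hη : LocInt (volume.prod μ) (cyl U) η) (hr : RadialInt μ U X η) {δ : ℝ} (hδ : 0 < δ)
    {K : Set E} (hK : IsCompact K) (hKU : K ⊆ U) (v : Fin k → E) :
    Integrable (fun p : ℝ × (ℝ × E) => (kern X p.2.1 p.1 • radialForm (η (p.1, p.2.2))) v)
      ((volume.restrict (Set.Ioo 0 1)).prod
        ((volume.prod μ).restrict (Set.Icc δ (1 - δ) ×ˢ K))) := by
  rw [← Measure.prod_restrict]
  exact (measurePreserving_leftComm (volume.restrict (Set.Ioo (0 : ℝ) 1))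
    (volume.restrict (Set.Icc δ (1 - δ))) (μ.restrict K)).integrable_comp_of_integrable
      (integrable_hom_aux hU hX hb hη hr hδ hK hKU v)

theorem locInt_homFlat (hU : IsOpen U) (hX : IsKernelFn b X) (hb : b < 1)
    (hη : LocInt (volume.prod μ) (cyl U) η) (hr : RadialInt μ U X η) :
    LocInt (volume.prod μ) (cyl U) (fun q => cylForm (homFlat X η q)) := by
  intro v
  rw [locallyIntegrableOn_cyl_iff hU]
  intro δ hδ K hKU hK
  have h := integrable_intForm (a := fun s (q : ℝ × E) => kern X q.1 s • radialForm (η (s, q.2)))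
    (fun v => integrable_hom hU hX hb hη hr hδ hK hKU v) (fun j => (v j).2)
  exact h

/-- Fubini moves the kernel from the form to the test function. The right side is restricted to `(0,
1)`, where the homotopy operator integrates, since for `X = 0` the function `testKern X θ` need not
vanish at `s ≤ 0`. -/
theorem integral_mul_homFlat (hU : IsOpen U) (hX : IsKernelFn b X) (hb : b < 1)
    (hη : LocInt (volume.prod μ) (cyl U) η) (hr : RadialInt μ U X η) {θ : ℝ × E → ℝ}
    (hθ : IsTest (cyl U) θ) (v : Fin k → E) :
    ∫ q, θ q * homFlat X η q v ∂(volume.prod μ) =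
      ∫ p, testKern X θ p * radialForm (η p) v ∂((volume.restrict (Set.Ioo 0 1)).prod μ) := by
  obtain ⟨δ, hδ, K, hKU, hK, hsub⟩ := exists_box_of_isCompact hθ.compact hθ.supp
  have hz : ∀ q ∉ Set.Icc δ (1 - δ) ×ˢ K, θ q = 0 := fun q hq =>
    image_eq_zero_of_notMem_tsupport fun h => hq (hsub h)
  have hi := integrable_hom hU hX hb hη hr hδ hK hKU
  have hi' := integrable_hom_aux hU hX hb hη hr hδ hK hKU v
  obtain ⟨C, hC⟩ := hθ.compact.exists_bound_of_continuous hθ.smooth.continuous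
  have hbd : Integrable (fun p : ℝ × (ℝ × E) => θ (p.1, p.2.2) *
      (kern X p.1 p.2.1 * radialForm (η p.2) v))
      ((volume.restrict (Set.Icc δ (1 - δ))).prod
        ((volume.restrict (Set.Ioo 0 1)).prod (μ.restrict K))) :=
    hi'.bdd_mul (c := C) ((hθ.smooth.continuous.comp (by fun_prop)).aestronglyMeasurable)
      (Filter.Eventually.of_forall fun p => hC _)
  have hmp := measurePreserving_leftComm (volume.restrict (Set.Ioo (0 : ℝ) 1))
    (volume.restrict (Set.Icc δ (1 - δ))) (μ.restrict K)
  have hbd' := hmp.integrable_comp_of_integrable hbd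
  rw [← setIntegral_eq_integral_of_forall_compl_eq_zero (μ := volume.prod μ)
    (f := fun q => θ q * homFlat X η q v) (s := Set.Icc δ (1 - δ) ×ˢ K)
    (fun q hq => by simp [hz q hq])]
  have e1 : ∫ q in Set.Icc δ (1 - δ) ×ˢ K, θ q * homFlat X η q v ∂(volume.prod μ) =
      ∫ q in Set.Icc δ (1 - δ) ×ˢ K, (∫ s in Set.Ioo (0 : ℝ) 1, θ q *
        (kern X q.1 s * radialForm (η (s, q.2)) v)) ∂(volume.prod μ) := by
    refine integral_congr_ae ?_
    filter_upwards [ae_intForm_apply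
      (a := fun s (q : ℝ × E) => kern X q.1 s • radialForm (η (s, q.2))) hi] with q hq
    rw [homFlat, hq v, ← integral_const_mul]
    rfl
  have e2 := integral_prod_symm _ hbd'
  have e3 := integral_map (μ := (volume.restrict (Set.Ioo (0 : ℝ) 1)).prod
    ((volume.restrict (Set.Icc δ (1 - δ))).prod (μ.restrict K))) hmp.measurable.aemeasurable
    (f := fun p : ℝ × (ℝ × E) => θ (p.1, p.2.2) * (kern X p.1 p.2.1 * radialForm (η p.2) v))
    (by rw [hmp.map_eq]; exact hbd.aestronglyMeasurable)
  rw [hmp.map_eq] at e3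
  simp only [Function.comp_apply] at e2
  rw [e1, ← Measure.prod_restrict, ← e2, ← e3, integral_prod_symm _ hbd]
  have hzK : ∀ p : ℝ × E, p.2 ∉ K → testKern X θ p = 0 := fun p hp =>
    integral_eq_zero_of_ae (Filter.Eventually.of_forall fun r => by
      simp [hz (r, p.2) fun h => hp h.2])
  have e4 : ∫ p, testKern X θ p * radialForm (η p) v
        ∂((volume.restrict (Set.Ioo 0 1)).prod (μ.restrict K)) =
      ∫ p, testKern X θ p * radialForm (η p) v ∂((volume.restrict (Set.Ioo 0 1)).prod μ) := by
    have e5 : (volume.restrict (Set.Ioo (0 : ℝ) 1)).prod (μ.restrict K) =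
        ((volume.restrict (Set.Ioo (0 : ℝ) 1)).prod μ).restrict (Set.univ ×ˢ K) := by
      rw [← Measure.prod_restrict, Measure.restrict_univ]
    rw [e5]
    exact setIntegral_eq_integral_of_forall_compl_eq_zero fun p hp => by
      rw [hzK p fun h => hp ⟨Set.mem_univ _, h⟩, zero_mul]
  rw [← e4]
  refine integral_congr_ae (Filter.Eventually.of_forall fun p => ?_)
  beta_reduce
  rw [testKern, ← integral_mul_const]
  rw [← setIntegral_eq_integral_of_forall_compl_eq_zero (μ := volume)
    (f := fun r => θ (r, p.2) * kern X r p.1 * radialForm (η p) v) (s := Set.Icc δ (1 - δ))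
    (fun r hr => by simp [hz (r, p.2) fun h => hr h.1])]
  simp only [mul_assoc]

end Homotopy

/-! ### The homotopy formula for a cutoff -/

section HomotopyFormula

variable {E : Type*} [NormedAddCommGroup E] [NormedSpace ℝ E] [FiniteDimensional ℝ E]
  [MeasurableSpace E] [BorelSpace E] {μ : Measure E} [μ.IsAddHaarMeasure] {U : Set E}

theorem tsupport_subset_of_eq_zero {W : Type*} [TopologicalSpace W] {f : W → ℝ} {K : Set W}
    (hK : IsClosed K) (hz : ∀ y ∉ K, f y = 0) : tsupport f ⊆ K :=
  closure_minimal (fun y hy => by_contra fun h => hy (hz y h)) hK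

theorem isTest_vertical_integral {ψ : ℝ × E → ℝ} (hψ : IsTest (cyl U) ψ) :
    IsTest U (fun y => ∫ r, ψ (r, y)) := by
  have e : (fun y => ∫ r, ψ (r, y)) = fun y => radialConv (fun _ => 1) ψ (0, y) :=
    funext fun y => (radialConv_one ψ (0, y)).symm
  have hz : ∀ y ∉ Prod.snd '' tsupport ψ, ∫ r, ψ (r, y) = 0 := fun y hy =>
    integral_eq_zero_of_ae (Filter.Eventually.of_forall fun r =>
      image_eq_zero_of_notMem_tsupport fun h => hy ⟨_, h, rfl⟩)
  have hK : IsCompact (Prod.snd '' tsupport ψ) := hψ.compact.isCompact.image continuous_snd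
  refine ⟨?_, HasCompactSupport.intro hK hz, ?_⟩
  · rw [e]
    exact (contDiff_radialConv (locallyIntegrable_const (1 : ℝ)) hψ.smooth hψ.compact).comp
      (by fun_prop)
  · refine (tsupport_subset_of_eq_zero hK.isClosed hz).trans ?_
    rintro _ ⟨p, hp, rfl⟩
    exact (hψ.supp hp).2

/-- `-X'` is the weight `χ` of the average that belongs to the kernel with cutoff `X`; it vanishes
where `X` is locally constant. -/
theorem IsCutoff.isTest_deriv {a b : ℝ} (ha : 0 < a) (hb : b < 1) {X : ℝ → ℝ}
    (hX : IsCutoff a b X) : IsTest (Set.Ioo (0 : ℝ) 1) (fun s => -deriv X s) := by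
  have hz : ∀ s ∉ Set.Icc a b, -deriv X s = 0 := by
    intro s hs
    rw [neg_eq_zero]
    rcases lt_or_ge s a with h | h
    · have : X =ᶠ[nhds s] fun _ => 1 :=
        Filter.eventually_of_mem (Iio_mem_nhds h) fun t ht => hX.eq_one t (le_of_lt ht)
      rw [this.deriv_eq, deriv_const]
    · have h' : b < s := by
        by_contra h2
        exact hs ⟨h, not_lt.1 h2⟩
      have : X =ᶠ[nhds s] fun _ => 0 :=
        Filter.eventually_of_mem (Ioi_mem_nhds h') fun t ht => hX.eq_zero t (le_of_lt ht)
      rw [this.deriv_eq, deriv_const]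
  refine ⟨(hX.smooth.deriv' (n := ∞)).neg, HasCompactSupport.intro isCompact_Icc hz, ?_⟩
  refine (tsupport_subset_of_eq_zero isClosed_Icc hz).trans ?_
  exact fun s hs => ⟨ha.trans_le hs.1, hs.2.trans_lt hb⟩

/-- Pairing of `ω - π^* avg ω` with a test function. -/
theorem integral_mul_sub_avg (hU : IsOpen U) {k : ℕ}
    {η : ℝ × E → (ℝ × E) [⋀^Fin k]→L[ℝ] ℝ} (hη : LocInt (volume.prod μ) (cyl U) η) {a b : ℝ}
    (ha : 0 < a) (hb : b < 1) {X : ℝ → ℝ} (hX : IsCutoff a b X) {ψ : ℝ × E → ℝ}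
    (hψ : IsTest (cyl U) ψ) (v : Fin k → E) :
    ∫ p, ψ p * (η p - cylForm (avgFlat (fun s => -deriv X s) η p.2)) (fun j => (0, v j))
        ∂(volume.prod μ) =
      ∫ p, (ψ p + deriv X p.1 * ∫ r, ψ (r, p.2)) * η p (fun j => (0, v j)) ∂(volume.prod μ) := by
  have hχ := hX.isTest_deriv ha hb
  have hP := isTest_vertical_integral hψ
  have i1 : Integrable (fun p => ψ p * η p (fun j => (0, v j))) (volume.prod μ) :=
    hψ.integrable_mul (hη _)
  have i2 : Integrable (fun p : ℝ × E => (-deriv X p.1 * ∫ r, ψ (r, p.2)) * η p (fun j => (0, v j)))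
      (volume.prod μ) := (hχ.mul hP).integrable_mul (hη _)
  have i3 : Integrable (fun p : ℝ × E => ψ p * cylForm (avgFlat (fun s => -deriv X s) η p.2)
      (fun j => (0, v j))) (volume.prod μ) :=
    hψ.integrable_mul (locInt_cylForm hU (locInt_avgFlat hU hχ hη) _)
  have e1 := integral_mul_avgFlat hχ hη hP v
  have e2 := integral_prod_symm _ i3
  simp only [cylForm_apply, integral_mul_const] at e2
  simp only [ContinuousAlternatingMap.sub_apply, mul_sub, cylForm_apply, add_mul] at i3 ⊢
  rw [integral_sub i1 i3, e2, e1, ← integral_sub i1 i2]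
  refine integral_congr_ae (Filter.Eventually.of_forall fun p => ?_)
  ring

/-- The radial part of the weak identity for a closed form. -/
theorem WeakDeriv.radial_identity {k : ℕ} {η : ℝ × E → (ℝ × E) [⋀^Fin (k + 1)]→L[ℝ] ℝ}
    (h : WeakDeriv (volume.prod μ) (cyl U) η 0) {θ : ℝ × E → ℝ} (hθ : IsTest (cyl U) θ)
    (v : Fin (k + 1) → E) :
    ∫ p, fderiv ℝ θ p (1, 0) * η p (fun j => (0, v j)) ∂(volume.prod μ) =
      ∑ j : Fin (k + 1), (-1 : ℝ) ^ (j : ℕ) * ∫ p, fderiv ℝ θ p (0, v j) *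
        radialForm (η p) (fun l => v (j.succAbove l)) ∂(volume.prod μ) := by
  have h1 := h.2.2 θ hθ (Fin.cons (1, 0) fun j => (0, v j))
  unfold WeakIdentity at h1
  rw [Fin.sum_univ_succ] at h1
  have e : ∀ j : Fin (k + 1), (fun l => (Fin.cons (1, 0) fun j => (0, v j) :
      Fin (k + 2) → ℝ × E) (j.succ.succAbove l)) =
      Fin.cons (1, 0) (fun l => (0, v (j.succAbove l))) := by
    intro j
    funext l
    refine Fin.cases ?_ (fun l => ?_) l <;> simp
  have z : ∀ (p : ℝ × E) w, (0 : ℝ × E → (ℝ × E) [⋀^Fin (k + 2)]→L[ℝ] ℝ) p w = 0 :=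
    fun _ _ => rfl
  simp only [e, z, mul_zero, integral_zero,
    Fin.val_zero, pow_zero, one_mul, Fin.cons_zero, Fin.succAbove_zero, Fin.cons_succ, Fin.val_succ,
    pow_succ, mul_neg, mul_one, neg_mul, Finset.sum_neg_distrib] at h1
  simp only [radialForm_apply]
  linarith

theorem IsTest.integral_cyl {θ : ℝ × E → ℝ} (hθ : IsTest (cyl U) θ) (u : ℝ × E → ℝ) :
    ∫ p, θ p * u p ∂((volume.restrict (Set.Ioo 0 1)).prod μ) =
      ∫ p, θ p * u p ∂(volume.prod μ) := by
  have e5 : (volume.restrict (Set.Ioo (0 : ℝ) 1)).prod μ =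
      (volume.prod μ).restrict (Set.Ioo 0 1 ×ˢ Set.univ) := by
    rw [← Measure.prod_restrict, Measure.restrict_univ]
  rw [e5]
  exact setIntegral_eq_integral_of_forall_compl_eq_zero fun p hp => by
    rw [hθ.eq_zero fun h => hp ⟨h.1, Set.mem_univ _⟩, zero_mul]

/-- The dual homotopy formula: a closed form tested on `testKern X ψ`. -/
theorem WeakDeriv.sum_testKern {k : ℕ} {η : ℝ × E → (ℝ × E) [⋀^Fin (k + 1)]→L[ℝ] ℝ}
    (h : WeakDeriv (volume.prod μ) (cyl U) η 0) {a b : ℝ}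
    (ha : 0 < a) (hb : b < 1) {X : ℝ → ℝ} (hX : IsCutoff a b X) {ψ : ℝ × E → ℝ}
    (hψ : IsTest (cyl U) ψ) (v : Fin (k + 1) → E) :
    ∫ p, (ψ p + deriv X p.1 * ∫ r, ψ (r, p.2)) * η p (fun j => (0, v j)) ∂(volume.prod μ) =
      -∑ j : Fin (k + 1), (-1 : ℝ) ^ (j : ℕ) *
        ∫ p, testKern X (fun q => fderiv ℝ ψ q (0, v j)) p *
          radialForm (η p) (fun l => v (j.succAbove l))
            ∂((volume.restrict (Set.Ioo 0 1)).prod μ) := by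
  have hT := isTest_testKern ha hb hX hψ
  have h1 := h.radial_identity hT v
  have hd := hX.smooth.differentiable (by simp)
  simp only [fderiv_testKern_radial hd hψ (hψ.fderiv _),
    fderiv_testKern_slice hd hψ (fun e => hψ.fderiv _)] at h1
  have e : ∀ j : Fin (k + 1), ∫ p, testKern X (fun q => fderiv ℝ ψ q (0, v j)) p *
          radialForm (η p) (fun l => v (j.succAbove l))
            ∂((volume.restrict (Set.Ioo 0 1)).prod μ) =
      ∫ p, testKern X (fun q => fderiv ℝ ψ q (0, v j)) p *
          radialForm (η p) (fun l => v (j.succAbove l)) ∂(volume.prod μ) :=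
    fun j => (isTest_testKern ha hb hX (hψ.fderiv (0, v j))).integral_cyl _
  simp only [e, ← h1]
  rw [← integral_neg]
  refine integral_congr_ae (Filter.Eventually.of_forall fun p => ?_)
  ring

/-- The part of the homotopy formula that involves `∂_r`. -/
theorem weakIdentity_hom_radial (hU : IsOpen U) {k : ℕ}
    {η : ℝ × E → (ℝ × E) [⋀^Fin (k + 1)]→L[ℝ] ℝ} {b : ℝ} {X : ℝ → ℝ} (hX : IsKernelFn b X)
    (hb : b < 1) (hη : LocInt (volume.prod μ) (cyl U) η) (hr : RadialInt μ U X η)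
    (ξ : E → E [⋀^Fin (k + 1)]→L[ℝ] ℝ) {ψ : ℝ × E → ℝ} (hψ : IsTest (cyl U) ψ) (v : Fin k → E) :
    WeakIdentity (volume.prod μ) (fun q => cylForm (homFlat X η q))
      (fun p => η p - cylForm (ξ p.2)) ψ (Fin.cons (1, 0) fun j => (0, v j)) := by
  unfold WeakIdentity
  rw [Fin.sum_univ_succ]
  have z1 : ∀ p : ℝ × E, (η p - cylForm (ξ p.2)) (Fin.cons (1, 0) fun j => (0, v j)) =
      radialForm (η p) v := by
    intro p
    rw [ContinuousAlternatingMap.sub_apply, cylForm_cons, sub_zero, radialForm_apply]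
  have z2 : ∀ (j : Fin k) (q : ℝ × E), cylForm (homFlat X η q) (fun l =>
      (Fin.cons (1, 0) fun j => (0, v j) : Fin (k + 1) → ℝ × E) (j.succ.succAbove l)) = 0 := by
    intro j q
    cases k with
    | zero => exact j.elim0
    | succ k => exact (homFlat X η q).map_coord_zero 0 (by simp)
  simp only [z1, z2, mul_zero, integral_zero, Finset.sum_const_zero, add_zero, Fin.val_zero,
    pow_zero, one_mul, Fin.cons_zero, Fin.succAbove_zero, Fin.cons_succ, cylForm_apply]
  rw [integral_mul_homFlat hU hX hb hη hr (hψ.fderiv _) v]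
  simp only [testKern_fderiv_radial X hψ (hψ.fderiv _), neg_mul]
  rw [integral_neg, hψ.integral_cyl, neg_neg]

/-- The homotopy formula `ω - π^* avg ω = d K ω` for a closed form `ω`. -/
theorem weakDeriv_homFlat (hU : IsOpen U) {k : ℕ} {η : ℝ × E → (ℝ × E) [⋀^Fin (k + 1)]→L[ℝ] ℝ}
    (h : WeakDeriv (volume.prod μ) (cyl U) η 0) {a b : ℝ} (ha : 0 < a) (hb : b < 1) {X : ℝ → ℝ}
    (hX : IsCutoff a b X) (hr : RadialInt μ U X η) :
    WeakDeriv (volume.prod μ) (cyl U) (fun q => cylForm (homFlat X η q))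
      (fun p => η p - cylForm (avgFlat (fun s => -deriv X s) η p.2)) := by
  have l1 := locInt_homFlat hU hX.isKernelFn hb h.1 hr
  have l2 : LocInt (volume.prod μ) (cyl U)
      (fun p => η p - cylForm (avgFlat (fun s => -deriv X s) η p.2)) := fun v =>
    (h.1 v).sub (locInt_cylForm hU (locInt_avgFlat hU (hX.isTest_deriv ha hb) h.1) v)
  refine ⟨l1, l2, fun ψ hψ => weakIdentity_of_prod l1 l2 hψ (fun v => ?_)
    (weakIdentity_hom_radial hU hX.isKernelFn hb h.1 hr _ hψ)⟩
  unfold WeakIdentity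
  rw [integral_mul_sub_avg hU h.1 ha hb hX hψ, h.sum_testKern ha hb hX hψ]
  congr 1
  refine Finset.sum_congr rfl fun j _ => ?_
  congr 1
  exact (integral_mul_homFlat hU hX.isKernelFn hb h.1 hr (hψ.fderiv _) _).symm

/-- A closed function on the cylinder is the pullback of its average. -/
theorem ae_eq_avg_of_degree_zero (hU : IsOpen U) {η : ℝ × E → (ℝ × E) [⋀^Fin 0]→L[ℝ] ℝ}
    (h : WeakDeriv (volume.prod μ) (cyl U) η 0) {a b : ℝ} (ha : 0 < a) (hb : b < 1) {X : ℝ → ℝ}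
    (hX : IsCutoff a b X) :
    ∀ᵐ p ∂(volume.prod μ), p ∈ cyl U →
      η p - cylForm (avgFlat (fun s => -deriv X s) η p.2) = 0 := by
  have l2 : LocInt (volume.prod μ) (cyl U)
      (fun p => η p - cylForm (avgFlat (fun s => -deriv X s) η p.2)) := fun v =>
    (h.1 v).sub (locInt_cylForm hU (locInt_avgFlat hU (hX.isTest_deriv ha hb) h.1) v)
  have h1 := (isOpen_cyl hU).ae_eq_zero_of_integral_contDiff_smul_eq_zero
    (l2 (fun j => (0, (fun i : Fin 0 => i.elim0 : Fin 0 → E) j))) fun ψ hs hc ht => by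
      have hψ : IsTest (cyl U) ψ := ⟨hs, hc, ht⟩
      simp only [smul_eq_mul]
      rw [integral_mul_sub_avg hU h.1 ha hb hX hψ]
      -- Weakly `∂_r η = 0`. Tested on `testKern X ψ`, this is the vanishing of the pairing of `ψ`
      -- with `η - π^* avg η`, up to sign.
      have h2 := h.2.2 _ (isTest_testKern ha hb hX hψ) (fun _ => (1, 0))
      unfold WeakIdentity at h2
      have z : ∀ (p : ℝ × E) w, (0 : ℝ × E → (ℝ × E) [⋀^Fin 1]→L[ℝ] ℝ) p w = 0 :=
        fun _ _ => rfl
      simp only [fderiv_testKern_radial (hX.smooth.differentiable (by simp)) hψ (hψ.fderiv _),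
        z, mul_zero, integral_zero, Fin.sum_univ_succ, Finset.univ_eq_empty, Finset.sum_empty,
        add_zero, Fin.val_zero, pow_zero, one_mul] at h2
      rw [eq_comm, neg_eq_zero] at h2
      rw [← neg_eq_zero, ← integral_neg]
      refine Eq.trans ?_ h2
      refine integral_congr_ae (Filter.Eventually.of_forall fun p => ?_)
      beta_reduce
      rw [Subsingleton.elim (fun j : Fin 0 => ((0 : ℝ), (fun i : Fin 0 => i.elim0 : Fin 0 → E) j))
        (fun _ => (1, 0))]
      ring
  filter_upwards [h1] with p hp hpU
  ext v
  rw [Subsingleton.elim v (fun j => (0, (fun i : Fin 0 => i.elim0 : Fin 0 → E) j))]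
  exact hp hpU

end HomotopyFormula

/-! ### A concrete cutoff and its rescalings -/

/-- A smooth function equal to `1` on `(-∞, 1/3]` and to `0` on `[2/3, ∞)`. -/
def stdCutoff (s : ℝ) : ℝ := Real.smoothTransition (2 - 3 * s)

theorem contDiff_stdCutoff : ContDiff ℝ ∞ stdCutoff :=
  Real.smoothTransition.contDiff.comp (by fun_prop)

theorem isCutoff_stdCutoff_mul {m : ℝ} (hm : 0 < m) :
    IsCutoff (1 / 3 / m) (2 / 3 / m) (fun s => stdCutoff (m * s)) where
  smooth := contDiff_stdCutoff.comp (by fun_prop)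
  nonneg _ := Real.smoothTransition.nonneg _
  le_one _ := Real.smoothTransition.le_one _
  eq_one s hs := Real.smoothTransition.one_of_one_le (by
    rw [le_div_iff₀ hm] at hs; linarith)
  eq_zero s hs := Real.smoothTransition.zero_of_nonpos (by
    rw [div_le_iff₀ hm] at hs; linarith)

theorem isCutoff_stdCutoff : IsCutoff (1 / 3) (2 / 3) stdCutoff := by
  have h := isCutoff_stdCutoff_mul one_pos
  simpa using h

theorem exists_bound_deriv_stdCutoff : ∃ L : ℝ, 0 ≤ L ∧ ∀ s, |deriv stdCutoff s| ≤ L := by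
  have h := isCutoff_stdCutoff.isTest_deriv (by norm_num) (by norm_num)
  obtain ⟨L, hL⟩ := h.compact.exists_bound_of_continuous h.smooth.continuous
  exact ⟨L, (norm_nonneg _).trans (hL 0), fun s => by simpa using hL s⟩

/-- The chain rule gives the factor `m`, and the rescaled cutoff is zero from `2 / (3m) < 1 / m` on.
The bound `L` does not depend on `m`. -/
theorem exists_bound_deriv_stdCutoff_mul : ∃ L : ℝ, 0 ≤ L ∧ ∀ m : ℝ, 0 < m → ∀ s,
    |deriv (fun s => stdCutoff (m * s)) s| ≤
      m * L * Set.indicator (Set.Iic m⁻¹) (fun _ => 1) s := by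
  obtain ⟨L, hL0, hL⟩ := exists_bound_deriv_stdCutoff
  refine ⟨L, hL0, fun m hm s => ?_⟩
  by_cases hs : s ≤ m⁻¹
  · rw [Set.indicator_of_mem (Set.mem_Iic.2 hs), mul_one, deriv_comp_mul_left, smul_eq_mul, abs_mul,
      abs_of_pos hm]
    exact mul_le_mul_of_nonneg_left (hL _) hm.le
  · rw [Set.indicator_of_notMem (by simpa using hs), mul_zero]
    push Not at hs
    have : (fun s => stdCutoff (m * s)) =ᶠ[nhds s] fun _ => 0 :=
      Filter.eventually_of_mem (Ioi_mem_nhds hs) fun t ht =>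
        (isCutoff_stdCutoff_mul hm).eq_zero t (le_trans (by
          rw [← one_div]; gcongr; norm_num) (le_of_lt ht))
    rw [this.deriv_eq, deriv_const, abs_zero]

/-! ### Removing the cutoff at the tip -/

section Limit

variable {E : Type*} [NormedAddCommGroup E] [NormedSpace ℝ E] [FiniteDimensional ℝ E]
  [MeasurableSpace E] [BorelSpace E] {μ : Measure E} [μ.IsAddHaarMeasure] {U : Set E}

/-- If `s⁻¹ u²` is integrable then the boundary terms at `r = 0` disappear in the limit. -/
theorem tendsto_cutoff_error {P : E → ℝ} (hP : IsTest U P) {u : ℝ × E → ℝ}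
    (hA : IntegrableOn (fun p : ℝ × E => p.1⁻¹ * u p ^ 2) (Set.Ioo 0 1 ×ˢ tsupport P)
      (volume.prod μ)) :
    Filter.Tendsto (fun n : ℕ => ∫ p : ℝ × E,
      (deriv (fun s => stdCutoff (((n : ℝ) + 1) * s)) p.1 * P p.2) * u p ∂(volume.prod μ))
      Filter.atTop (nhds 0) := by
  set K := tsupport P with hKd
  have hK : IsCompact K := hP.compact
  have hbox : MeasurableSet (Set.Ioo (0 : ℝ) 1 ×ˢ K) := measurableSet_Ioo.prod hK.measurableSet
  set m := (volume.prod μ).restrict (Set.Ioo (0 : ℝ) 1 ×ˢ K) with hm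
  have hmfin : IsFiniteMeasure m := by
    refine ⟨?_⟩
    rw [hm, Measure.restrict_apply_univ, Measure.prod_prod]
    exact ENNReal.mul_lt_top measure_Ioo_lt_top hK.measure_lt_top
  obtain ⟨L, hL0, hL⟩ := exists_bound_deriv_stdCutoff_mul
  obtain ⟨C, hC⟩ := hP.compact.exists_bound_of_continuous hP.smooth.continuous
  have hC0 : 0 ≤ C := (norm_nonneg _).trans (hC 0)
  let ind : ℕ → ℝ → ℝ := fun n s => Set.indicator (Set.Iic ((n : ℝ) + 1)⁻¹) (fun _ => (1 : ℝ)) s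
  have ind0 : ∀ n s, 0 ≤ ind n s := fun n s => Set.indicator_nonneg (fun _ _ => zero_le_one) _
  have ind1 : ∀ n s, ind n s ≤ 1 := fun n s => Set.indicator_le_self' (fun _ _ => zero_le_one) _
  have indm : ∀ n, Measurable (ind n) := fun n => measurable_const.indicator measurableSet_Iic
  have ig : Integrable (fun p : ℝ × E => p.1⁻¹ * u p ^ 2) m := hA
  have iR : ∀ n, Integrable (fun p : ℝ × E => ind n p.1 * (p.1⁻¹ * u p ^ 2)) m := fun n =>
    ig.bdd_mul (c := 1) (((indm n).comp measurable_fst).aestronglyMeasurable)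
      (Filter.Eventually.of_forall fun p => by
        rw [Real.norm_eq_abs, abs_of_nonneg (ind0 n _)]; exact ind1 n _)
  have hmem : ∀ᵐ p ∂m, p ∈ Set.Ioo (0 : ℝ) 1 ×ˢ K := ae_restrict_mem hbox
  have hR : Filter.Tendsto (fun n => ∫ p, ind n p.1 * (p.1⁻¹ * u p ^ 2) ∂m) Filter.atTop
      (nhds 0) := by
    have h0 : (0 : ℝ) = ∫ _p : ℝ × E, (0 : ℝ) ∂m := by simp
    rw [h0]
    refine tendsto_integral_of_dominated_convergence (fun p => ‖p.1⁻¹ * u p ^ 2‖)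
      (fun n => (iR n).aestronglyMeasurable) ig.norm (fun n => Filter.Eventually.of_forall fun p =>
        ?_)
      (hmem.mono fun p hp => ?_)
    · rw [norm_mul, Real.norm_eq_abs (ind n p.1), abs_of_nonneg (ind0 n _)]
      exact mul_le_of_le_one_left (norm_nonneg _) (ind1 n _)
    · refine tendsto_const_nhds.congr' ?_
      have h1 : Filter.Tendsto (fun n : ℕ => ((n : ℝ) + 1)⁻¹) Filter.atTop (nhds 0) := by
        simpa using tendsto_one_div_add_atTop_nhds_zero_nat (𝕜 := ℝ)
      filter_upwards [h1.eventually (Iio_mem_nhds hp.1.1)] with n hn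
      have : p.1 ∉ Set.Iic ((n : ℝ) + 1)⁻¹ := not_le.2 hn
      simp only [ind, Set.indicator_of_notMem this, zero_mul]
  -- The functions `(n + 1) 1_{s ≤ 1/(n+1)}` have integral at most one, so this term is bounded
  -- uniformly in `n` but does not tend to zero.
  have hI : ∀ n : ℕ, ∫ p, ((n : ℝ) + 1) * ind n p.1 ∂m ≤ (μ K).toReal := by
    intro n
    rw [hm, ← Measure.prod_restrict]
    have e := integral_prod_mul (μ := volume.restrict (Set.Ioo (0 : ℝ) 1)) (ν := μ.restrict K)
      (fun s => ((n : ℝ) + 1) * ind n s) (fun _ => (1 : ℝ))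
    simp only [mul_one] at e
    rw [e, integral_const_mul]
    have e2 : ∫ s in Set.Ioo (0 : ℝ) 1, ind n s ≤ ((n : ℝ) + 1)⁻¹ := by
      simp only [ind]
      rw [integral_indicator measurableSet_Iic, Measure.restrict_restrict measurableSet_Iic]
      simp only [integral_const, smul_eq_mul, mul_one, measureReal_restrict_apply_univ]
      have hsub : Set.Iic ((n : ℝ) + 1)⁻¹ ∩ Set.Ioo 0 1 ⊆ Set.Ioc 0 ((n : ℝ) + 1)⁻¹ :=
        fun s hs => ⟨hs.2.1, hs.1⟩
      refine (measureReal_mono hsub measure_Ioc_lt_top.ne).trans ?_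
      rw [Real.volume_real_Ioc_of_le (by positivity), sub_zero]
    have e3 : ((n : ℝ) + 1) * ∫ s in Set.Ioo (0 : ℝ) 1, ind n s ≤ 1 := by
      have hn : (0 : ℝ) < (n : ℝ) + 1 := by positivity
      calc _ ≤ ((n : ℝ) + 1) * ((n : ℝ) + 1)⁻¹ := by gcongr
        _ = 1 := mul_inv_cancel₀ hn.ne'
    have e4 : ∫ _y in K, (1 : ℝ) ∂μ = (μ K).toReal := by simp [Measure.real]
    rw [e4]
    exact mul_le_of_le_one_left ENNReal.toReal_nonneg e3
  have iI : ∀ n : ℕ, Integrable (fun p : ℝ × E => ((n : ℝ) + 1) * ind n p.1) m := fun n =>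
    (Integrable.of_bound (((indm n).comp measurable_fst).aestronglyMeasurable) 1
      (Filter.Eventually.of_forall fun p => by
        rw [Function.comp, Real.norm_eq_abs, abs_of_nonneg (ind0 n _)]; exact ind1 n _)).const_mul _
  -- Cauchy–Schwarz in the form of a weighted arithmetic-geometric inequality: a bounded term times
  -- `ε`, plus `ε⁻¹` times a tail of the convergent integral of `s⁻¹ u²`.
  have key : ∀ ε : ℝ, 0 < ε → ∀ n : ℕ, |∫ p : ℝ × E,
      (deriv (fun s => stdCutoff (((n : ℝ) + 1) * s)) p.1 * P p.2) * u p ∂(volume.prod μ)| ≤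
      ε * (C * L ^ 2 * (μ K).toReal) +
        C * ε⁻¹ * ∫ p, ind n p.1 * (p.1⁻¹ * u p ^ 2) ∂m := by
    intro ε hε n
    have hz : ∀ p ∉ Set.Ioo (0 : ℝ) 1 ×ˢ K,
        (deriv (fun s => stdCutoff (((n : ℝ) + 1) * s)) p.1 * P p.2) * u p = 0 := by
      intro p hp
      by_cases h2 : p.2 ∈ K
      · have h1 : p.1 ∉ Set.Ioo (0 : ℝ) 1 := fun h => hp ⟨h, h2⟩
        have hc := (isCutoff_stdCutoff_mul (by positivity : (0 : ℝ) < (n : ℝ) + 1)).isTest_deriv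
          (by positivity) (by
            rw [div_lt_one (by positivity)]
            have : (0 : ℝ) ≤ n := Nat.cast_nonneg n
            linarith)
        have := hc.eq_zero h1
        rw [neg_eq_zero] at this
        rw [this]; ring
      · rw [image_eq_zero_of_notMem_tsupport h2]; ring
    rw [← setIntegral_eq_integral_of_forall_compl_eq_zero hz]
    calc _ ≤ ∫ p, (ε * (C * L ^ 2) * (((n : ℝ) + 1) * ind n p.1) +
          C * ε⁻¹ * (ind n p.1 * (p.1⁻¹ * u p ^ 2))) ∂m := by
          rw [← Real.norm_eq_abs]
          refine norm_integral_le_of_norm_le (g := fun p : ℝ × E =>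
            ε * (C * L ^ 2) * (((n : ℝ) + 1) * ind n p.1) +
            C * ε⁻¹ * (ind n p.1 * (p.1⁻¹ * u p ^ 2)))
            (((iI n).const_mul _).add ((iR n).const_mul _)) ?_
          filter_upwards [hmem] with p hp
          have hp0 : 0 < p.1 := hp.1.1
          rw [Real.norm_eq_abs, abs_mul, abs_mul]
          have h1 := hL ((n : ℝ) + 1) (by positivity) p.1
          have h2 : |P p.2| ≤ C := hC p.2
          have hind : ind n p.1 = Set.indicator (Set.Iic ((n : ℝ) + 1)⁻¹) (fun _ => 1) p.1 := rfl
          rw [← hind] at h1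
          have hn : (0 : ℝ) < (n : ℝ) + 1 := by positivity
          have h3 : |deriv (fun s => stdCutoff (((n : ℝ) + 1) * s)) p.1| * |P p.2| * |u p| ≤
              (((n : ℝ) + 1) * L * ind n p.1) * C * |u p| := by
            have := ind0 n p.1
            gcongr
          refine h3.trans ?_
          rcases eq_or_ne (ind n p.1) 0 with h0 | h0
          · rw [h0]; simp
          · have hle : p.1 ≤ ((n : ℝ) + 1)⁻¹ := by
              by_contra hcon
              have hcon' : p.1 ∉ Set.Iic ((n : ℝ) + 1)⁻¹ := hcon
              exact h0 (Set.indicator_of_notMem hcon' _)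
            have h1' : ind n p.1 = 1 := Set.indicator_of_mem (Set.mem_Iic.2 hle) _
            rw [h1', mul_one, mul_one, one_mul]
            have h4 : ((n : ℝ) + 1) * L * |u p| ≤
                ε * L ^ 2 * ((n : ℝ) + 1) + ε⁻¹ * (p.1⁻¹ * u p ^ 2) := by
              have h5 : (((n : ℝ) + 1) * p.1) ≤ 1 := by
                calc _ ≤ ((n : ℝ) + 1) * ((n : ℝ) + 1)⁻¹ := by gcongr
                  _ = 1 := mul_inv_cancel₀ hn.ne'
              have h6 : ε * L ^ 2 * ((n : ℝ) + 1) * (((n : ℝ) + 1) * p.1) ≤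
                  ε * L ^ 2 * ((n : ℝ) + 1) := mul_le_of_le_one_right (by positivity) h5
              have h7 : ε⁻¹ * (p.1⁻¹ * u p ^ 2) = (|u p|) ^ 2 / (ε * p.1) := by
                rw [sq_abs]; field_simp
              rw [h7]
              -- Complete the square with weight `ε s`. The extra factor `(n + 1) s` is then
              -- discarded, being at most one on the support of the derivative.
              have h8 : ((n : ℝ) + 1) * L * |u p| ≤
                  ε * L ^ 2 * ((n : ℝ) + 1) * (((n : ℝ) + 1) * p.1) + |u p| ^ 2 / (ε * p.1) := by
                have h9 : 0 < ε * p.1 := mul_pos hε hp0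
                rw [← sub_nonneg]
                have : ε * L ^ 2 * ((n : ℝ) + 1) * (((n : ℝ) + 1) * p.1) + |u p| ^ 2 / (ε * p.1) -
                    ((n : ℝ) + 1) * L * |u p| =
                    ((((n : ℝ) + 1) * L * (ε * p.1) - |u p| / 2) ^ 2 + 3 / 4 * |u p| ^ 2) /
                      (ε * p.1) := by
                  field_simp
                  ring
                rw [this]
                positivity
              linarith
            calc ((n : ℝ) + 1) * L * C * |u p| = C * (((n : ℝ) + 1) * L * |u p|) := by ring
              _ ≤ C * (ε * L ^ 2 * ((n : ℝ) + 1) + ε⁻¹ * (p.1⁻¹ * u p ^ 2)) := by gcongr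
              _ = _ := by ring
      _ = ε * (C * L ^ 2) * ∫ p, ((n : ℝ) + 1) * ind n p.1 ∂m +
          C * ε⁻¹ * ∫ p, ind n p.1 * (p.1⁻¹ * u p ^ 2) ∂m := by
          rw [integral_add ((iI n).const_mul _) ((iR n).const_mul _),
            integral_const_mul (ε * (C * L ^ 2)), integral_const_mul (C * ε⁻¹)]
      _ ≤ _ := by
          rw [← mul_assoc ε (C * L ^ 2)]
          gcongr
          exact hI n
  rw [Metric.tendsto_atTop]
  intro ε0 hε0
  set M := C * L ^ 2 * (μ K).toReal with hM
  have hM0 : 0 ≤ M := by positivity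
  -- This makes the bounded term at most `ε0 / 2`; adding one to `M` allows `M = 0`.
  set ε := ε0 / (2 * (M + 1)) with hεd
  have hε : 0 < ε := by positivity
  have hεM : ε * M ≤ ε0 / 2 := by
    rw [hεd, div_mul_eq_mul_div, div_le_div_iff₀ (by positivity) (by positivity)]
    nlinarith
  have hR' := hR.const_mul (C * ε⁻¹)
  rw [mul_zero] at hR'
  have h5 := hR'.eventually (Iio_mem_nhds (half_pos hε0))
  obtain ⟨N, hN⟩ := Filter.eventually_atTop.1 h5
  refine ⟨N, fun n hn => ?_⟩
  rw [Real.dist_eq, sub_zero]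
  have h6 := key ε hε n
  have h7 : C * ε⁻¹ * ∫ p, ind n p.1 * (p.1⁻¹ * u p ^ 2) ∂m < ε0 / 2 := hN n hn
  linarith

/-- The kernel is at most one in absolute value and `θ` lives over an interval of length one, so the
bound is the same for all cutoffs. -/
theorem abs_testKern_le {b : ℝ} {X : ℝ → ℝ} (hX : IsKernelFn b X) {θ : ℝ × E → ℝ}
    (hθ : IsTest (cyl U) θ) {C : ℝ} (hC : ∀ p, ‖θ p‖ ≤ C) (p : ℝ × E) : |testKern X θ p| ≤ C := by
  have hk : ∀ r s, |kern X r s| ≤ 1 := by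
    intro r s
    have h1 := hX.nonneg s
    have h2 := hX.le_one s
    unfold kern
    rw [abs_le]
    split_ifs <;> constructor <;> linarith
  have e : testKern X θ p = ∫ r in Set.Ioo (0 : ℝ) 1, θ (r, p.2) * kern X r p.1 :=
    (setIntegral_eq_integral_of_forall_compl_eq_zero fun r hr => by
      rw [hθ.eq_zero fun h => hr h.1, zero_mul]).symm
  rw [e, ← Real.norm_eq_abs]
  refine (norm_setIntegral_le_of_norm_le_const (C := C) measure_Ioo_lt_top fun r _ => ?_).trans ?_
  · rw [norm_mul]
    exact (mul_le_of_le_one_right (norm_nonneg _) (hk _ _)).trans (hC _)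
  · simp

/-- Dominated convergence. For fixed `s > 0` the rescaled cutoff vanishes at `s` as soon as `1/(n+1)
< s`, so the integrands are eventually equal to their limit; the majorant is integrable up to `s =
0` by `RadialInt` for `X = 0`. -/
theorem tendsto_integral_testKern {k : ℕ} {η : ℝ × E → (ℝ × E) [⋀^Fin (k + 1)]→L[ℝ] ℝ}
    (hr : RadialInt μ U (fun _ => 0) η) {θ : ℝ × E → ℝ}
    (hθ : IsTest (cyl U) θ) (v : Fin k → E) :
    Filter.Tendsto (fun n : ℕ => ∫ p, testKern (fun s => stdCutoff (((n : ℝ) + 1) * s)) θ p *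
        radialForm (η p) v ∂((volume.restrict (Set.Ioo 0 1)).prod μ))
      Filter.atTop (nhds (∫ p, testKern (fun _ => 0) θ p *
        radialForm (η p) v ∂((volume.restrict (Set.Ioo 0 1)).prod μ))) := by
  set K := Prod.snd '' tsupport θ with hKd
  have hK : IsCompact K := hθ.compact.isCompact.image continuous_snd
  have hKU : K ⊆ U := by
    rintro _ ⟨p, hp, rfl⟩
    exact (hθ.supp hp).2
  obtain ⟨C, hC⟩ := hθ.compact.exists_bound_of_continuous hθ.smooth.continuous
  have hz : ∀ (X : ℝ → ℝ) (p : ℝ × E), p.2 ∉ K → testKern X θ p = 0 := fun X p hp =>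
    integral_eq_zero_of_ae (Filter.Eventually.of_forall fun r => by
      have : θ (r, p.2) = 0 := image_eq_zero_of_notMem_tsupport fun h => hp ⟨_, h, rfl⟩
      simp [this])
  have hkf : ∀ n : ℕ, IsKernelFn (2 / 3 / ((n : ℝ) + 1)) (fun s => stdCutoff (((n : ℝ) + 1) * s)) :=
    fun n => (isCutoff_stdCutoff_mul (by positivity)).isKernelFn
  have i0 : Integrable (fun p : ℝ × E => radialForm (η p) v)
      ((volume.restrict (Set.Ioo 0 1)).prod (μ.restrict K)) := by
    rw [Measure.prod_restrict]
    have := hr K hKU hK v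
    simp only [sub_zero, one_mul] at this
    exact this
  have e5 : (volume.restrict (Set.Ioo (0 : ℝ) 1)).prod (μ.restrict K) =
      ((volume.restrict (Set.Ioo (0 : ℝ) 1)).prod μ).restrict (Set.univ ×ˢ K) := by
    rw [← Measure.prod_restrict, Measure.restrict_univ]
  have e4 : ∀ X : ℝ → ℝ, ∫ p, testKern X θ p * radialForm (η p) v
        ∂((volume.restrict (Set.Ioo 0 1)).prod μ) =
      ∫ p, testKern X θ p * radialForm (η p) v
        ∂((volume.restrict (Set.Ioo 0 1)).prod (μ.restrict K)) := by
    intro X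
    rw [e5]
    exact (setIntegral_eq_integral_of_forall_compl_eq_zero fun p hp => by
      rw [hz X p fun h => hp ⟨Set.mem_univ _, h⟩, zero_mul]).symm
  simp only [e4]
  have hcont : ∀ n : ℕ, Continuous (testKern (fun s => stdCutoff (((n : ℝ) + 1) * s)) θ) := by
    intro n
    rw [testKern_eq _ hθ]
    exact (contDiff_radialConv locallyIntegrable_negInd hθ.smooth hθ.compact).continuous.sub
      (((isCutoff_stdCutoff_mul (by positivity)).smooth.continuous.comp continuous_fst).mul
        (contDiff_radialConv (locallyIntegrable_const (1 : ℝ)) hθ.smooth hθ.compact).continuous)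
  refine tendsto_integral_of_dominated_convergence (fun p => C * ‖radialForm (η p) v‖)
    (fun n => (hcont n).aestronglyMeasurable.mul i0.aestronglyMeasurable) (i0.norm.const_mul C)
    (fun n => Filter.Eventually.of_forall fun p => ?_) ?_
  · rw [norm_mul]
    exact mul_le_mul_of_nonneg_right (abs_testKern_le (hkf n) hθ hC p) (norm_nonneg _)
  · have hae : ∀ᵐ p ∂((volume.restrict (Set.Ioo (0 : ℝ) 1)).prod (μ.restrict K)),
        p.1 ∈ Set.Ioo (0 : ℝ) 1 :=
      Measure.quasiMeasurePreserving_fst.ae (ae_restrict_mem measurableSet_Ioo)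
    filter_upwards [hae] with p hp
    refine tendsto_const_nhds.congr' ?_
    have h1 : Filter.Tendsto (fun n : ℕ => ((n : ℝ) + 1)⁻¹) Filter.atTop (nhds 0) := by
      simpa using tendsto_one_div_add_atTop_nhds_zero_nat (𝕜 := ℝ)
    filter_upwards [h1.eventually (Iio_mem_nhds hp.1)] with n hn
    have h2 : stdCutoff (((n : ℝ) + 1) * p.1) = 0 := by
      have hn' : (0 : ℝ) < (n : ℝ) + 1 := by positivity
      refine (isCutoff_stdCutoff_mul hn').eq_zero p.1 (le_trans ?_ (le_of_lt hn))
      rw [← one_div]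
      gcongr
      norm_num
    simp only [testKern, kern, h2]

/-- The homotopy formula `ω = d K₀ ω` for closed forms whose boundary values at `r = 0` are forced
to vanish. -/
theorem weakDeriv_homFlat_zero (hU : IsOpen U) {k : ℕ}
    {η : ℝ × E → (ℝ × E) [⋀^Fin (k + 1)]→L[ℝ] ℝ}
    (h : WeakDeriv (volume.prod μ) (cyl U) η 0) (hr : RadialInt μ U (fun _ => 0) η)
    (hA : ∀ K ⊆ U, IsCompact K → ∀ v : Fin (k + 1) → E,
      IntegrableOn (fun p : ℝ × E => p.1⁻¹ * sliceForm (η p) v ^ 2)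
        (Set.Ioo 0 1 ×ˢ K) (volume.prod μ)) :
    WeakDeriv (volume.prod μ) (cyl U) (fun q => cylForm (homFlat (fun _ => 0) η q)) η := by
  have hX := isKernelFn_zero (1 / 2)
  have l1 := locInt_homFlat hU hX (by norm_num) h.1 hr
  refine ⟨l1, h.1, fun ψ hψ => weakIdentity_of_prod l1 h.1 hψ (fun v => ?_) (fun v => ?_)⟩
  · have hP := isTest_vertical_integral hψ
    have t1 := tendsto_cutoff_error hP (hA _ hP.supp hP.compact v)
    have t2 := tendsto_finsetSum Finset.univ fun (j : Fin (k + 1)) _ =>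
      (tendsto_integral_testKern hr (hψ.fderiv (0, v j))
        (fun l => v (j.succAbove l))).const_mul ((-1 : ℝ) ^ (j : ℕ))
    have hc : ∀ n : ℕ, IsCutoff _ _ (fun s => stdCutoff (((n : ℝ) + 1) * s)) := fun n =>
      isCutoff_stdCutoff_mul (by positivity)
    have hb : ∀ n : ℕ, 2 / 3 / ((n : ℝ) + 1) < 1 := fun n => by
      rw [div_lt_one (by positivity)]
      have : (0 : ℝ) ≤ n := Nat.cast_nonneg n
      linarith
    have i1 : Integrable (fun p => ψ p * η p (fun j => (0, v j))) (volume.prod μ) :=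
      hψ.integrable_mul (h.1 _)
    -- For each `n` the transposed formula is exact. In the limit the term with `X_n'` disappears by
    -- `t1`, and the right side converges by `t2`.
    have e : ∀ n : ℕ, ∫ p, ψ p * η p (fun j => (0, v j)) ∂(volume.prod μ) +
        ∫ p : ℝ × E, (deriv (fun s => stdCutoff (((n : ℝ) + 1) * s)) p.1 * ∫ r, ψ (r, p.2)) *
          sliceForm (η p) v ∂(volume.prod μ) = -∑ j : Fin (k + 1), (-1 : ℝ) ^ (j : ℕ) *
        ∫ p, testKern (fun s => stdCutoff (((n : ℝ) + 1) * s)) (fun q => fderiv ℝ ψ q (0, v j)) p *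
          radialForm (η p) (fun l => v (j.succAbove l))
            ∂((volume.restrict (Set.Ioo 0 1)).prod μ) := by
      intro n
      have ht := (hc n).isTest_deriv (by positivity) (hb n)
      have i2 := (ht.mul hP).integrable_mul (h.1 fun j => (0, v j))
      rw [← h.sum_testKern (by positivity) (hb n) (hc n) hψ v, ← integral_add i1]
      · refine integral_congr_ae (Filter.Eventually.of_forall fun p => ?_)
        simp only [sliceForm_apply]
        ring
      · refine i2.neg.congr (Filter.Eventually.of_forall fun p => ?_)
        simp only [sliceForm_apply, Pi.neg_apply]
        ring
    have t3 := (tendsto_const_nhds (x := ∫ p, ψ p * η p (fun j => (0, v j))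
        ∂(volume.prod μ))).add t1
    have t4 := tendsto_nhds_unique (t3.congr e) t2.neg
    unfold WeakIdentity
    rw [add_zero] at t4
    rw [t4]
    congr 1
    refine Finset.sum_congr rfl fun j _ => ?_
    congr 1
    exact (integral_mul_homFlat hU hX (by norm_num) h.1 hr (hψ.fderiv _) _).symm
  · have := weakIdentity_hom_radial hU hX (by norm_num) h.1 hr (fun _ => 0) hψ v
    have z : (fun p : ℝ × E => η p - cylForm ((fun _ => 0 : E → E [⋀^Fin
        (k + 1)]→L[ℝ] ℝ) p.2)) = η :=
      funext fun p => sub_zero (η p)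
    rwa [z] at this

end Limit

/-! ### Passage from charts to the product manifold -/

section Charts

variable {E : Type*} [NormedAddCommGroup E] [NormedSpace ℝ E] [FiniteDimensional ℝ E]
  [MeasurableSpace E] [BorelSpace E] {F : Type*} [TopologicalSpace F] [ChartedSpace E F]

/-- The midpoint of `(0, 1)`. -/
def half : interval01 := ⟨1 / 2, by constructor <;> norm_num⟩

/-- The inverse of the chart of `(0, 1)`; it is the identity on `(0, 1)`. -/
def clip (t : ℝ) : interval01 := (extChartAt 𝓘(ℝ, ℝ) half).symm t

theorem extChartAt_interval01_apply (r s : interval01) : extChartAt 𝓘(ℝ, ℝ) r s = (s : ℝ) := rfl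

theorem extChartAt_interval01_target (r : interval01) :
    (extChartAt 𝓘(ℝ, ℝ) r).target = Set.Ioo 0 1 := by
  ext t
  constructor
  · intro ht
    have h := (extChartAt 𝓘(ℝ, ℝ) r).right_inv ht
    rw [extChartAt_interval01_apply] at h
    rw [← h]
    exact ((extChartAt 𝓘(ℝ, ℝ) r).symm t).2
  · intro ht
    exact (extChartAt 𝓘(ℝ, ℝ) r).map_source (x := (⟨t, ht⟩ : interval01))
      (mem_extChartAt_source (I := 𝓘(ℝ, ℝ)) (⟨t, ht⟩ : interval01))

theorem coe_clip {t : ℝ} (ht : t ∈ Set.Ioo (0 : ℝ) 1) : (clip t : ℝ) = t := by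
  have h := (extChartAt 𝓘(ℝ, ℝ) half).right_inv
    ((extChartAt_interval01_target half).symm ▸ ht)
  exact h

theorem mfderiv_coe_interval01 (r : interval01) :
    mfderiv 𝓘(ℝ, ℝ) 𝓘(ℝ, ℝ) (fun s : interval01 => (s : ℝ)) r = ContinuousLinearMap.id ℝ ℝ := by
  have := mfderiv_extChartAt_self (I := 𝓘(ℝ, ℝ)) (x := r)
  exact this

/-- The pullback of a form on `F` to `(0, 1) × F`. -/
def pull {k : ℕ} (ξ : Form 𝓘(ℝ, E) F k) : Form (𝓘(ℝ, ℝ).prod 𝓘(ℝ, E)) (interval01 × F) k :=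
  fun q => cylForm (E := E) (ξ q.2)

variable (F) in
theorem isOpen_coordDomain (x : F) : IsOpen (coordDomain 𝓘(ℝ, E) x) := isOpen_extChartAt_target x

theorem exists_coordFrame_equiv [IsManifold 𝓘(ℝ, E) ∞ F] {x : F} {y : E}
    (hy : y ∈ coordDomain 𝓘(ℝ, E) x) :
    ∃ A : E ≃L[ℝ] E, (A : E →L[ℝ] E) = coordFrame 𝓘(ℝ, E) x y := by
  have : IsManifold 𝓘(ℝ, E) 1 F := IsManifold.of_le (n := ∞) (by simp)
  have h := isInvertible_mfderivWithin_extChartAt_symm (I := 𝓘(ℝ, E)) hy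
  simp only [modelWithCornersSelf_coe, Set.range_id, mfderivWithin_univ] at h
  exact h

theorem coordDomain_prod (r : interval01) (x : F) :
    coordDomain (𝓘(ℝ, ℝ).prod 𝓘(ℝ, E)) (r, x) = cyl (coordDomain 𝓘(ℝ, E) x) := by
  rw [coordDomain, extChartAt_prod, PartialEquiv.prod_target, extChartAt_interval01_target]
  rfl

theorem extChartAt_prod_symm (r : interval01) (x : F) (p : ℝ × E) :
    (extChartAt (𝓘(ℝ, ℝ).prod 𝓘(ℝ, E)) (r, x)).symm p =
      (clip p.1, (extChartAt 𝓘(ℝ, E) x).symm p.2) := by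
  rw [extChartAt_prod]
  rfl

theorem mfderiv_clip {t : ℝ} (ht : t ∈ Set.Ioo (0 : ℝ) 1) :
    MDifferentiableAt 𝓘(ℝ, ℝ) 𝓘(ℝ, ℝ) clip t ∧
    mfderiv 𝓘(ℝ, ℝ) 𝓘(ℝ, ℝ) clip t = ContinuousLinearMap.id ℝ ℝ := by
  have hd : MDifferentiableAt 𝓘(ℝ, ℝ) 𝓘(ℝ, ℝ) clip t := by
    have h := mdifferentiableWithinAt_extChartAt_symm (I := 𝓘(ℝ, ℝ)) (x := half)
      ((extChartAt_interval01_target half).symm ▸ ht)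
    simp only [modelWithCornersSelf_coe, Set.range_id, mdifferentiableWithinAt_univ] at h
    exact h
  refine ⟨hd, ?_⟩
  have h := mfderiv_extChartAt_comp_mfderivWithin_extChartAt_symm (I := 𝓘(ℝ, ℝ)) (x := half)
      ((extChartAt_interval01_target half).symm ▸ ht)
  simp only [modelWithCornersSelf_coe, Set.range_id, mfderivWithin_univ] at h
  have e := mfderiv_coe_interval01 (clip t)
  have e' : mfderiv 𝓘(ℝ, ℝ) 𝓘(ℝ, ℝ) (extChartAt 𝓘(ℝ, ℝ) half)
      (clip t) = ContinuousLinearMap.id ℝ ℝ := e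
  change (mfderiv 𝓘(ℝ, ℝ) 𝓘(ℝ, ℝ) (extChartAt 𝓘(ℝ, ℝ) half) (clip t)).comp
      (mfderiv 𝓘(ℝ, ℝ) 𝓘(ℝ, ℝ) clip t) = _ at h
  rw [e'] at h
  exact h

theorem coordFrame_prod [IsManifold 𝓘(ℝ, E) ∞ F] (r : interval01) {x : F} {p : ℝ × E}
    (hp : p ∈ cyl (coordDomain 𝓘(ℝ, E) x)) :
    coordFrame (𝓘(ℝ, ℝ).prod 𝓘(ℝ, E)) (r, x) p =
      (ContinuousLinearMap.id ℝ ℝ).prodMap (coordFrame 𝓘(ℝ, E) x p.2) := by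
  have : IsManifold 𝓘(ℝ, E) 1 F := IsManifold.of_le (n := ∞) (by simp)
  have e : ((extChartAt (𝓘(ℝ, ℝ).prod 𝓘(ℝ, E)) (r, x)).symm : ℝ × E → interval01 × F) =
      Prod.map clip (extChartAt 𝓘(ℝ, E) x).symm := funext fun p => extChartAt_prod_symm r x p
  have h2 := mdifferentiableWithinAt_extChartAt_symm (I := 𝓘(ℝ, E)) (x := x) hp.2
  simp only [modelWithCornersSelf_coe, Set.range_id, mdifferentiableWithinAt_univ] at h2
  have h := mfderiv_prodMap (p := p) (mfderiv_clip hp.1).1 h2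
  rw [(mfderiv_clip hp.1).2, ← modelWithCornersSelf_prod, chartedSpaceSelf_prod] at h
  unfold coordFrame
  rw [e]
  exact h

theorem coordForm_pull [IsManifold 𝓘(ℝ, E) ∞ F] {k : ℕ} (ξ : Form 𝓘(ℝ, E) F k) (r : interval01)
    {x : F} {p : ℝ × E}
    (hp : p ∈ cyl (coordDomain 𝓘(ℝ, E) x)) :
    coordForm (pull ξ) (r, x) p = cylForm (coordForm ξ x p.2) := by
  unfold coordForm
  rw [coordFrame_prod r hp, extChartAt_prod_symm]
  rfl

/-- The value at `(r, x)` of a form on `(0, 1) × F`, as a form on `ℝ × E`. -/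
def prodValue {k : ℕ} (η : Form (𝓘(ℝ, ℝ).prod 𝓘(ℝ, E)) (interval01 × F) k) (r : interval01)
    (x : F) :
    (ℝ × E) [⋀^Fin k]→L[ℝ] ℝ := η (r, x)

/-- The average `∫ χ(s) ω_s ds` of a form on `(0, 1) × F`. -/
def avgForm {k : ℕ} (χ : ℝ → ℝ) (η : Form (𝓘(ℝ, ℝ).prod 𝓘(ℝ, E))
    (interval01 × F) k) : Form 𝓘(ℝ, E) F k :=
  fun x => intForm (E := E) (volume.restrict (Set.Ioo (0 : ℝ) 1)) (fun s => χ s • sliceForm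
    (prodValue η (clip s) x))

/-- The chart of the product is the identity in `r` times a chart of `F`, so its frame is `id × A`
with `A` independent of `r`. Hence slicing and contraction with `∂_r` commute with passing to
coordinates. -/
theorem coordForm_prodValue [IsManifold 𝓘(ℝ, E) ∞ F] {k : ℕ}
    (η : Form (𝓘(ℝ, ℝ).prod 𝓘(ℝ, E)) (interval01 × F) k) (r : interval01) {x : F} {p : ℝ × E}
    (hp : p ∈ cyl (coordDomain 𝓘(ℝ, E) x)) :
    coordForm η (r, x) p = (prodValue η (clip p.1) ((extChartAt 𝓘(ℝ, E) x).symm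
      p.2)).compContinuousLinearMap
      ((ContinuousLinearMap.id ℝ ℝ).prodMap (coordFrame 𝓘(ℝ, E) x p.2 : E →L[ℝ] E)) := by
  unfold coordForm
  rw [coordFrame_prod r hp, extChartAt_prod_symm]
  rfl

theorem sliceForm_prodMap {k : ℕ} (η : (ℝ × E) [⋀^Fin k]→L[ℝ] ℝ) (A : E →L[ℝ] E) :
    sliceForm (η.compContinuousLinearMap ((ContinuousLinearMap.id ℝ ℝ).prodMap A)) =
      (sliceForm η).compContinuousLinearMap A := rfl

theorem radialForm_prodMap {k : ℕ} (η : (ℝ × E) [⋀^Fin (k + 1)]→L[ℝ] ℝ) (A : E →L[ℝ] E) :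
    radialForm (η.compContinuousLinearMap ((ContinuousLinearMap.id ℝ ℝ).prodMap A)) =
      (radialForm η).compContinuousLinearMap A := by
  ext v
  rw [radialForm_apply, ContinuousAlternatingMap.compContinuousLinearMap_apply,
    ContinuousAlternatingMap.compContinuousLinearMap_apply, radialForm_apply]
  congr 1
  funext j
  refine Fin.cases ?_ (fun j => ?_) j <;> simp

/-- The frame at `y` does not depend on the integration variable and is invertible, so it may be
taken out of the integral by `intForm_comp`. -/
theorem coordForm_avgForm [IsManifold 𝓘(ℝ, E) ∞ F] {k : ℕ} (χ : ℝ → ℝ)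
    (η : Form (𝓘(ℝ, ℝ).prod 𝓘(ℝ, E)) (interval01 × F) k) (r : interval01) {x : F} {y : E}
    (hy : y ∈ coordDomain 𝓘(ℝ, E) x) :
    coordForm (avgForm χ η) x y = avgFlat χ (coordForm η (r, x)) y := by
  obtain ⟨A, hA⟩ := exists_coordFrame_equiv hy
  refine Eq.trans ?_ ((intForm_comp (ν := volume.restrict (Set.Ioo (0 : ℝ) 1)) (fun s => χ s •
    sliceForm (prodValue η (clip s) ((extChartAt 𝓘(ℝ, E) x).symm y))) A).trans (intForm_congr ?_))
  · rw [hA]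
    rfl
  filter_upwards [ae_restrict_mem measurableSet_Ioo] with s hs
  have h := coordForm_prodValue η r (p := (s, y)) ⟨hs, hy⟩
  rw [← hA] at h
  erw [h, sliceForm_prodMap]
  rfl

/-- The homotopy operator on forms on `(0, 1) × F`. -/
def homForm {k : ℕ} (X : ℝ → ℝ) (η : Form (𝓘(ℝ, ℝ).prod 𝓘(ℝ, E)) (interval01 × F) (k + 1)) :
    Form (𝓘(ℝ, ℝ).prod 𝓘(ℝ, E)) (interval01 × F) k := fun q =>
  cylForm (E := E) (intForm (volume.restrict (Set.Ioo (0 : ℝ) 1))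
    (fun s => kern X (q.1 : ℝ) s • radialForm (prodValue η (clip s) q.2)))

/-- As for the average, the frame passes through the integral. Thus the radial operator has the same
formula in every chart. -/
theorem coordForm_homForm [IsManifold 𝓘(ℝ, E) ∞ F] {k : ℕ} (X : ℝ → ℝ)
    (η : Form (𝓘(ℝ, ℝ).prod 𝓘(ℝ, E)) (interval01 × F) (k + 1)) (r : interval01) {x : F} {p : ℝ × E}
    (hp : p ∈ cyl (coordDomain 𝓘(ℝ, E) x)) :
    coordForm (homForm X η) (r, x) p = cylForm (homFlat X (coordForm η (r, x)) p) := by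
  obtain ⟨A, hA⟩ := exists_coordFrame_equiv hp.2
  have h1 : homFlat X (coordForm η (r, x)) p = (intForm (volume.restrict (Set.Ioo (0 : ℝ) 1))
      (fun s => kern X p.1 s • radialForm (prodValue η (clip s)
        ((extChartAt 𝓘(ℝ, E) x).symm p.2)))).compContinuousLinearMap (A : E →L[ℝ] E) := by
    rw [intForm_comp]
    refine intForm_congr ?_
    filter_upwards [ae_restrict_mem measurableSet_Ioo] with s hs
    have h := coordForm_prodValue η r (p := (s, p.2)) ⟨hs, hp.2⟩
    rw [← hA] at h
    erw [h, radialForm_prodMap]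
    rfl
  have h2 := coordForm_prodValue (homForm X η) r hp
  rw [h2, h1, ← hA]
  simp only [prodValue, homForm, coe_clip hp.1]
  rfl

theorem coneMetric_eq (c : ℝ) (g : BilinField 𝓘(ℝ, E) F) (q : interval01 × F) :
   coneMetric c g q = warpedForm (E := E) ((q.1 : ℝ) ^ (2 * c)) (g q.2) := by
  have h1 : mfderiv (𝓘(ℝ, ℝ).prod 𝓘(ℝ, E)) 𝓘(ℝ, ℝ) (fun p : interval01 × F => (p.1 : ℝ)) q =
      ContinuousLinearMap.fst ℝ ℝ E := by
    have := mfderiv_comp (I := 𝓘(ℝ, ℝ).prod 𝓘(ℝ, E)) (I' := 𝓘(ℝ, ℝ)) (I'' := 𝓘(ℝ, ℝ)) q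
        (f := Prod.fst) (g := fun s : interval01 => (s : ℝ))
       (mdifferentiableAt_extChartAt (I := 𝓘(ℝ, ℝ)) (x := q.1) (by simp)) mdifferentiableAt_fst
    rw [mfderiv_coe_interval01, mfderiv_fst] at this
    exact this
  unfold coneMetric
  rw [h1, mfderiv_snd]
  rfl

theorem isWeakExtDeriv_iff {k : ℕ} {α : Form 𝓘(ℝ, E) F k} {β : Form 𝓘(ℝ, E) F (k + 1)} :
    IsWeakExtDeriv α β ↔ ∀ x : F, WeakDeriv (modelMeasure E) (coordDomain 𝓘(ℝ, E) x)
      (coordForm α x) (coordForm β x) :=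
  ⟨fun h x => ⟨h.1 x, h.2.1 x, fun ψ hψ v => h.2.2 x ψ hψ.smooth hψ.compact hψ.supp v⟩,
    fun h => ⟨fun x => (h x).1, fun x => (h x).2.1,
      fun x ψ h1 h2 h3 v => (h x).2.2 ψ ⟨h1, h2, h3⟩ v⟩⟩

instance : (modelMeasure E).IsAddHaarMeasure :=
  inferInstanceAs (Module.finBasis ℝ E).addHaar.IsAddHaarMeasure

variable (E) in
theorem exists_modelMeasure_prod : ∃ κ : ℝ≥0∞, κ ≠ 0 ∧ κ ≠ ⊤ ∧
    modelMeasure (ℝ × E) = κ • (volume : Measure ℝ).prod (modelMeasure E) :=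
  ⟨_, ENNReal.coe_ne_zero.2 (Measure.addHaarScalarFactor_pos_of_isAddHaarMeasure _ _).ne',
    ENNReal.coe_ne_top, Measure.isAddLeftInvariant_eq_smul _ _⟩

/-- All charts of `(0, 1)` are the inclusion in `ℝ`, so the chart at `(r, x)` does not depend on `r`
and one base point `half` suffices. The constant between the two measures is irrelevant. -/
theorem isWeakExtDeriv_cyl_iff {k : ℕ}
    {α : Form (𝓘(ℝ, ℝ).prod 𝓘(ℝ, E)) (interval01 × F) k}
    {β : Form (𝓘(ℝ, ℝ).prod 𝓘(ℝ, E)) (interval01 × F) (k + 1)} :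
    IsWeakExtDeriv α β ↔ ∀ x : F, WeakDeriv (volume.prod (modelMeasure E))
      (cyl (coordDomain 𝓘(ℝ, E) x)) (coordForm α (half, x)) (coordForm β (half, x)) := by
  obtain ⟨κ, h0, h1, hκ⟩ := exists_modelMeasure_prod E
  have e : IsWeakExtDeriv α β ↔ ∀ q : interval01 × F, WeakDeriv (modelMeasure (ℝ × E))
      (coordDomain (𝓘(ℝ, ℝ).prod 𝓘(ℝ, E)) q) (coordForm α q) (coordForm β q) :=
    ⟨fun h x => ⟨h.1 x, h.2.1 x, fun ψ hψ v => h.2.2 x ψ hψ.smooth hψ.compact hψ.supp v⟩,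
      fun h => ⟨fun x => (h x).1, fun x => (h x).2.1,
        fun x ψ h1 h2 h3 v => (h x).2.2 ψ ⟨h1, h2, h3⟩ v⟩⟩
  rw [e]
  constructor
  · intro h x
    have := h (half, x)
    rwa [hκ, weakDeriv_smul_measure h0 h1, coordDomain_prod] at this
  · rintro h ⟨r, x⟩
    rw [hκ, weakDeriv_smul_measure h0 h1, coordDomain_prod]
    exact h x

variable [IsManifold 𝓘(ℝ, E) ∞ F]

theorem isWeakExtDeriv_pull {k : ℕ} {ξ : Form 𝓘(ℝ, E) F k} {ξ' : Form 𝓘(ℝ, E) F (k + 1)}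
    (h : IsWeakExtDeriv ξ ξ') : IsWeakExtDeriv (pull ξ) (pull ξ') := by
  rw [isWeakExtDeriv_cyl_iff]
  intro x
  have hU := isOpen_coordDomain (E := E) F x
  exact (weakDeriv_cylForm hU (isWeakExtDeriv_iff.1 h x)).congr_ae (isOpen_cyl hU).measurableSet
    (Filter.Eventually.of_forall fun p hp => (coordForm_pull ξ half hp).symm)
    (Filter.Eventually.of_forall fun p hp => (coordForm_pull ξ' half hp).symm)

theorem isWeakExtDeriv_avgForm {k : ℕ} {χ : ℝ → ℝ} (hχ : IsTest (Set.Ioo (0 : ℝ) 1) χ)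
    {η : Form (𝓘(ℝ, ℝ).prod 𝓘(ℝ, E)) (interval01 × F) k}
    {η' : Form (𝓘(ℝ, ℝ).prod 𝓘(ℝ, E)) (interval01 × F) (k + 1)} (h : IsWeakExtDeriv η η') :
    IsWeakExtDeriv (avgForm χ η) (avgForm χ η') := by
  rw [isWeakExtDeriv_iff]
  intro x
  have hU := isOpen_coordDomain (E := E) F x
  exact (weakDeriv_avgFlat hU hχ (isWeakExtDeriv_cyl_iff.1 h x)).congr_ae hU.measurableSet
    (Filter.Eventually.of_forall fun y hy => (coordForm_avgForm χ η half hy).symm)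
    (Filter.Eventually.of_forall fun y hy => (coordForm_avgForm χ η' half hy).symm)

theorem isWeakExtDeriv_homForm {k : ℕ} {a b : ℝ} (ha : 0 < a) (hb : b < 1) {X : ℝ → ℝ}
    (hX : IsCutoff a b X) {η : Form (𝓘(ℝ, ℝ).prod 𝓘(ℝ, E)) (interval01 × F) (k + 1)}
    (h : IsWeakExtDeriv η 0)
    (hr : ∀ x : F, RadialInt (modelMeasure E) (coordDomain 𝓘(ℝ, E) x) X (coordForm η (half, x))) :
    IsWeakExtDeriv (homForm X η) (η - pull (avgForm (fun s => -deriv X s) η)) := by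
  rw [isWeakExtDeriv_cyl_iff]
  intro x
  have hU := isOpen_coordDomain (E := E) F x
  refine (weakDeriv_homFlat hU (isWeakExtDeriv_cyl_iff.1 h x) ha hb hX (hr x)).congr_ae
    (isOpen_cyl hU).measurableSet
    (Filter.Eventually.of_forall fun p hp => (coordForm_homForm X η half hp).symm)
    (Filter.Eventually.of_forall fun p hp => ?_)
  rw [← coordForm_avgForm _ η half hp.2, ← coordForm_pull _ half hp]
  rfl

theorem isWeakExtDeriv_homForm_zero {k : ℕ}
    {η : Form (𝓘(ℝ, ℝ).prod 𝓘(ℝ, E)) (interval01 × F) (k + 1)} (h : IsWeakExtDeriv η 0)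
    (hr : ∀ x : F, RadialInt (modelMeasure E) (coordDomain 𝓘(ℝ, E) x) (fun _ => 0)
      (coordForm η (half, x)))
    (hA : ∀ x : F, ∀ K ⊆ coordDomain 𝓘(ℝ, E) x, IsCompact K → ∀ v : Fin (k + 1) → E,
      IntegrableOn (fun p : ℝ × E => p.1⁻¹ * sliceForm (coordForm η (half, x) p) v ^ 2)
        (Set.Ioo 0 1 ×ˢ K) (volume.prod (modelMeasure E))) :
    IsWeakExtDeriv (homForm (fun _ => 0) η) η := by
  rw [isWeakExtDeriv_cyl_iff]
  intro x
  have hU := isOpen_coordDomain (E := E) F x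
  exact (weakDeriv_homFlat_zero hU (isWeakExtDeriv_cyl_iff.1 h x) (hr x) (hA x)).congr_ae
    (isOpen_cyl hU).measurableSet
    (Filter.Eventually.of_forall fun p hp => (coordForm_homForm _ η half hp).symm)
    (Filter.Eventually.of_forall fun p _ => rfl)

theorem ae_coordForm_eq_zero_of_degree_zero {a b : ℝ} (ha : 0 < a) (hb : b < 1) {X : ℝ → ℝ}
    (hX : IsCutoff a b X) {η : Form (𝓘(ℝ, ℝ).prod 𝓘(ℝ, E)) (interval01 × F) 0}
    (h : IsWeakExtDeriv η 0) (x : F) :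
    ∀ᵐ p ∂((volume : Measure ℝ).prod (modelMeasure E)), p ∈ cyl (coordDomain 𝓘(ℝ, E) x) →
      coordForm (η - pull (avgForm (fun s => -deriv X s) η)) (half, x) p = 0 := by
  have hU := isOpen_coordDomain (E := E) F x
  filter_upwards [ae_eq_avg_of_degree_zero hU (isWeakExtDeriv_cyl_iff.1 h x) ha hb hX] with p hp hpU
  have := hp hpU
  rw [← coordForm_avgForm _ η half hpU.2, ← coordForm_pull _ half hpU] at this
  exact this

theorem LocIntegrableForm.measurableForm {H : Type*} [TopologicalSpace H]
    {I : ModelWithCorners ℝ E H}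
    {M : Type*} [TopologicalSpace M] [ChartedSpace H M] {k : ℕ} {α : Form I M k}
    (h : LocIntegrableForm α) : MeasurableForm α :=
  fun x v => (h x v).aestronglyMeasurable.aemeasurable

end Charts

/-! ### Gluing measures over a countable cover -/

section Gluing

variable {M ι : Type*} [MeasurableSpace M]

/-- Every `l i` is a restriction of `ν`, hence at most `ν`; conversely, on each `U i` the supremum
dominates `l i = ν`. A countable cover suffices to compare two measures. -/
theorem iSup_eq_of_restrict_eq {l : ι → Measure M} {U : ι → Set M} {s : Set ι} (hs : s.Countable)
    (hcov : ⋃ i ∈ s, U i = Set.univ) (hU : ∀ i, MeasurableSet (U i)) {ν : Measure M}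
    (hν : ∀ i, ν.restrict (U i) = l i) : ⨆ i, l i = ν := by
  have h : ∀ i, l i ≤ ν := fun i => hν i ▸ Measure.restrict_le_self
  have h2 : ⨆ i, l i ≤ ν := iSup_le h
  refine (Measure.ext_iff_of_biUnion_eq_univ hs hcov).2 fun i _ => le_antisymm
    (Measure.restrict_mono subset_rfl h2) ?_
  have h3 : (l i).restrict (U i) = ν.restrict (U i) := by
    rw [← hν i, Measure.restrict_restrict (hU i), Set.inter_self]
  rw [← h3]
  exact Measure.restrict_mono subset_rfl (le_iSup l i)

/-- Make the countable cover disjoint and sum the restricted pieces. By compatibility the sum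
restricts to each `l i`, and so it is the supremum. -/
theorem restrict_iSup_eq {l : ι → Measure M} {U : ι → Set M} {s : Set ι} (hs : s.Countable)
    (hcov : ⋃ i ∈ s, U i = Set.univ) (hU : ∀ i, MeasurableSet (U i))
    (hl : ∀ i, (l i).restrict (U i) = l i)
    (hc : ∀ i j S, MeasurableSet S → S ⊆ U i → S ⊆ U j → l i S ≤ l j S) (i : ι) :
    (⨆ j, l j).restrict (U i) = l i := by
  rcases s.eq_empty_or_nonempty with rfl | hne
  · have : IsEmpty M := Set.univ_eq_empty_iff.1 (by simpa using hcov.symm)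
    exact Measure.ext_iff.2 fun S _ => by simp [Set.eq_empty_of_isEmpty S]
  obtain ⟨e, rfl⟩ := hs.exists_eq_range hne
  -- The compatibility inequality is assumed for all ordered pairs, so it is an equality.
  have hc' : ∀ i j S, MeasurableSet S → S ⊆ U i → S ⊆ U j → l i S = l j S := fun i j S h1 h2 h3 =>
    le_antisymm (hc i j S h1 h2 h3) (hc j i S h1 h3 h2)
  set D := disjointed fun n => U (e n) with hD
  have hDm : ∀ n, MeasurableSet (D n) := fun n => MeasurableSet.disjointed (fun n => hU (e n)) n
  have hDU : ⋃ n, D n = Set.univ := by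
    rw [hD, iUnion_disjointed]
    simpa using hcov
  have key : ∀ i, (Measure.sum fun n => (l (e n)).restrict (D n)).restrict (U i) = l i := by
    intro i
    refine Measure.ext fun S hS => ?_
    rw [Measure.restrict_apply hS, Measure.sum_apply _ (hS.inter (hU i))]
    have h1 : l i S = l i (⋃ n, (S ∩ U i ∩ D n)) := by
      rw [← Set.inter_iUnion, hDU, Set.inter_univ]
      conv_lhs => rw [← hl i, Measure.restrict_apply hS]
    rw [h1, measure_iUnion]
    · refine tsum_congr fun n => ?_
      rw [Measure.restrict_apply (hS.inter (hU i))]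
      exact hc' _ _ _ ((hS.inter (hU i)).inter (hDm n))
        (Set.inter_subset_right.trans (disjointed_subset _ n))
        (Set.inter_subset_left.trans Set.inter_subset_right)
    · intro m n hmn
      exact ((disjoint_disjointed (fun n => U (e n))) hmn).mono Set.inter_subset_right
        Set.inter_subset_right
    · exact fun n => (hS.inter (hU i)).inter (hDm n)
  rw [iSup_eq_of_restrict_eq hs hcov hU key]
  exact key i

end Gluing

/-! ### Regularity of the metric in coordinates -/

section Volume

variable {E : Type*} [NormedAddCommGroup E] [NormedSpace ℝ E] [FiniteDimensional ℝ E]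
  [MeasurableSpace E] [BorelSpace E] {F : Type*} [TopologicalSpace F] [ChartedSpace E F]
  [IsManifold 𝓘(ℝ, E) ∞ F]

theorem isInnerForm_inner (g : Bundle.ContMDiffRiemannianMetric 𝓘(ℝ, E) ∞ E
      (fun x : F => TangentSpace 𝓘(ℝ, E) x)) (x : F) : IsInnerForm (V := E) (g.inner x) :=
  ⟨g.symm x, g.pos x⟩

/-- The frame is the tangent map of the inverse chart applied to the constant section `v`, and both
are smooth. -/
theorem contMDiffOn_coordFrame (x : F) (v : E) :
    ContMDiffOn 𝓘(ℝ, E) (𝓘(ℝ, E).prod 𝓘(ℝ, E)) ∞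
      (fun y => (⟨(extChartAt 𝓘(ℝ, E) x).symm y, coordFrame 𝓘(ℝ, E) x y v⟩ :
        TangentBundle 𝓘(ℝ, E) F)) (coordDomain 𝓘(ℝ, E) x) := by
  have hU : IsOpen (extChartAt 𝓘(ℝ, E) x).target := isOpen_coordDomain (E := E) F x
  have h := (contMDiffOn_extChartAt_symm (I := 𝓘(ℝ, E)) (n := ∞) x).contMDiffOn_tangentMapWithin
    (m := ∞) (by simp) hU.uniqueMDiffOn
  have hs : ContMDiffOn 𝓘(ℝ, E) (𝓘(ℝ, E).prod 𝓘(ℝ, E)) ∞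
      (fun y => (⟨y, v⟩ : TangentBundle 𝓘(ℝ, E) E)) (extChartAt 𝓘(ℝ, E) x).target := by
    refine ContMDiff.contMDiffOn ?_
    refine contMDiff_vectorSpace_iff_contDiff.2 contDiff_const
  refine (h.comp hs (fun y hy => hy)).congr fun y hy => ?_
  simp only [Function.comp, tangentMapWithin, coordFrame]
  rw [mfderivWithin_of_isOpen hU hy]
  rfl

theorem continuousOn_coordGram (g : Bundle.ContMDiffRiemannianMetric 𝓘(ℝ, E) ∞ E
      (fun x : F => TangentSpace 𝓘(ℝ, E) x)) (x : F) (v w : E) :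
    ContinuousOn (fun y => g.inner ((extChartAt 𝓘(ℝ, E) x).symm y)
      (coordFrame 𝓘(ℝ, E) x y v) (coordFrame 𝓘(ℝ, E) x y w)) (coordDomain 𝓘(ℝ, E) x) := by
  have hv := contMDiffOn_coordFrame x v
  have hw := contMDiffOn_coordFrame x w
  have hb := contMDiffOn_extChartAt_symm (I := 𝓘(ℝ, E)) (n := ∞) x
  have h : ContMDiffOn 𝓘(ℝ, E) (𝓘(ℝ, E).prod 𝓘(ℝ, ℝ)) ∞ (fun y =>
      Bundle.TotalSpace.mk' ℝ (E := Bundle.Trivial F ℝ) ((extChartAt 𝓘(ℝ, E) x).symm y)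
        (g.inner ((extChartAt 𝓘(ℝ, E) x).symm y) (coordFrame 𝓘(ℝ, E) x y v)
          (coordFrame 𝓘(ℝ, E) x y w))) (coordDomain 𝓘(ℝ, E) x) := by
    intro y hy
    apply ContMDiffWithinAt.clm_bundle_apply₂ (F₁ := E) (F₂ := E)
    · exact ContMDiffAt.comp_contMDiffWithinAt (I' := 𝓘(ℝ, E))
        (g := fun b => _) y g.contMDiff.contMDiffAt (hb y hy)
    · exact hv y hy
    · exact hw y hy
  intro y hy
  have h2 := h y hy
  simp only [Bundle.contMDiffWithinAt_totalSpace] at h2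
  exact h2.2.continuousWithinAt

end Volume

/-! ### Gram determinants -/

section Gram

variable {V : Type*} [AddCommGroup V] [Module ℝ V] [TopologicalSpace V] {ι κ : Type*}

/-- The matrix `B (u a) (u b)` of a bilinear form on a family of vectors. -/
def gram (B : V →L[ℝ] V →L[ℝ] ℝ) (u : ι → V) : Matrix ι ι ℝ :=
  Matrix.of fun a b => B (u a) (u b)

theorem gram_eq_mul [Fintype κ] (B : V →L[ℝ] V →L[ℝ] ℝ) (b : Module.Basis κ ℝ V) (u : ι → V) :
    gram B u = (b.toMatrix u).transpose * gram B b * b.toMatrix u := by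
  ext i j
  simp only [gram, Matrix.of_apply, Matrix.mul_apply, Matrix.transpose_apply,
    Module.Basis.toMatrix_apply, Finset.sum_mul]
  conv_lhs => rw [← b.sum_repr (u i), ← b.sum_repr (u j)]
  simp only [map_sum, map_smul, _root_.sum_apply, _root_.smul_apply,
    smul_eq_mul, Finset.mul_sum]
  refine Finset.sum_congr rfl fun k _ => Finset.sum_congr rfl fun l _ => ?_
  ring

theorem det_gram_eq_mul [Fintype κ] [DecidableEq κ] (B : V →L[ℝ] V →L[ℝ] ℝ)
    (b : Module.Basis κ ℝ V) (u : κ → V) :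
    (gram B u).det = (b.toMatrix u).det ^ 2 * (gram B b).det := by
  rw [gram_eq_mul B b u, Matrix.det_mul, Matrix.det_mul, Matrix.det_transpose]
  ring

theorem det_gram_pos [Fintype κ] [DecidableEq κ] {B : V →L[ℝ] V →L[ℝ] ℝ} (hB : IsInnerForm B)
    (b : Module.Basis κ ℝ V) : 0 < (gram B b).det := by
  refine Matrix.PosDef.det_pos (Matrix.PosDef.of_dotProduct_mulVec_pos ?_ fun x hx => ?_)
  · ext i j
    exact hB.symm _ _
  · have h : (∑ i, x i • b i) ≠ 0 := by
      intro h0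
      exact hx (funext (Fintype.linearIndependent_iff.1 b.linearIndependent x h0))
    have := hB.pos _ h
    simp only [map_sum, map_smul, _root_.sum_apply, _root_.smul_apply,
      smul_eq_mul] at this
    refine this.trans_eq ?_
    simp only [dotProduct, Matrix.mulVec, gram, Matrix.of_apply, star_trivial, Pi.star_apply,
        Finset.mul_sum]
    rw [Finset.sum_comm]
    refine Finset.sum_congr rfl fun k _ => Finset.sum_congr rfl fun l _ => ?_
    ring

variable {E : Type*} [NormedAddCommGroup E] [NormedSpace ℝ E] [FiniteDimensional ℝ E]

variable (E) in
-- In the basis formed by `∂_r` and a basis of `E` the Gram matrix is block diagonal with blocks `1`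
-- and `ρ B`. `C` is the absolute determinant of the change to the chosen basis of `ℝ × E`, so it
-- depends on neither `ρ` nor `B`.
theorem exists_det_gram_warpedForm : ∃ C : ℝ, 0 < C ∧ ∀ (ρ : ℝ) (B : E →L[ℝ] E →L[ℝ] ℝ),
    (gram (warpedForm ρ B) (Module.finBasis ℝ (ℝ × E))).det =
      C ^ 2 * (ρ ^ (Module.finrank ℝ E) * (gram B (Module.finBasis ℝ E)).det) := by
  set b : Module.Basis (Unit ⊕ Fin (Module.finrank ℝ E)) ℝ (ℝ × E) :=
    (Module.Basis.singleton Unit ℝ).prod (Module.finBasis ℝ E) with hb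
  set e := b.indexEquiv (Module.finBasis ℝ (ℝ × E))
  refine ⟨|((b.reindex e).toMatrix (Module.finBasis ℝ (ℝ × E))).det|, ?_, fun ρ B => ?_⟩
  · refine abs_pos.2 fun h => ?_
    have h2 := congr_arg Matrix.det
      ((b.reindex e).toMatrix_mul_toMatrix_flip (Module.finBasis ℝ (ℝ × E)))
    rw [Matrix.det_mul, h] at h2
    simp at h2
  · rw [det_gram_eq_mul _ (b.reindex e), sq_abs]
    congr 1
    have h1 : gram (warpedForm ρ B) (b.reindex e) =
        (gram (warpedForm ρ B) b).submatrix e.symm e.symm := by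
      ext i j
      simp [gram]
    have h2 : gram (warpedForm ρ B) b =
        Matrix.fromBlocks 1 0 0 (ρ • gram B (Module.finBasis ℝ E)) := by
      ext i j
      rcases i with i | i <;> rcases j with j | j <;>
        simp [gram, hb, warpedForm_apply]
    rw [h1, Matrix.det_submatrix_equiv_self, h2, Matrix.det_fromBlocks_zero₂₁, Matrix.det_one,
      one_mul, Matrix.det_smul, Fintype.card_fin]

end Gram

/-! ### Local volumes and changes of charts -/

section Volume

variable {E : Type*} [NormedAddCommGroup E] [NormedSpace ℝ E] [FiniteDimensional ℝ E]
  [MeasurableSpace E] [BorelSpace E] {F : Type*} [TopologicalSpace F] [ChartedSpace E F]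
  [IsManifold 𝓘(ℝ, E) ∞ F]

/-- The density of the volume in coordinates. -/
def coordDensity {G : Type*} [NormedAddCommGroup G] [NormedSpace ℝ G] [FiniteDimensional ℝ G]
    {H : Type*} [TopologicalSpace H] {I : ModelWithCorners ℝ G H} {M : Type*} [TopologicalSpace M]
    [ChartedSpace H M] (g : BilinField I M) (x : M) (y : G) : ℝ :=
  Real.sqrt (coordGram g x y).det

theorem coordDensity_pos (g : Bundle.ContMDiffRiemannianMetric 𝓘(ℝ, E) ∞ E
      (fun x : F => TangentSpace 𝓘(ℝ, E) x)) {x : F} {y : E} (hy : y ∈ coordDomain 𝓘(ℝ, E) x) :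
    0 < coordDensity g.inner x y := by
  obtain ⟨A, hA⟩ := exists_coordFrame_equiv hy
  refine Real.sqrt_pos.2 ?_
  have h := det_gram_pos (isInnerForm_inner g ((extChartAt 𝓘(ℝ, E) x).symm y))
    ((Module.finBasis ℝ E).map A.toLinearEquiv)
  convert h using 2
  ext i j
  simp only [coordGram, ← hA]
  rfl

theorem continuousOn_coordDensity (g : Bundle.ContMDiffRiemannianMetric 𝓘(ℝ, E) ∞ E
      (fun x : F => TangentSpace 𝓘(ℝ, E) x)) (x : F) :
    ContinuousOn (coordDensity g.inner x) (coordDomain 𝓘(ℝ, E) x) := by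
  unfold coordDensity
  simp only [coordGram, Matrix.det_apply]
  refine ContinuousOn.sqrt (continuousOn_finsetSum _ fun s _ => ContinuousOn.const_smul
    (continuousOn_finsetProd _ fun i _ => ?_) _)
  exact continuousOn_coordGram g x _ _

/-- By the chain rule the two frames at one point differ by the derivative of the transition map.
The Gram determinants therefore differ by the square of its Jacobian. -/
theorem coordDensity_change (g : Bundle.ContMDiffRiemannianMetric 𝓘(ℝ, E) ∞ E
      (fun x : F => TangentSpace 𝓘(ℝ, E) x)) {x x' : F} {y : E} (hy : y ∈ coordDomain 𝓘(ℝ, E) x)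
    (hy' : (extChartAt 𝓘(ℝ, E) x).symm y ∈ (extChartAt 𝓘(ℝ, E) x').source) :
    DifferentiableAt ℝ (extChartAt 𝓘(ℝ, E) x' ∘ (extChartAt 𝓘(ℝ, E) x).symm) y ∧
    coordDensity g.inner x y =
      |(fderiv ℝ (extChartAt 𝓘(ℝ, E) x' ∘ (extChartAt 𝓘(ℝ, E) x).symm) y).det| *
        coordDensity g.inner x' (extChartAt 𝓘(ℝ, E) x' ((extChartAt 𝓘(ℝ, E) x).symm y)) := by
  have : IsManifold 𝓘(ℝ, E) 1 F := IsManifold.of_le (n := ∞) (by simp)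
  set τ := extChartAt 𝓘(ℝ, E) x' ∘ (extChartAt 𝓘(ℝ, E) x).symm with hτ
  have hd : ∀ (x : F) (y : E), y ∈ coordDomain 𝓘(ℝ, E) x →
      MDifferentiableAt 𝓘(ℝ, E) 𝓘(ℝ, E) (extChartAt 𝓘(ℝ, E) x).symm y := by
    intro x y hy
    have h2 := mdifferentiableWithinAt_extChartAt_symm (I := 𝓘(ℝ, E)) (x := x) hy
    simpa only [modelWithCornersSelf_coe, Set.range_id, mdifferentiableWithinAt_univ] using h2
  have hd' : MDifferentiableAt 𝓘(ℝ, E) 𝓘(ℝ, E) (extChartAt 𝓘(ℝ, E) x')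
      ((extChartAt 𝓘(ℝ, E) x).symm y) :=
    mdifferentiableAt_extChartAt (by simpa using hy')
  have hτd : MDifferentiableAt 𝓘(ℝ, E) 𝓘(ℝ, E) τ y := hd'.comp y (hd x y hy)
  refine ⟨mdifferentiableAt_iff_differentiableAt.1 hτd, ?_⟩
  have ht : τ y ∈ coordDomain 𝓘(ℝ, E) x' := (extChartAt 𝓘(ℝ, E) x').map_source hy'
  have hpt : (extChartAt 𝓘(ℝ, E) x').symm (τ y) = (extChartAt 𝓘(ℝ, E) x).symm y :=
    (extChartAt 𝓘(ℝ, E) x').left_inv hy'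
  have hev : (extChartAt 𝓘(ℝ, E) x).symm =ᶠ[nhds y] (extChartAt 𝓘(ℝ, E) x').symm ∘ τ := by
    have h1 : (extChartAt 𝓘(ℝ, E) x).symm ⁻¹' (extChartAt 𝓘(ℝ, E) x').source ∈ nhds y :=
      (hd x y hy).continuousAt.preimage_mem_nhds ((isOpen_extChartAt_source x').mem_nhds hy')
    filter_upwards [h1] with z hz
    exact ((extChartAt 𝓘(ℝ, E) x').left_inv hz).symm
  have hframe : (coordFrame 𝓘(ℝ, E) x y : E →L[ℝ] E) =
      (coordFrame 𝓘(ℝ, E) x' (τ y) : E →L[ℝ] E).comp (fderiv ℝ τ y) := by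
    have h := mfderiv_comp y (hd x' _ ht) hτd
    rw [← hev.mfderiv_eq, mfderiv_eq_fderiv] at h
    exact h
  obtain ⟨A, hA⟩ := exists_coordFrame_equiv ht
  set B : E →L[ℝ] E →L[ℝ] ℝ := g.inner ((extChartAt 𝓘(ℝ, E) x).symm y) with hB
  set b := Module.finBasis ℝ E
  have e1 : coordGram g.inner x y =
      gram (pullbackBilin B (coordFrame 𝓘(ℝ, E) x' (τ y) : E →L[ℝ] E)) (fun a => fderiv ℝ τ y
        (b a)) := by
    ext i j
    have h : ∀ v : E, (coordFrame 𝓘(ℝ, E) x y : E →L[ℝ] E) v =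
        (coordFrame 𝓘(ℝ, E) x' (τ y) : E →L[ℝ] E) (fderiv ℝ τ y v) :=
      fun v => congr_arg (fun L : E →L[ℝ] E => L v) hframe
    exact congr_arg₂ (fun v w : E => B v w) (h (b i)) (h (b j))
  have e2 : coordGram g.inner x' (τ y) =
      gram (pullbackBilin B (coordFrame 𝓘(ℝ, E) x' (τ y) : E →L[ℝ] E)) b := by
    have : (g.inner ((extChartAt 𝓘(ℝ, E) x').symm (τ y)) : E →L[ℝ] E →L[ℝ] ℝ) = B := by
      rw [hB]
      let G : F → E →L[ℝ] E →L[ℝ] ℝ := fun q => g.inner q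
      exact congr_arg G hpt
    ext i j
    exact congr_arg (fun D : E →L[ℝ] E →L[ℝ] ℝ =>
      D ((coordFrame 𝓘(ℝ, E) x' (τ y) : E →L[ℝ] E) (b i))
        ((coordFrame 𝓘(ℝ, E) x' (τ y) : E →L[ℝ] E) (b j))) this
  have e3 : b.toMatrix (fun a => fderiv ℝ τ y (b a)) = LinearMap.toMatrix b b
      (fderiv ℝ τ y).toLinearMap := by
    ext i j
    rw [Module.Basis.toMatrix_apply, LinearMap.toMatrix_apply]
    rfl
  change Real.sqrt (coordGram g.inner x y).det = _ * Real.sqrt (coordGram g.inner x' (τ y)).det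
  rw [e1, e2, det_gram_eq_mul _ b, e3, LinearMap.det_toMatrix, Real.sqrt_mul
      (sq_nonneg _), Real.sqrt_sq_eq_abs]

variable [MeasurableSpace F] [BorelSpace F]

theorem aemeasurable_extChartAt_symm (x : F) (μ : Measure E) :
    AEMeasurable (extChartAt 𝓘(ℝ, E) x).symm (μ.restrict (coordDomain 𝓘(ℝ, E) x)) :=
  (continuousOn_extChartAt_symm x).aemeasurable (isOpen_coordDomain (E := E) F x).measurableSet

theorem localVolume_apply (g : BilinField 𝓘(ℝ, E) F) (x : F) {S : Set F} (hS : MeasurableSet S) :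
    localVolume g x S = ∫⁻ y in (extChartAt 𝓘(ℝ, E) x).symm ⁻¹' S ∩ coordDomain 𝓘(ℝ, E) x,
      ENNReal.ofReal (coordDensity g x y) ∂(modelMeasure E) := by
  unfold localVolume
  rw [Measure.map_apply_of_aemeasurable (aemeasurable_extChartAt_symm x _) hS,
    Measure.restrict_apply' (isOpen_coordDomain (E := E) F x).measurableSet, withDensity_apply']
  rfl

theorem localVolume_restrict (g : BilinField 𝓘(ℝ, E) F) (x : F) :
    (localVolume g x).restrict (extChartAt 𝓘(ℝ, E) x).source = localVolume g x := by
  refine Measure.ext fun S hS => ?_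
  rw [Measure.restrict_apply hS, localVolume_apply g x hS, localVolume_apply g x
    (hS.inter (isOpen_extChartAt_source x).measurableSet)]
  congr 2
  ext y
  simp only [Set.preimage_inter, Set.mem_inter_iff, Set.mem_preimage]
  exact ⟨fun h => ⟨h.1.1, h.2⟩, fun h => ⟨⟨h.1, (extChartAt 𝓘(ℝ, E) x).map_target h.2⟩, h.2⟩⟩

/-- Change of variables for the transition map. The image of `A` is only shown to lie in the
coordinate set of `S` at `x'`; an inequality is enough, since the roles of the charts can be
exchanged. -/
theorem localVolume_le (g : Bundle.ContMDiffRiemannianMetric 𝓘(ℝ, E) ∞ E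
      (fun x : F => TangentSpace 𝓘(ℝ, E) x)) (x x' : F) (S : Set F) (hS : MeasurableSet S)
    (_ : S ⊆ (extChartAt 𝓘(ℝ, E) x).source) (h' : S ⊆ (extChartAt 𝓘(ℝ, E) x').source) :
    localVolume g.inner x S ≤ localVolume g.inner x' S := by
  have hU : IsOpen (coordDomain 𝓘(ℝ, E) x) := isOpen_coordDomain (E := E) F x
  set A := (extChartAt 𝓘(ℝ, E) x).symm ⁻¹' S ∩ coordDomain 𝓘(ℝ, E) x with hA
  set τ := extChartAt 𝓘(ℝ, E) x' ∘ (extChartAt 𝓘(ℝ, E) x).symm with hτ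
  -- The inverse chart is continuous only on its domain, so measurability is obtained by restricting
  -- to it and taking the image under the inclusion.
  have hAm : MeasurableSet A := by
    have h1 : Measurable ((coordDomain 𝓘(ℝ, E) x).domRestrict (extChartAt 𝓘(ℝ, E) x).symm) :=
      (ContinuousOn.domRestrict (s := coordDomain 𝓘(ℝ, E) x)
        (continuousOn_extChartAt_symm x)).measurable
    have h2 := hU.measurableSet.subtype_image (h1 hS)
    convert h2 using 1
    ext y
    simp only [hA, Set.mem_inter_iff, Set.mem_preimage, Set.mem_image, Subtype.exists]
    exact ⟨fun hy => ⟨y, hy.2, hy.1, rfl⟩, fun ⟨z, hz, hz', e⟩ => e ▸ ⟨hz', hz⟩⟩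
  have hinj : Set.InjOn τ A := by
    intro y hy z hz hyz
    have h1 := (extChartAt 𝓘(ℝ, E) x').injOn (h' hy.1) (h' hz.1) hyz
    exact (extChartAt 𝓘(ℝ, E) x).symm.injOn hy.2 hz.2 h1
  have hch := fun y (hy : y ∈ A) => coordDensity_change g hy.2 (h' hy.1)
  have hJ := lintegral_image_eq_lintegral_abs_det_fderiv_mul (modelMeasure E) hAm
    (fun y hy => (hch y hy).1.hasFDerivAt.hasFDerivWithinAt) hinj
    (fun z => ENNReal.ofReal (coordDensity g.inner x' z))
  rw [localVolume_apply _ _ hS, localVolume_apply _ _ hS]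
  calc _ = ∫⁻ y in A, ENNReal.ofReal |(fderiv ℝ τ y).det| *
        ENNReal.ofReal (coordDensity g.inner x' (τ y)) ∂(modelMeasure E) := by
        refine setLIntegral_congr_fun hAm fun y hy => ?_
        rw [(hch y hy).2, ENNReal.ofReal_mul (abs_nonneg _)]
        rfl
    _ = _ := hJ.symm
    _ ≤ _ := by
        refine lintegral_mono_set ?_
        rintro _ ⟨y, hy, rfl⟩
        refine ⟨?_, (extChartAt 𝓘(ℝ, E) x').map_source (h' hy.1)⟩
        change (extChartAt 𝓘(ℝ, E) x').symm (extChartAt 𝓘(ℝ, E) x' _) ∈ S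
        rw [(extChartAt 𝓘(ℝ, E) x').left_inv (h' hy.1)]
        exact hy.1

variable (E F) in
theorem exists_countable_cover [SecondCountableTopology F] : ∃ s : Set F, s.Countable ∧
    ⋃ x ∈ s, (extChartAt 𝓘(ℝ, E) x).source = Set.univ :=
  TopologicalSpace.countable_cover_nhds fun x => extChartAt_source_mem_nhds x

theorem volumeMeasure_restrict [SecondCountableTopology F] (g : Bundle.ContMDiffRiemannianMetric
    𝓘(ℝ, E) ∞ E (fun x : F => TangentSpace 𝓘(ℝ, E) x)) (x : F) :
    (volumeMeasure g.inner).restrict (extChartAt 𝓘(ℝ, E) x).source = localVolume g.inner x := by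
  obtain ⟨s, hs, hcov⟩ := exists_countable_cover E F
  exact restrict_iSup_eq hs hcov (fun x => (isOpen_extChartAt_source x).measurableSet)
    (localVolume_restrict _) (localVolume_le g) x

end Volume

/-! ### Integrals and null sets in charts -/

section LocalVolume

variable {G : Type*} [NormedAddCommGroup G] [NormedSpace ℝ G] [FiniteDimensional ℝ G]
  [MeasurableSpace G] [BorelSpace G] {H : Type*} [TopologicalSpace H] {I : ModelWithCorners ℝ G H}
  [I.Boundaryless] {M : Type*} [TopologicalSpace M] [ChartedSpace H M]
  [MeasurableSpace M] [BorelSpace M]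

variable (I) in
theorem measurableSet_coordDomain (x : M) : MeasurableSet (coordDomain I x) :=
  (isOpen_extChartAt_target x).measurableSet

variable (I) in
theorem aemeasurable_symm_coordDomain (x : M) (μ : Measure G) :
    AEMeasurable (extChartAt I x).symm (μ.restrict (coordDomain I x)) :=
  (continuousOn_extChartAt_symm x).aemeasurable (measurableSet_coordDomain I x)

theorem localVolume_eq_map (g : BilinField I M) (x : M) :
    localVolume g x = (((modelMeasure G).restrict (coordDomain I x)).withDensity
      fun y => ENNReal.ofReal (coordDensity g x y)).map (extChartAt I x).symm := by
  unfold localVolume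
  rw [restrict_withDensity (measurableSet_coordDomain I x)]
  rfl

theorem lintegral_localVolume (g : BilinField I M) (x : M)
    (hd : AEMeasurable (coordDensity g x) ((modelMeasure G).restrict (coordDomain I x)))
    {h : M → ℝ≥0∞} (hm : Measurable h) :
    ∫⁻ q, h q ∂(localVolume g x) = ∫⁻ y in coordDomain I x,
      ENNReal.ofReal (coordDensity g x y) * h ((extChartAt I x).symm y) ∂(modelMeasure G) := by
  have h1 := aemeasurable_symm_coordDomain I x (modelMeasure G)
  rw [localVolume_eq_map, lintegral_map' hm.aemeasurable
    (h1.mono_ac (withDensity_absolutelyContinuous _ _))]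
  exact lintegral_withDensity_eq_lintegral_mul₀ hd.ennreal_ofReal (hm.comp_aemeasurable h1)

/-- `P` need not be measurable, so the exceptional set in coordinates is first replaced by a
measurable null hull, whose preimage in `M` is measurable. -/
theorem ae_localVolume (g : BilinField I M) (x : M) {P : M → Prop}
    (h : ∀ᵐ y ∂(modelMeasure G), y ∈ coordDomain I x → P ((extChartAt I x).symm y)) :
    ∀ᵐ q ∂(localVolume g x), P q := by
  set N := toMeasurable (modelMeasure G)
    {y | ¬ (y ∈ coordDomain I x → P ((extChartAt I x).symm y))} with hN
  have hN0 : modelMeasure G N = 0 := by rw [hN, measure_toMeasurable]; exact h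
  have h1 := aemeasurable_symm_coordDomain I x (modelMeasure G)
  have hm : MeasurableSet ((extChartAt I x).source ∩ (extChartAt I x) ⁻¹' N) := by
    have h2 : Measurable ((extChartAt I x).source.domRestrict (extChartAt I x)) :=
      (continuousOn_extChartAt x).domRestrict.measurable
    have h3 := (isOpen_extChartAt_source (I := I) x).measurableSet.subtype_image
      (h2 (measurableSet_toMeasurable _ _ : MeasurableSet N))
    convert h3 using 1
    ext y
    simp only [Set.mem_inter_iff, Set.mem_preimage, Set.mem_image, Subtype.exists]
    exact ⟨fun hy => ⟨y, hy.1, hy.2, rfl⟩, fun ⟨z, hz, hz', e⟩ => e ▸ ⟨hz, hz'⟩⟩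
  have hm' : MeasurableSet ((extChartAt I x).source \ ((extChartAt I x) ⁻¹' N)) := by
    rw [← Set.sdiff_self_inter]
    exact (isOpen_extChartAt_source (I := I) x).measurableSet.diff hm
  have key : ∀ᵐ q ∂(localVolume g x), q ∈ (extChartAt I x).source \ ((extChartAt I x) ⁻¹' N) := by
    rw [localVolume_eq_map]
    refine (ae_map_iff (h1.mono_ac (withDensity_absolutelyContinuous _ _)) hm').2 ?_
    refine (withDensity_absolutelyContinuous _ _).ae_le ?_
    refine (ae_restrict_iff' (measurableSet_coordDomain I x)).2 ?_
    filter_upwards [measure_eq_zero_iff_ae_notMem.1 hN0] with y hy hyT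
    refine ⟨(extChartAt I x).map_target hyT, ?_⟩
    rwa [Set.mem_preimage, (extChartAt I x).right_inv hyT]
  filter_upwards [key] with q hq
  by_contra hP
  refine hq.2 (subset_toMeasurable _ _ ?_)
  simp only [Set.mem_ofPred_eq, Classical.not_imp]
  refine ⟨(extChartAt I x).map_source hq.1, ?_⟩
  rwa [(extChartAt I x).left_inv hq.1]

/-- Positivity of the density makes Lebesgue measure absolutely continuous with respect to the
volume in a chart. -/
theorem ae_coordDomain_of_ae_volumeMeasure (g : BilinField I M) (x : M)
    (hd : AEMeasurable (coordDensity g x) ((modelMeasure G).restrict (coordDomain I x)))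
    (hpos : ∀ y ∈ coordDomain I x, 0 < coordDensity g x y) {P : M → Prop}
    (h : ∀ᵐ q ∂(volumeMeasure g), P q) :
    ∀ᵐ y ∂(modelMeasure G), y ∈ coordDomain I x → P ((extChartAt I x).symm y) := by
  have h0 : ∀ᵐ q ∂(localVolume g x), P q :=
    (Measure.absolutelyContinuous_of_le (le_iSup (localVolume g) x)).ae_le h
  have h1 := aemeasurable_symm_coordDomain I x (modelMeasure G)
  rw [localVolume_eq_map] at h0
  have h2 := ae_of_ae_map (h1.mono_ac (withDensity_absolutelyContinuous _ _)) h0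
  rw [ae_withDensity_iff' hd.ennreal_ofReal, ae_restrict_iff' (measurableSet_coordDomain I x)] at h2
  filter_upwards [h2] with y hy hyT
  exact hy hyT (by simpa using hpos y hyT)

end LocalVolume

/-! ### The volume of the cone as a product measure -/

section Cone

variable {E : Type*} [NormedAddCommGroup E] [NormedSpace ℝ E] [FiniteDimensional ℝ E]
  [MeasurableSpace E] [BorelSpace E] {F : Type*} [TopologicalSpace F] [ChartedSpace E F]
  [IsManifold 𝓘(ℝ, E) ∞ F] [MeasurableSpace F] [BorelSpace F] [SecondCountableTopology F]

theorem aemeasurable_coordDensity (g : Bundle.ContMDiffRiemannianMetric 𝓘(ℝ, E) ∞ E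
      (fun x : F => TangentSpace 𝓘(ℝ, E) x)) (x : F) :
    AEMeasurable (coordDensity g.inner x) ((modelMeasure E).restrict (coordDomain 𝓘(ℝ, E) x)) :=
  (continuousOn_coordDensity g x).aemeasurable (measurableSet_coordDomain 𝓘(ℝ, E) x)

/-- Fubini on the cone requires this. The volume is dominated by the countable sum of local volumes
over a countable atlas. -/
theorem sFinite_volumeMeasure (g : Bundle.ContMDiffRiemannianMetric 𝓘(ℝ, E) ∞ E
      (fun x : F => TangentSpace 𝓘(ℝ, E) x)) : SFinite (volumeMeasure g.inner) := by
  obtain ⟨s, hs, hcov⟩ := exists_countable_cover E F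
  have := hs.to_subtype
  have h1 : ∀ x : F, SFinite (localVolume g.inner x) := fun x => by
    rw [localVolume_eq_map]
    infer_instance
  have h2 : volumeMeasure g.inner ≤ Measure.sum fun x : s => localVolume g.inner x.1 := by
    have h3 : ⋃ x : s, (extChartAt 𝓘(ℝ, E) x.1).source = Set.univ := by
      rw [← hcov, Set.biUnion_eq_iUnion]
    have h4 := Measure.restrict_iUnion_le (μ := volumeMeasure g.inner)
      (s := fun x : s => (extChartAt 𝓘(ℝ, E) x.1).source)
    simp only [h3, Measure.restrict_univ, volumeMeasure_restrict] at h4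
    exact h4
  exact sFinite_of_absolutelyContinuous (Measure.absolutelyContinuous_of_le h2)

/-- The measure `s^a ds` on `(0, 1)`. -/
def radialMeasure (a : ℝ) : Measure interval01 :=
  ((volume.restrict (Set.Ioo (0 : ℝ) 1)).withDensity fun s => ENNReal.ofReal (s ^ a)).map clip

instance (a : ℝ) : SFinite (radialMeasure a) := by
  unfold radialMeasure
  infer_instance

theorem aemeasurable_clip : AEMeasurable clip (volume.restrict (Set.Ioo (0 : ℝ) 1)) := by
  have h := aemeasurable_symm_coordDomain 𝓘(ℝ, ℝ) half volume
  rw [coordDomain, extChartAt_interval01_target] at h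
  exact h

theorem lintegral_radialMeasure (a : ℝ) {h : interval01 → ℝ≥0∞} (hm : Measurable h) :
    ∫⁻ r, h r ∂(radialMeasure a) =
      ∫⁻ s in Set.Ioo (0 : ℝ) 1, ENNReal.ofReal (s ^ a) * h (clip s) := by
  unfold radialMeasure
  rw [lintegral_map' hm.aemeasurable
    (aemeasurable_clip.mono_ac (withDensity_absolutelyContinuous _ _))]
  exact lintegral_withDensity_eq_lintegral_mul₀ (by fun_prop)
    (hm.comp_aemeasurable aemeasurable_clip)

variable (E) in
-- With `ρ = r^{2c}` the square root of `ρ^f` is `r^{cf}`; the constant is that of the change of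
-- basis.
theorem exists_coordDensity_coneMetric : ∃ C : ℝ, 0 < C ∧ ∀ (c : ℝ) (g : BilinField 𝓘(ℝ, E) F)
    (r : interval01) (x : F), ∀ p ∈ cyl (coordDomain 𝓘(ℝ, E) x),
    coordDensity (coneMetric c g) (r, x) p =
      C * (p.1 ^ (c * Module.finrank ℝ E) * coordDensity g x p.2) := by
  obtain ⟨C, hC, h⟩ := exists_det_gram_warpedForm E
  refine ⟨C, hC, fun c g r x p hp => ?_⟩
  set B : E →L[ℝ] E →L[ℝ] ℝ := pullbackBilin (g ((extChartAt 𝓘(ℝ, E) x).symm p.2))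
    (coordFrame 𝓘(ℝ, E) x p.2) with hB
  have h0 := hp.1.1
  have e1 : coordGram (coneMetric c g) (r, x) p =
      gram (warpedForm (p.1 ^ (2 * c)) B) (Module.finBasis ℝ (ℝ × E)) := by
    ext i j
    simp only [coordGram, Matrix.of_apply]
    rw [coordFrame_prod r hp, extChartAt_prod_symm, coneMetric_eq]
    simp only [coe_clip hp.1]
    rfl
  have e2 : (coordGram g x p.2) = gram B (Module.finBasis ℝ E) := rfl
  unfold coordDensity
  rw [e1, h, e2, Real.sqrt_mul (sq_nonneg _), Real.sqrt_sq hC.le,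
    Real.sqrt_mul (by positivity)]
  congr 2
  rw [← Real.rpow_natCast, ← Real.rpow_mul h0.le, Real.sqrt_eq_rpow, ← Real.rpow_mul h0.le]
  congr 1
  ring

theorem coordDensity_coneMetric_pos (c : ℝ) (g : Bundle.ContMDiffRiemannianMetric 𝓘(ℝ, E) ∞ E
      (fun x : F => TangentSpace 𝓘(ℝ, E) x)) (q : interval01 × F) :
    ∀ p ∈ coordDomain (𝓘(ℝ, ℝ).prod 𝓘(ℝ, E)) q, 0 < coordDensity (coneMetric c g.inner) q p := by
  obtain ⟨C, hC, h⟩ := exists_coordDensity_coneMetric (F := F) E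
  obtain ⟨r, x⟩ := q
  intro p hp
  rw [coordDomain_prod] at hp
  rw [h c g.inner r x p hp]
  exact mul_pos hC (mul_pos (Real.rpow_pos_of_pos hp.1.1 _) (coordDensity_pos g hp.2))

theorem aemeasurable_coordDensity_coneMetric (c : ℝ) (g : Bundle.ContMDiffRiemannianMetric 𝓘(ℝ, E)
    ∞ E
      (fun x : F => TangentSpace 𝓘(ℝ, E) x)) (q : interval01 × F) :
    AEMeasurable (coordDensity (coneMetric c g.inner) q)
      ((modelMeasure (ℝ × E)).restrict (coordDomain (𝓘(ℝ, ℝ).prod 𝓘(ℝ, E)) q)) := by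
  obtain ⟨C, hC, h⟩ := exists_coordDensity_coneMetric (F := F) E
  obtain ⟨r, x⟩ := q
  have hU : IsOpen (cyl (coordDomain 𝓘(ℝ, E) x)) := isOpen_cyl (isOpen_coordDomain (E := E) F x)
  rw [coordDomain_prod]
  refine ContinuousOn.aemeasurable (ContinuousOn.congr ?_ (h c g.inner r x)) hU.measurableSet
  refine continuousOn_const.mul (ContinuousOn.mul (continuousOn_fst.rpow_const
    fun p hp => Or.inl hp.1.1.ne') ((continuousOn_coordDensity g x).comp continuousOn_snd
      fun p hp => hp.2))

/-- The product measure has the right restriction over every chart of `F`, because the density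
factors; the gluing lemma then identifies it with the volume. `K` collects the constants of the
measure and of the density. -/
theorem exists_volumeMeasure_coneMetric (c : ℝ) (g : Bundle.ContMDiffRiemannianMetric 𝓘(ℝ, E) ∞ E
      (fun x : F => TangentSpace 𝓘(ℝ, E) x)) : ∃ K : ℝ≥0∞, K ≠ 0 ∧ K ≠ ⊤ ∧
    (∀ q : interval01 × F, (volumeMeasure (coneMetric c g.inner)).restrict
      (Set.univ ×ˢ (extChartAt 𝓘(ℝ, E) q.2).source) = localVolume (coneMetric c g.inner) q) ∧
    volumeMeasure (coneMetric c g.inner) =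
      K • (radialMeasure (c * Module.finrank ℝ E)).prod (volumeMeasure g.inner) := by
  obtain ⟨C, hC, hD⟩ := exists_coordDensity_coneMetric (F := F) E
  obtain ⟨κ, hκ0, hκ1, hκ⟩ := exists_modelMeasure_prod E
  have hsf := sFinite_volumeMeasure g
  refine ⟨κ * ENNReal.ofReal C, by simp [hκ0, hC], ENNReal.mul_ne_top hκ1 (by simp), ?_⟩
  set ν := (κ * ENNReal.ofReal C) •
    (radialMeasure (c * Module.finrank ℝ E)).prod (volumeMeasure g.inner) with hν
  have key : ∀ q : interval01 × F,
      ν.restrict (Set.univ ×ˢ (extChartAt 𝓘(ℝ, E) q.2).source) =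
        localVolume (coneMetric c g.inner) q := by
    rintro ⟨r, x⟩
    have hsl : SFinite (localVolume g.inner x) := by
      rw [localVolume_eq_map]
      infer_instance
    rw [hν, Measure.restrict_smul, ← Measure.prod_restrict, Measure.restrict_univ,
      volumeMeasure_restrict]
    refine Measure.ext_of_lintegral _ fun h hm => ?_
    rw [lintegral_localVolume _ _ (aemeasurable_coordDensity_coneMetric c g (r, x)) hm,
      coordDomain_prod, hκ, Measure.restrict_smul, lintegral_smul_measure, lintegral_smul_measure,
      lintegral_prod _ hm.aemeasurable, lintegral_radialMeasure _ hm.lintegral_prod_right',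
      smul_eq_mul, smul_eq_mul, mul_assoc]
    congr 1
    have e1 : ∫⁻ p in cyl (coordDomain 𝓘(ℝ, E) x),
        ENNReal.ofReal (coordDensity (coneMetric c g.inner) (r, x) p) *
          h ((extChartAt (𝓘(ℝ, ℝ).prod 𝓘(ℝ, E)) (r, x)).symm p)
          ∂((volume : Measure ℝ).prod (modelMeasure E)) =
        ∫⁻ p in cyl (coordDomain 𝓘(ℝ, E) x), ENNReal.ofReal C *
          (ENNReal.ofReal (p.1 ^ (c * Module.finrank ℝ E)) *
          (ENNReal.ofReal (coordDensity g.inner x p.2) *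
            h (clip p.1, (extChartAt 𝓘(ℝ, E) x).symm p.2)))
          ∂((volume : Measure ℝ).prod (modelMeasure E)) := by
      refine setLIntegral_congr_fun (isOpen_cyl (isOpen_coordDomain (E := E) F x)).measurableSet
        fun p hp => ?_
      have := hp.1.1
      rw [hD c g.inner r x p hp, extChartAt_prod_symm, ENNReal.ofReal_mul hC.le,
        ENNReal.ofReal_mul (by positivity), mul_assoc, mul_assoc]
    have hcl : AEMeasurable (fun p : ℝ × E => (clip p.1, (extChartAt 𝓘(ℝ, E) x).symm p.2))
        ((volume.restrict (Set.Ioo (0 : ℝ) 1)).prod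
          ((modelMeasure E).restrict (coordDomain 𝓘(ℝ, E) x))) :=
      (aemeasurable_clip.comp_quasiMeasurePreserving Measure.quasiMeasurePreserving_fst).prodMk
        ((aemeasurable_symm_coordDomain 𝓘(ℝ, E) x _).comp_quasiMeasurePreserving
          Measure.quasiMeasurePreserving_snd)
    have hdm : AEMeasurable (fun p : ℝ × E => coordDensity g.inner x p.2)
        ((volume.restrict (Set.Ioo (0 : ℝ) 1)).prod
          ((modelMeasure E).restrict (coordDomain 𝓘(ℝ, E) x))) :=
      (aemeasurable_coordDensity g x).comp_quasiMeasurePreserving Measure.quasiMeasurePreserving_snd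
    have hs : AEMeasurable (fun p : ℝ × E => ENNReal.ofReal (p.1 ^ (c * Module.finrank ℝ E)))
        ((volume.restrict (Set.Ioo (0 : ℝ) 1)).prod
          ((modelMeasure E).restrict (coordDomain 𝓘(ℝ, E) x))) := by fun_prop
    have hin : AEMeasurable (fun p : ℝ × E => ENNReal.ofReal (coordDensity g.inner x p.2) *
            h (clip p.1, (extChartAt 𝓘(ℝ, E) x).symm p.2))
        ((volume.restrict (Set.Ioo (0 : ℝ) 1)).prod
          ((modelMeasure E).restrict (coordDomain 𝓘(ℝ, E) x))) :=
      hdm.ennreal_ofReal.mul (hm.comp_aemeasurable hcl)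
    rw [e1, cyl, ← Measure.prod_restrict, lintegral_const_mul' _ _ ENNReal.ofReal_ne_top]
    congr 1
    refine Eq.trans ?_ (lintegral_prod _ (hs.mul hin)).symm
    refine setLIntegral_congr_fun measurableSet_Ioo fun s _ => ?_
    simp only [Pi.mul_apply]
    rw [lintegral_const_mul' _ _ ENNReal.ofReal_ne_top]
    rw [lintegral_localVolume (h := fun y => h (clip s, y)) _ _ (aemeasurable_coordDensity g x)
        (hm.comp (measurable_const.prodMk measurable_id))]
  obtain ⟨s, hs, hcov⟩ := exists_countable_cover E F
  have hν' : volumeMeasure (coneMetric c g.inner) = ν := by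
    -- One chart covers the whole interval, so a countable atlas of `F` gives one of the cone.
    refine iSup_eq_of_restrict_eq (s := {half} ×ˢ s) ((Set.countable_singleton _).prod hs)
      (U := fun q : interval01 × F => Set.univ ×ˢ (extChartAt 𝓘(ℝ, E) q.2).source) ?_
      (fun q => MeasurableSet.univ.prod (isOpen_extChartAt_source q.2).measurableSet) key
    refine Set.eq_univ_of_forall fun q => ?_
    obtain ⟨x, hx, hq⟩ := Set.mem_iUnion₂.1 (hcov.symm ▸ Set.mem_univ q.2)
    exact Set.mem_iUnion₂.2 ⟨(half, x), ⟨rfl, hx⟩, trivial, hq⟩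
  exact ⟨fun q => hν' ▸ key q, hν'⟩

end Cone

/-! ### `L²` bounds for pullback, average and homotopy operator -/

section Estimates

variable {E : Type*} [NormedAddCommGroup E] [NormedSpace ℝ E] [FiniteDimensional ℝ E]
  [MeasurableSpace E] [BorelSpace E] {F : Type*} [TopologicalSpace F] [ChartedSpace E F]
  [IsManifold 𝓘(ℝ, E) ∞ F] [MeasurableSpace F] [BorelSpace F] [SecondCountableTopology F]
  {c : ℝ} {g : Bundle.ContMDiffRiemannianMetric 𝓘(ℝ, E) ∞ E
      (fun x : F => TangentSpace 𝓘(ℝ, E) x)}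

/-- `|α|²` has an integrable majorant. -/
def HasMajorant {G : Type*} [NormedAddCommGroup G] [NormedSpace ℝ G] [FiniteDimensional ℝ G]
    [MeasurableSpace G] [BorelSpace G] {H : Type*} [TopologicalSpace H]
    {I : ModelWithCorners ℝ G H} {M : Type*} [TopologicalSpace M] [ChartedSpace H M]
    [MeasurableSpace M] (g : BilinField I M) {k : ℕ} (α : Form I M k) : Prop :=
  ∃ h : M → ℝ≥0∞, Measurable h ∧ ∫⁻ x, h x ∂(volumeMeasure g) < ⊤ ∧
    ∀ x, formNormSq (g x) (α x) ≤ h x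

variable (c g) in
theorem exists_lintegral_coneMetric : ∃ K : ℝ≥0∞, K ≠ 0 ∧ K ≠ ⊤ ∧
    ∀ h : interval01 × F → ℝ≥0∞, Measurable h →
      ∫⁻ q, h q ∂(volumeMeasure (coneMetric c g.inner)) =
        K * ∫⁻ x, ∫⁻ r, h (r, x) ∂(radialMeasure (c * Module.finrank ℝ E))
          ∂(volumeMeasure g.inner) := by
  have := sFinite_volumeMeasure g
  obtain ⟨K, h0, h1, -, h2⟩ := exists_volumeMeasure_coneMetric c g
  refine ⟨K, h0, h1, fun h hm => ?_⟩
  rw [h2, lintegral_smul_measure, smul_eq_mul, lintegral_prod_symm _ hm.aemeasurable]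

theorem slice_sq_le_of_unit {ρ : ℝ} (hρ : 0 < ρ) {B : E →L[ℝ] E →L[ℝ] ℝ} (hB : IsInnerForm B)
    {k : ℕ} (η : (ℝ × E) [⋀^Fin k]→L[ℝ] ℝ) {v : Fin k → E} (hv : ∀ j, B (v j) (v j) = 1) :
    ENNReal.ofReal (sliceForm η v ^ 2) ≤
      (k ! : ℝ≥0∞) * (ENNReal.ofReal (ρ ^ k) * formNormSq (warpedForm ρ B) η) := by
  simpa [hv] using slice_sq_le hρ hB η v

theorem radial_sq_le_of_unit {ρ : ℝ} (hρ : 0 < ρ) {B : E →L[ℝ] E →L[ℝ] ℝ} (hB : IsInnerForm B)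
    {k : ℕ} (η : (ℝ × E) [⋀^Fin (k + 1)]→L[ℝ] ℝ) {v : Fin k → E} (hv : ∀ j, B (v j) (v j) = 1) :
    ENNReal.ofReal (radialForm η v ^ 2) ≤
      ((k + 1)! : ℝ≥0∞) * (ENNReal.ofReal (ρ ^ k) * formNormSq (warpedForm ρ B) η) := by
  simpa only [hv, Finset.prod_const_one, ENNReal.ofReal_one, mul_one] using radial_sq_le hρ hB η v

/-- The integral of a majorant over the ray through `x`. -/
def rayIntegral (a : ℝ) (h : interval01 × F → ℝ≥0∞) (x : F) : ℝ≥0∞ :=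
  ∫⁻ r, h (r, x) ∂(radialMeasure a)

theorem measurable_rayIntegral (a : ℝ) {h : interval01 × F → ℝ≥0∞} (hm : Measurable h) :
    Measurable (rayIntegral a h) := hm.lintegral_prod_left'

theorem lintegral_rayIntegral_lt_top {h : interval01 × F → ℝ≥0∞} (hm : Measurable h)
    (hi : ∫⁻ q, h q ∂(volumeMeasure (coneMetric c g.inner)) < ⊤) :
    ∫⁻ x, rayIntegral (c * Module.finrank ℝ E) h x ∂(volumeMeasure g.inner) < ⊤ := by
  obtain ⟨K, h0, h1, hK⟩ := exists_lintegral_coneMetric c g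
  rw [hK h hm] at hi
  by_contra hc
  rw [not_lt, top_le_iff] at hc
  unfold rayIntegral at hc
  rw [hc, ENNReal.mul_top h0] at hi
  exact lt_irrefl _ hi

/-- Bookkeeping of the weight: `s^{cn}` comes from the volume and `s^{2ck}` from the scaling of `k`
tangent vectors. -/
theorem rpow_mul_rpow_pow {s : ℝ} (hs : 0 < s) (c n : ℝ) (k : ℕ) :
    s ^ (c * (n - 2 * k)) * (s ^ (2 * c)) ^ k = s ^ (c * n) := by
  rw [← Real.rpow_natCast, ← Real.rpow_mul hs.le, ← Real.rpow_add hs]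
  congr 1
  ring

theorem rpow_mul_inv_rpow_pow {s : ℝ} (hs : 0 < s) (c n : ℝ) (k : ℕ) :
    s ^ (c * n) * ((s ^ (2 * c)) ^ k)⁻¹ = s ^ (c * (n - 2 * k)) := by
  rw [← rpow_mul_rpow_pow hs c n k]
  field_simp

/-- The majorant separates the variables, so by Fubini its integral is a constant times the weighted
radial integral times an integral over `F`. -/
theorem hasMajorant_of_le {k : ℕ} {α : Form (𝓘(ℝ, ℝ).prod 𝓘(ℝ, E)) (interval01 × F) k}
    {C : ℝ≥0∞} (hC : C ≠ ⊤) {N : ℝ → ℝ≥0∞} (hN : Measurable N) {h : F → ℝ≥0∞} (hm : Measurable h)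
    (hi : ∫⁻ x, h x ∂(volumeMeasure g.inner) < ⊤)
    (hNi : ∫⁻ s in Set.Ioo (0 : ℝ) 1,
      ENNReal.ofReal (s ^ (c * (Module.finrank ℝ E - 2 * k))) * N s < ⊤)
    (hα : ∀ q : interval01 × F, formNormSq (coneMetric c g.inner q) (α q) ≤
      C * (ENNReal.ofReal ((((q.1 : ℝ) ^ (2 * c)) ^ k)⁻¹) * (N q.1 * h q.2))) :
    HasMajorant (coneMetric c g.inner) α := by
  obtain ⟨K, h0, h1, hK⟩ := exists_lintegral_coneMetric c g
  have hm1 : Measurable fun q : interval01 × F =>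
      C * (ENNReal.ofReal ((((q.1 : ℝ) ^ (2 * c)) ^ k)⁻¹) * (N q.1 * h q.2)) := by
    have : Measurable fun q : interval01 × F => (q.1 : ℝ) :=
      measurable_subtype_coe.comp measurable_fst
    exact (((((this.pow_const _).pow_const _).inv.ennreal_ofReal).mul
      ((hN.comp this).mul (hm.comp measurable_snd)))).const_mul _
  refine ⟨_, hm1, ?_, hα⟩
  rw [hK _ hm1]
  have e : ∀ x, ∫⁻ r, C * (ENNReal.ofReal ((((r : interval01) : ℝ) ^ (2 * c)) ^ k)⁻¹ *
      (N r * h x)) ∂(radialMeasure (c * Module.finrank ℝ E)) =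
      C * ((∫⁻ s in Set.Ioo (0 : ℝ) 1,
        ENNReal.ofReal (s ^ (c * (Module.finrank ℝ E - 2 * k))) * N s) * h x) := by
    intro x
    refine (lintegral_radialMeasure _ (hm1.comp (measurable_id.prodMk measurable_const))).trans ?_
    rw [← lintegral_mul_const _ (by fun_prop), ← lintegral_const_mul _ (by fun_prop)]
    refine setLIntegral_congr_fun measurableSet_Ioo fun s hs => ?_
    simp only [Function.comp, id]
    rw [coe_clip hs, ← rpow_mul_inv_rpow_pow hs.1, ENNReal.ofReal_mul (Real.rpow_nonneg hs.1.le _)]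
    ring
  simp only [e]
  rw [lintegral_const_mul _ (by fun_prop), lintegral_const_mul _ hm]
  exact ENNReal.mul_lt_top h1.lt_top (ENNReal.mul_lt_top hC.lt_top (ENNReal.mul_lt_top hNi hi))

/-- The radial integral is `∫_0^1 r^{c(f-2k)} dr`, which converges exactly when the exponent exceeds
`-1`. -/
theorem hasMajorant_pull {k : ℕ} {ξ : Form 𝓘(ℝ, E) F k} (hξ : HasMajorant g.inner ξ)
    (hw : -1 < c * (Module.finrank ℝ E - 2 * k)) :
    HasMajorant (coneMetric c g.inner) (pull ξ) := by
  obtain ⟨h, hm, hi, hle⟩ := hξ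
  refine hasMajorant_of_le (C := (Module.finrank ℝ (ℝ × E) : ℝ≥0∞) ^ k * (k ! : ℝ≥0∞))
    (by finiteness) (N := fun _ => 1)
    measurable_const hm hi ?_ fun q => ?_
  · simp only [mul_one]
    exact ((intervalIntegral.integrableOn_Ioo_rpow_iff one_pos).2 hw).lintegral_lt_top
  · rw [coneMetric_eq]
    have h0 : (0 : ℝ) < q.1 := q.1.2.1
    refine (formNormSq_cylForm_le (Real.rpow_pos_of_pos h0 _) (isInnerForm_inner g q.2) _).trans ?_
    rw [one_mul]
    gcongr
    exact hle q.2

/-- Cauchy–Schwarz along the ray with the weight `s^{c(f-2k)}`, chosen so that its product with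
`(s^{2c})^k` is the volume weight `s^{cf}`. -/
theorem formNormSq_intForm_ray_le {k : ℕ} {κ : ℝ → ℝ} (hκ : Measurable κ)
    (B : E →L[ℝ] E →L[ℝ] ℝ) (b : ℝ → E [⋀^Fin k]→L[ℝ] ℝ) {h : interval01 × F → ℝ≥0∞}
    (hm : Measurable h) (x : F) {C : ℝ≥0∞}
    (hb : ∀ s ∈ Set.Ioo (0 : ℝ) 1, ∀ v : Fin k → E, (∀ j, B (v j) (v j) = 1) →
      ENNReal.ofReal (b s v ^ 2) ≤ C * (ENNReal.ofReal ((s ^ (2 * c)) ^ k) * h (clip s, x))) :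
    formNormSq B (intForm (volume.restrict (Set.Ioo (0 : ℝ) 1)) fun s => κ s • b s) ≤
      (Module.finrank ℝ E : ℝ≥0∞) ^ k * ((∫⁻ s in Set.Ioo (0 : ℝ) 1,
        ENNReal.ofReal (κ s ^ 2 * (s ^ (c * (Module.finrank ℝ E - 2 * k)))⁻¹)) *
        (C * rayIntegral (c * Module.finrank ℝ E) h x)) := by
  have hcl : AEMeasurable (fun s => h (clip s, x)) (volume.restrict (Set.Ioo (0 : ℝ) 1)) :=
    (hm.comp (measurable_id.prodMk measurable_const)).comp_aemeasurable aemeasurable_clip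
  have h1 : ∀ᵐ s ∂(volume.restrict (Set.Ioo (0 : ℝ) 1)),
      0 < s ^ (c * (Module.finrank ℝ E - 2 * k)) := by
    filter_upwards [ae_restrict_mem measurableSet_Ioo] with s hs
    exact Real.rpow_pos_of_pos hs.1 _
  have h2 : AEMeasurable (fun s => C * (ENNReal.ofReal ((s ^ (2 * c)) ^ k) * h (clip s, x)))
      (volume.restrict (Set.Ioo (0 : ℝ) 1)) := by
    have h3 : AEMeasurable (fun s : ℝ => ENNReal.ofReal ((s ^ (2 * c)) ^ k))
      (volume.restrict (Set.Ioo (0 : ℝ) 1)) := by fun_prop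
    exact (h3.mul hcl).const_mul C
  have h4 := formNormSq_intForm_le B κ hκ (fun s => s ^ (c * (Module.finrank ℝ E - 2 * k)))
    (by fun_prop) h1 b _ h2
    (by filter_upwards [ae_restrict_mem measurableSet_Ioo] with s hs using hb s hs)
  refine h4.trans (le_of_eq ?_)
  · congr 2
    unfold rayIntegral
    have h5 : AEMeasurable (fun s : ℝ => ENNReal.ofReal (s ^ (c * Module.finrank ℝ E)))
      (volume.restrict (Set.Ioo (0 : ℝ) 1)) := by fun_prop
    rw [lintegral_radialMeasure (h := fun r => h (r, x)) _
      (hm.comp (measurable_id.prodMk measurable_const))]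
    refine Eq.trans ?_ (lintegral_const_mul'' _ (h5.mul hcl))
    refine setLIntegral_congr_fun measurableSet_Ioo fun s hs => ?_
    rw [← rpow_mul_rpow_pow hs.1 c (Module.finrank ℝ E) k, ENNReal.ofReal_mul
        (Real.rpow_nonneg hs.1.le _)]
    ring

theorem formNormSq_coneMetric_clip {k : ℕ}
    (η : Form (𝓘(ℝ, ℝ).prod 𝓘(ℝ, E)) (interval01 × F) k) {h : interval01 × F → ℝ≥0∞}
    (hle : ∀ q, formNormSq (coneMetric c g.inner q) (η q) ≤ h q) {s : ℝ}
    (hs : s ∈ Set.Ioo (0 : ℝ) 1) (x : F) :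
    formNormSq (warpedForm (E := E) (s ^ (2 * c)) (g.inner x)) (prodValue η (clip s) x) ≤
      h (clip s, x) := by
  have := hle (clip s, x)
  rw [coneMetric_eq] at this
  simp only [coe_clip hs] at this
  exact this

/-- On the compact support of `χ` the weight is bounded above and away from zero, so no condition on
the degree arises. -/
theorem hasMajorant_avgForm {k : ℕ} {η : Form (𝓘(ℝ, ℝ).prod 𝓘(ℝ, E)) (interval01 × F) k}
    (hη : HasMajorant (coneMetric c g.inner) η) {χ : ℝ → ℝ} (hχ : IsTest (Set.Ioo (0 : ℝ) 1) χ) :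
    HasMajorant g.inner (avgForm χ η) := by
  obtain ⟨h, hm, hi, hle⟩ := hη
  have hN : ∫⁻ s in Set.Ioo (0 : ℝ) 1,
        ENNReal.ofReal (χ s ^ 2 * (s ^ (c * (Module.finrank ℝ E - 2 * k)))⁻¹) < ⊤ := by
    have h1 : Integrable (fun s => χ s * (χ s * (s ^ (c * (Module.finrank ℝ E - 2 * k)))⁻¹)) := by
      refine hχ.integrable_mul (ContinuousOn.locallyIntegrableOn ?_ measurableSet_Ioo)
      exact hχ.smooth.continuous.continuousOn.mul ((continuousOn_id.rpow_const
        fun s hs => Or.inl hs.1.ne').inv₀ fun s hs => (Real.rpow_pos_of_pos hs.1 _).ne')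
    have h2 := h1.integrableOn (s := Set.Ioo 0 1)
    refine (setLIntegral_congr_fun measurableSet_Ioo fun s _ => ?_).trans_lt h2.lintegral_lt_top
    congr 1
    ring
  refine ⟨fun x => (Module.finrank ℝ E : ℝ≥0∞) ^ k * ((∫⁻ s in Set.Ioo (0 : ℝ) 1,
        ENNReal.ofReal (χ s ^ 2 * (s ^ (c * (Module.finrank ℝ E - 2 * k)))⁻¹)) *
        ((k ! : ℝ≥0∞) * rayIntegral (c * Module.finrank ℝ E) h x)), ?_, ?_,
    fun x => formNormSq_intForm_ray_le (E := E) hχ.smooth.continuous.measurable (g.inner x)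
      (fun s => sliceForm (prodValue η (clip s) x)) hm x fun s hs v hv => ?_⟩
  · exact ((measurable_rayIntegral _ hm).const_mul _ |>.const_mul _).const_mul _
  · have hr := measurable_rayIntegral (F := F) (c * Module.finrank ℝ E) hm
    rw [lintegral_const_mul _ (by fun_prop), lintegral_const_mul _ (by fun_prop),
      lintegral_const_mul _ hr]
    have h1 := lintegral_rayIntegral_lt_top hm hi
    finiteness
  · refine (slice_sq_le_of_unit (Real.rpow_pos_of_pos hs.1 (2 * c)) (isInnerForm_inner g x) _
      hv).trans ?_
    gcongr
    exact formNormSq_coneMetric_clip η hle hs x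

/-- The square integral of the kernel of the homotopy operator, with weight `s^{-w}`. -/
def kernSq (X : ℝ → ℝ) (w r : ℝ) : ℝ≥0∞ :=
  ∫⁻ s in Set.Ioo (0 : ℝ) 1, ENNReal.ofReal (kern X r s ^ 2 * (s ^ w)⁻¹)

theorem measurable_kernSq {X : ℝ → ℝ} (hX : Measurable X) (w : ℝ) : Measurable (kernSq X w) := by
  have := measurable_kern hX
  have h : Measurable fun p : ℝ × ℝ => ENNReal.ofReal (kern X p.1 p.2 ^ 2 * (p.2 ^ w)⁻¹) := by
    fun_prop
  exact h.lintegral_prod_right'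

/-- A Hilbert–Schmidt bound: the kernel must be square integrable on the unit square against `r^w
s^{-w}`. Source and target carry the same `w`, since contraction with `∂_r` lowers the degree by one
without a factor. -/
theorem hasMajorant_homForm {k : ℕ} {η : Form (𝓘(ℝ, ℝ).prod 𝓘(ℝ, E)) (interval01 × F) (k + 1)}
    (hη : HasMajorant (coneMetric c g.inner) η) {X : ℝ → ℝ} (hX : Measurable X)
    (hN : ∫⁻ r in Set.Ioo (0 : ℝ) 1, ENNReal.ofReal (r ^ (c * (Module.finrank ℝ E - 2 * k))) *
      kernSq X (c * (Module.finrank ℝ E - 2 * k)) r < ⊤) :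
    HasMajorant (coneMetric c g.inner) (homForm X η) := by
  obtain ⟨h, hm, hi, hle⟩ := hη
  have hr := measurable_rayIntegral (F := F) (c * Module.finrank ℝ E) hm
  refine hasMajorant_of_le (C := ((Module.finrank ℝ (ℝ × E) : ℝ≥0∞) ^ k * (k ! : ℝ≥0∞)) *
    ((Module.finrank ℝ E : ℝ≥0∞) ^ k * ((k + 1)! : ℝ≥0∞))) (by finiteness)
    (measurable_kernSq hX _) hr (lintegral_rayIntegral_lt_top hm hi) hN fun q => ?_
  rw [coneMetric_eq]
  have h0 : (0 : ℝ) < q.1 := q.1.2.1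
  refine (formNormSq_cylForm_le (Real.rpow_pos_of_pos h0 _) (isInnerForm_inner g q.2) _).trans ?_
  refine (mul_le_mul_right (mul_le_mul_right (formNormSq_intForm_ray_le (c := c)
    (C := ((k + 1)! : ℝ≥0∞)) ((measurable_kern hX).comp (measurable_const.prodMk measurable_id))
    _ _ hm q.2 fun s hs v hv => ?_) _) _).trans (le_of_eq ?_)
  · refine (radial_sq_le_of_unit (Real.rpow_pos_of_pos hs.1 (2 * c)) (isInnerForm_inner g q.2) _
      hv).trans ?_
    gcongr
    exact formNormSq_coneMetric_clip η hle hs q.2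
  · simp only [kernSq, Function.comp, id]
    ring

end Estimates

/-! ### Integrability of the kernels -/

section KernelIntegrals

theorem integrableOn_rpow_Ioo {w : ℝ} (hw : -1 < w) :
    IntegrableOn (fun s : ℝ => s ^ w) (Set.Ioo 0 1) :=
  (intervalIntegral.integrableOn_Ioo_rpow_iff one_pos).2 hw

theorem lintegral_kernSq_lt_top {X : ℝ → ℝ} {w : ℝ} {A B : ℝ → ℝ}
    (hA : IntegrableOn A (Set.Ioo 0 1)) (hB : IntegrableOn B (Set.Ioo 0 1))
    (h : ∀ r ∈ Set.Ioo (0 : ℝ) 1, ∀ s ∈ Set.Ioo (0 : ℝ) 1,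
      r ^ w * (kern X r s ^ 2 * (s ^ w)⁻¹) ≤ A r + B s) :
    ∫⁻ r in Set.Ioo (0 : ℝ) 1, ENNReal.ofReal (r ^ w) * kernSq X w r < ⊤ := by
  have h1 : ∀ r ∈ Set.Ioo (0 : ℝ) 1, ENNReal.ofReal (r ^ w) * kernSq X w r ≤
      ENNReal.ofReal (A r) + ∫⁻ s in Set.Ioo (0 : ℝ) 1, ENNReal.ofReal (B s) := by
    intro r hr
    unfold kernSq
    rw [← lintegral_const_mul' _ _ ENNReal.ofReal_ne_top]
    calc _ ≤ ∫⁻ s in Set.Ioo (0 : ℝ) 1, (ENNReal.ofReal (A r) + ENNReal.ofReal (B s)) := by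
          refine setLIntegral_mono' measurableSet_Ioo fun s hs => ?_
          rw [← ENNReal.ofReal_mul (Real.rpow_nonneg hr.1.le _)]
          exact (ENNReal.ofReal_le_ofReal (h r hr s hs)).trans ENNReal.ofReal_add_le
      _ = _ := by
          rw [lintegral_add_left measurable_const]
          simp
  calc _ ≤ ∫⁻ r in Set.Ioo (0 : ℝ) 1, (ENNReal.ofReal (A r) +
        ∫⁻ s in Set.Ioo (0 : ℝ) 1, ENNReal.ofReal (B s)) :=
        setLIntegral_mono' measurableSet_Ioo h1
    _ = (∫⁻ r in Set.Ioo (0 : ℝ) 1, ENNReal.ofReal (A r)) +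
        ∫⁻ s in Set.Ioo (0 : ℝ) 1, ENNReal.ofReal (B s) := by
        rw [lintegral_add_right _ measurable_const]
        simp
    _ < ⊤ := ENNReal.add_lt_top.2 ⟨hA.lintegral_lt_top, hB.lintegral_lt_top⟩

/-- Where the kernel is nonzero, `s ≥ a r`. Then `r^w s^{-w}` is at most `a^{-w}` if `w ≥ 0` and at
most `r^w` if `w < 0`; the latter is integrable since `w > -1`. -/
theorem IsCutoff.lintegral_kernSq_lt_top {a b : ℝ} (ha : 0 < a) (ha1 : a ≤ 1) {X : ℝ → ℝ}
    (hX : IsCutoff a b X) {w : ℝ} (hw : -1 < w) :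
    ∫⁻ r in Set.Ioo (0 : ℝ) 1, ENNReal.ofReal (r ^ w) * kernSq X w r < ⊤ := by
  refine L2deRham.lintegral_kernSq_lt_top (A := fun r => (a⁻¹) ^ w + r ^ w) (B := fun _ => 0)
    ((integrableOn_const (by simp)).add (integrableOn_rpow_Ioo hw)) integrableOn_zero
    fun r hr s hs => ?_
  have hr0 := Real.rpow_pos_of_pos hr.1 w
  have hs0 := Real.rpow_pos_of_pos hs.1 w
  have ha0 := Real.rpow_pos_of_pos (inv_pos.2 ha) w
  rw [add_zero]
  -- `a r` lies below `r`, as `a ≤ 1`, and below `a`, as `r < 1`; so in this range `1_{s<r} = X(s) =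
  -- 1`.
  by_cases hs' : s < a * r
  · have h1 : s < r := hs'.trans_le (by nlinarith [hr.1])
    have h2 : s ≤ a := hs'.le.trans (by nlinarith [hr.2])
    simp only [kern, h1, hX.eq_one s h2, if_true]
    simp only [sub_self, ne_eq, OfNat.ofNat_ne_zero, not_false_eq_true, zero_pow, zero_mul,
      mul_zero]
    positivity
  · have hk : kern X r s ^ 2 ≤ 1 := by
      have h1 := hX.nonneg s
      have h2 := hX.le_one s
      unfold kern
      split_ifs <;> nlinarith
    have h3 : r ^ w * (kern X r s ^ 2 * (s ^ w)⁻¹) ≤ r ^ w * (s ^ w)⁻¹ := by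
      have := inv_pos.2 hs0
      gcongr
      nlinarith
    refine h3.trans ?_
    rcases le_or_gt 0 w with h | h
    · have h4 : r ^ w ≤ (a⁻¹) ^ w * s ^ w := by
        rw [← Real.mul_rpow (inv_pos.2 ha).le hs.1.le]
        refine Real.rpow_le_rpow hr.1.le ?_ h
        rw [← div_eq_inv_mul, le_div_iff₀ ha]
        linarith
      rw [← div_eq_mul_inv]
      have := (div_le_iff₀ hs0).2 h4
      linarith
    · have h4 : (s ^ w)⁻¹ ≤ 1 := by
        refine inv_le_one_of_one_le₀ ?_
        exact Real.one_le_rpow_of_pos_of_le_one_of_nonpos hs.1 hs.2.le h.le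
      nlinarith

/-- For `s < r` the integrand `r^w s^{-w}` is at most `s^{-w}` if `w ≥ 0` and at most one if `w <
0`. This is where `w < 1` enters. -/
theorem lintegral_kernSq_zero_lt_top {w : ℝ} (hw : w < 1) :
    ∫⁻ r in Set.Ioo (0 : ℝ) 1, ENNReal.ofReal (r ^ w) * kernSq (fun _ => 0) w r < ⊤ := by
  refine lintegral_kernSq_lt_top (A := fun _ => 1) (B := fun s => s ^ (-w))
    (integrableOn_const (by simp)) (integrableOn_rpow_Ioo (by linarith))
    fun r hr s hs => ?_
  have hr0 := Real.rpow_pos_of_pos hr.1 w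
  have hs0 := Real.rpow_pos_of_pos hs.1 w
  rw [Real.rpow_neg hs.1.le]
  have := inv_pos.2 hs0
  by_cases hsr : s < r
  · simp only [kern, hsr, if_true, sub_zero, one_pow, one_mul]
    rcases le_or_gt 0 w with h | h
    · have h4 : r ^ w ≤ 1 := Real.rpow_le_one hr.1.le hr.2.le h
      nlinarith
    · have h4 : r ^ w ≤ s ^ w := Real.rpow_le_rpow_of_nonpos hs.1 hsr.le h.le
      have : r ^ w * (s ^ w)⁻¹ ≤ 1 := by
        rw [← div_eq_mul_inv]
        exact (div_le_one hs0).2 h4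
      linarith
  · simp only [kern, hsr, if_false, sub_zero]
    simp only [ne_eq, OfNat.ofNat_ne_zero, not_false_eq_true, zero_pow, zero_mul, mul_zero]
    positivity

/-- `1 - X` vanishes near zero, so every power of `s` is allowed. -/
theorem IsCutoff.integrableOn_one_sub_sq {a b : ℝ} (ha : 0 < a) {X : ℝ → ℝ}
    (hX : IsCutoff a b X) (w : ℝ) :
    IntegrableOn (fun s => (1 - X s) ^ 2 * s ^ (-w)) (Set.Ioo 0 1) := by
  have hc := hX.smooth.continuous
  refine Integrable.mono' (g := fun _ => max 1 (a ^ (-w))) (integrableOn_const (by simp)) ?_ ?_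
  · have : Measurable fun s => (1 - X s) ^ 2 * s ^ (-w) := by
      have := hc.measurable
      fun_prop
    exact this.aestronglyMeasurable
  · filter_upwards [ae_restrict_mem measurableSet_Ioo] with s hs
    have hs0 := Real.rpow_pos_of_pos hs.1 (-w)
    rw [Real.norm_of_nonneg (by positivity)]
    rcases le_or_gt s a with h | h
    · rw [hX.eq_one s h]
      simp
    · have h1 := hX.nonneg s
      have h2 := hX.le_one s
      have h3 : (1 - X s) ^ 2 ≤ 1 := by nlinarith
      refine le_trans (by nlinarith : _ ≤ s ^ (-w)) ?_
      rcases le_or_gt 0 (-w) with h' | h'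
      · exact (Real.rpow_le_one hs.1.le hs.2.le h').trans (le_max_left _ _)
      · exact (Real.rpow_le_rpow_of_nonpos ha h.le h'.le).trans (le_max_right _ _)

end KernelIntegrals

/-! ### Local integrability near the tip -/

section Local

variable {E : Type*} [NormedAddCommGroup E] [NormedSpace ℝ E] [FiniteDimensional ℝ E]
  [MeasurableSpace E] [BorelSpace E] {F : Type*} [TopologicalSpace F] [ChartedSpace E F]
  [IsManifold 𝓘(ℝ, E) ∞ F] [MeasurableSpace F] [BorelSpace F] [SecondCountableTopology F]
  {c : ℝ} {g : Bundle.ContMDiffRiemannianMetric 𝓘(ℝ, E) ∞ E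
      (fun x : F => TangentSpace 𝓘(ℝ, E) x)}

theorem setLIntegral_cyl_lt_top {h : interval01 × F → ℝ≥0∞} (hm : Measurable h)
    (hi : ∫⁻ q, h q ∂(volumeMeasure (coneMetric c g.inner)) < ⊤) (x : F) :
    ∫⁻ p in cyl (coordDomain 𝓘(ℝ, E) x), ENNReal.ofReal (p.1 ^ (c * Module.finrank ℝ E) *
        coordDensity g.inner x p.2) * h (clip p.1, (extChartAt 𝓘(ℝ, E) x).symm p.2)
      ∂((volume : Measure ℝ).prod (modelMeasure E)) < ⊤ := by
  obtain ⟨C, hC, hD⟩ := exists_coordDensity_coneMetric (F := F) E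
  obtain ⟨κ, hκ0, hκ1, hκ⟩ := exists_modelMeasure_prod E
  have h1 : ∫⁻ q, h q ∂(localVolume (coneMetric c g.inner) (half, x)) < ⊤ :=
    (lintegral_mono' (le_iSup (localVolume (coneMetric c g.inner)) (half, x)) le_rfl).trans_lt hi
  rw [lintegral_localVolume _ _ (aemeasurable_coordDensity_coneMetric c g (half, x)) hm,
    coordDomain_prod, hκ, Measure.restrict_smul, lintegral_smul_measure] at h1
  have e1 : ∫⁻ p in cyl (coordDomain 𝓘(ℝ, E) x),
        ENNReal.ofReal (coordDensity (coneMetric c g.inner) (half, x) p) *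
          h ((extChartAt (𝓘(ℝ, ℝ).prod 𝓘(ℝ, E)) (half, x)).symm p)
          ∂((volume : Measure ℝ).prod (modelMeasure E)) =
        ∫⁻ p in cyl (coordDomain 𝓘(ℝ, E) x), ENNReal.ofReal C *
          (ENNReal.ofReal (p.1 ^ (c * Module.finrank ℝ E) * coordDensity g.inner x p.2) *
            h (clip p.1, (extChartAt 𝓘(ℝ, E) x).symm p.2))
          ∂((volume : Measure ℝ).prod (modelMeasure E)) := by
    refine setLIntegral_congr_fun (isOpen_cyl (isOpen_coordDomain (E := E) F x)).measurableSet
      fun p hp => ?_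
    rw [hD c g.inner half x p hp, extChartAt_prod_symm, ENNReal.ofReal_mul hC.le, mul_assoc]
  rw [e1, lintegral_const_mul' _ _ ENNReal.ofReal_ne_top, smul_eq_mul] at h1
  by_contra hc
  rw [not_lt, top_le_iff] at hc
  rw [hc, ENNReal.mul_top (by simpa using hC), ENNReal.mul_top hκ0] at h1
  exact lt_irrefl _ h1

/-- The global `L²` condition becomes a weighted one for coefficients in a chart, uniformly up to `r
= 0`. Here `m` is the number of arguments tangent to `F`: the degree for slices, one less for the
contraction with `∂_r`. -/
theorem integrableOn_weighted_sq {k m : ℕ} {η : Form (𝓘(ℝ, ℝ).prod 𝓘(ℝ, E)) (interval01 × F) k}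
    (hη : HasMajorant (coneMetric c g.inner) η) (x : F) {K : Set E}
    (hK : K ⊆ coordDomain 𝓘(ℝ, E) x) (hKc : IsCompact K) (v : Fin m → E) {u : ℝ × E → ℝ}
    (hu : AEStronglyMeasurable u (((volume : Measure ℝ).prod (modelMeasure E)).restrict
      (Set.Ioo 0 1 ×ˢ K)))
    {C : ℝ≥0∞} (hC : C ≠ ⊤)
    (hle : ∀ p ∈ Set.Ioo (0 : ℝ) 1 ×ˢ K, ENNReal.ofReal (u p ^ 2) ≤ C * ENNReal.ofReal
      (∏ j, g.inner ((extChartAt 𝓘(ℝ, E) x).symm p.2) (coordFrame 𝓘(ℝ, E) x p.2 (v j))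
        (coordFrame 𝓘(ℝ, E) x p.2 (v j))) * (ENNReal.ofReal ((p.1 ^ (2 * c)) ^ m) *
          formNormSq (coneMetric c g.inner (clip p.1, (extChartAt 𝓘(ℝ, E) x).symm p.2))
            (η (clip p.1, (extChartAt 𝓘(ℝ, E) x).symm p.2)))) :
    IntegrableOn (fun p => p.1 ^ (c * (Module.finrank ℝ E - 2 * m)) * u p ^ 2)
      (Set.Ioo 0 1 ×ˢ K) ((volume : Measure ℝ).prod (modelMeasure E)) := by
  obtain ⟨h, hm, hi, hh⟩ := hη
  set G : E → ℝ := fun y => ∏ j, g.inner ((extChartAt 𝓘(ℝ, E) x).symm y)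
    (coordFrame 𝓘(ℝ, E) x y (v j)) (coordFrame 𝓘(ℝ, E) x y (v j)) with hG
  have hGc : ContinuousOn G K :=
    (continuousOn_finsetProd _ fun j _ => continuousOn_coordGram g x (v j) (v j)).mono hK
  -- On the compact `K` the lengths of the frame vectors are bounded by a multiple of the positive,
  -- continuous volume density.
  obtain ⟨Q, hQ⟩ := hKc.exists_bound_of_continuousOn (hGc.div
      ((continuousOn_coordDensity g x).mono hK)
    fun y hy => (coordDensity_pos g (hK hy)).ne')
  have hQ' : ∀ y ∈ K, G y ≤ |Q| * coordDensity g.inner x y := fun y hy => by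
    have h1 := (le_abs_self _).trans ((hQ y hy).trans (le_abs_self Q))
    exact (div_le_iff₀ (coordDensity_pos g (hK hy))).1 h1
  have hKm : MeasurableSet (Set.Ioo (0 : ℝ) 1 ×ˢ K) := measurableSet_Ioo.prod hKc.measurableSet
  have hmeas : AEStronglyMeasurable
      (fun p : ℝ × E => p.1 ^ (c * (Module.finrank ℝ E - 2 * m)) * u p ^ 2)
      (((volume : Measure ℝ).prod (modelMeasure E)).restrict (Set.Ioo 0 1 ×ˢ K)) := by
    refine AEStronglyMeasurable.mul ?_ (hu.pow 2)
    exact (measurable_fst.pow_const _).aestronglyMeasurable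
  refine ⟨hmeas, ?_⟩
  have hnn : 0 ≤ᵐ[((volume : Measure ℝ).prod (modelMeasure E)).restrict (Set.Ioo 0 1 ×ˢ K)]
      fun p : ℝ × E => p.1 ^ (c * (Module.finrank ℝ E - 2 * m)) * u p ^ 2 := by
    filter_upwards [ae_restrict_mem hKm] with p hp
    exact mul_nonneg (Real.rpow_nonneg hp.1.1.le _) (sq_nonneg _)
  rw [hasFiniteIntegral_iff_ofReal hnn]
  calc _ ≤ ∫⁻ p in Set.Ioo (0 : ℝ) 1 ×ˢ K, (C * ENNReal.ofReal |Q|) *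
        (ENNReal.ofReal (p.1 ^ (c * Module.finrank ℝ E) *
        coordDensity g.inner x p.2) * h (clip p.1, (extChartAt 𝓘(ℝ, E) x).symm p.2))
        ∂((volume : Measure ℝ).prod (modelMeasure E)) := by
        refine setLIntegral_mono' hKm fun p hp => ?_
        have hp0 := hp.1.1
        have hd := coordDensity_pos g (hK hp.2)
        rw [ENNReal.ofReal_mul (Real.rpow_nonneg hp0.le _)]
        calc _ ≤ ENNReal.ofReal (p.1 ^ (c * (Module.finrank ℝ E - 2 * m))) *
              (C * ENNReal.ofReal (|Q| * coordDensity g.inner x p.2) *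
                (ENNReal.ofReal ((p.1 ^ (2 * c)) ^ m) *
                  h (clip p.1, (extChartAt 𝓘(ℝ, E) x).symm p.2))) := by
              refine mul_le_mul_right ((hle p hp).trans ?_) _
              gcongr
              · exact hQ' p.2 hp.2
              · exact hh _
          _ = _ := by
              rw [← rpow_mul_rpow_pow hp0 c (Module.finrank ℝ E) m,
                ENNReal.ofReal_mul (abs_nonneg Q), ENNReal.ofReal_mul (by positivity),
                ENNReal.ofReal_mul (Real.rpow_nonneg hp0.le _)]
              ring
    _ = C * ENNReal.ofReal |Q| * ∫⁻ p in Set.Ioo (0 : ℝ) 1 ×ˢ K,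
        (ENNReal.ofReal (p.1 ^ (c * Module.finrank ℝ E) *
        coordDensity g.inner x p.2) * h (clip p.1, (extChartAt 𝓘(ℝ, E) x).symm p.2))
        ∂((volume : Measure ℝ).prod (modelMeasure E)) :=
        lintegral_const_mul' _ _ (ENNReal.mul_ne_top hC ENNReal.ofReal_ne_top)
    _ < ⊤ := ENNReal.mul_lt_top (ENNReal.mul_ne_top hC ENNReal.ofReal_ne_top).lt_top
        ((lintegral_mono_set (Set.prod_mono subset_rfl hK)).trans_lt
          (setLIntegral_cyl_lt_top hm hi x))

theorem aestronglyMeasurable_coordForm_cyl {k : ℕ}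
    {η : Form (𝓘(ℝ, ℝ).prod 𝓘(ℝ, E)) (interval01 × F) k} (hη : MeasurableForm η) (x : F)
    {K : Set E} (hK : K ⊆ coordDomain 𝓘(ℝ, E) x) (v : Fin k → ℝ × E) :
    AEStronglyMeasurable (fun p => coordForm η (half, x) p v)
      (((volume : Measure ℝ).prod (modelMeasure E)).restrict (Set.Ioo 0 1 ×ˢ K)) := by
  obtain ⟨κ, hκ0, hκ1, hκ⟩ := exists_modelMeasure_prod E
  have h := hη (half, x) v
  rw [coordDomain_prod, hκ, Measure.restrict_smul, aemeasurable_smul_measure_iff hκ0] at h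
  exact (h.mono_measure (Measure.restrict_mono (Set.prod_mono subset_rfl hK)
      le_rfl)).aestronglyMeasurable

theorem radialForm_coordForm_apply {k : ℕ}
    (η : Form (𝓘(ℝ, ℝ).prod 𝓘(ℝ, E)) (interval01 × F) (k + 1)) (r : interval01) {x : F}
    {p : ℝ × E} (hp : p ∈ cyl (coordDomain 𝓘(ℝ, E) x)) (v : Fin k → E) :
    radialForm (coordForm η (r, x) p) v =
      radialForm (prodValue η (clip p.1) ((extChartAt 𝓘(ℝ, E) x).symm p.2))
        (fun j => (coordFrame 𝓘(ℝ, E) x p.2 : E →L[ℝ] E) (v j)) := by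
  rw [coordForm_prodValue η r hp]
  exact congr_arg (fun θ : E [⋀^Fin k]→L[ℝ] ℝ => θ v) (radialForm_prodMap _ _)

theorem sliceForm_coordForm_apply {k : ℕ}
    (η : Form (𝓘(ℝ, ℝ).prod 𝓘(ℝ, E)) (interval01 × F) k) (r : interval01) {x : F}
    {p : ℝ × E} (hp : p ∈ cyl (coordDomain 𝓘(ℝ, E) x)) (v : Fin k → E) :
    sliceForm (coordForm η (r, x) p) v =
      sliceForm (prodValue η (clip p.1) ((extChartAt 𝓘(ℝ, E) x).symm p.2))
        (fun j => (coordFrame 𝓘(ℝ, E) x p.2 : E →L[ℝ] E) (v j)) := by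
  rw [coordForm_prodValue η r hp]
  exact congr_arg (fun θ : E [⋀^Fin k]→L[ℝ] ℝ => θ v) (sliceForm_prodMap _ _)

/-- With `t = s^w`, one has `2 |1 - X| |u| ≤ (1 - X)² t⁻¹ + t u²`. The first term is integrable by
assumption, the second by the `L²` condition. -/
theorem radialInt_of_hasMajorant {k : ℕ}
    {η : Form (𝓘(ℝ, ℝ).prod 𝓘(ℝ, E)) (interval01 × F) (k + 1)} (hm : MeasurableForm η)
    (hη : HasMajorant (coneMetric c g.inner) η) {X : ℝ → ℝ} (hXm : Measurable X)
    (hX : IntegrableOn (fun s => (1 - X s) ^ 2 * s ^ (-(c * (Module.finrank ℝ E - 2 * k))))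
      (Set.Ioo 0 1)) (x : F) :
    RadialInt (modelMeasure E) (coordDomain 𝓘(ℝ, E) x) X (coordForm η (half, x)) := by
  intro K hK hKc v
  have hu := aestronglyMeasurable_coordForm_cyl hm x hK (Fin.cons (1, 0) fun j => (0, v j))
  have h1 := integrableOn_weighted_sq (k := k + 1) (m := k) hη x hK hKc v hu
    (C := ((k + 1)! : ℝ≥0∞)) (by finiteness) fun p hp => by
      have hp' : p ∈ cyl (coordDomain 𝓘(ℝ, E) x) := ⟨hp.1, hK hp.2⟩
      rw [coneMetric_eq, ← radialForm_apply, radialForm_coordForm_apply η half hp']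
      have := radial_sq_le (Real.rpow_pos_of_pos hp.1.1 (2 * c))
        (isInnerForm_inner g ((extChartAt 𝓘(ℝ, E) x).symm p.2))
        (prodValue η (clip p.1) ((extChartAt 𝓘(ℝ, E) x).symm p.2))
        (fun j => (coordFrame 𝓘(ℝ, E) x p.2 : E →L[ℝ] E) (v j))
      simp only [coe_clip hp.1]
      exact this
  have hKf : IsFiniteMeasure ((modelMeasure E).restrict K) := ⟨by
    rw [Measure.restrict_apply_univ]; exact hKc.measure_lt_top⟩
  have h2 : IntegrableOn (fun p : ℝ × E => (1 - X p.1) ^ 2 *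
      p.1 ^ (-(c * (Module.finrank ℝ E - 2 * k)))) (Set.Ioo 0 1 ×ˢ K)
      ((volume : Measure ℝ).prod (modelMeasure E)) := by
    rw [IntegrableOn, ← Measure.prod_restrict]
    exact Integrable.comp_fst hX _
  refine Integrable.mono' (h2.add h1) ?_ ?_
  · exact ((measurable_const.sub (hXm.comp measurable_fst)).aestronglyMeasurable).mul hu
  · filter_upwards [ae_restrict_mem (measurableSet_Ioo.prod hKc.measurableSet)] with p hp
    have h0 := Real.rpow_pos_of_pos hp.1.1 (c * (Module.finrank ℝ E - 2 * k))
    simp only [Pi.add_apply]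
    rw [Real.rpow_neg hp.1.1.le, radialForm_apply]
    generalize coordForm η (half, x) p (Fin.cons (1, 0) fun j => (0, v j)) = u
    generalize p.1 ^ (c * (Module.finrank ℝ E - 2 * k)) = t at h0
    rw [Real.norm_eq_abs, abs_mul]
    have h3 : |1 - X p.1| * |u| = (|1 - X p.1| * t⁻¹) * (t * |u|) := by field_simp
    have h4 : (1 - X p.1) ^ 2 * t⁻¹ + t * u ^ 2 - 2 * (|1 - X p.1| * |u|) =
        t⁻¹ * (|1 - X p.1| - t * |u|) ^ 2 := by
      rw [← sq_abs (1 - X p.1), ← sq_abs u]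
      field_simp
      ring
    have h5 : 0 ≤ t⁻¹ * (|1 - X p.1| - t * |u|) ^ 2 := by positivity
    have h6 : 0 ≤ |1 - X p.1| * |u| := by positivity
    linarith

/-- On `(0, 1)` an exponent at most `-1` gives `s^w ≥ s⁻¹`. This yields the hypothesis under which
the boundary term at the tip vanishes. -/
theorem integrableOn_inv_mul_slice_sq {k : ℕ}
    {η : Form (𝓘(ℝ, ℝ).prod 𝓘(ℝ, E)) (interval01 × F) k} (hm : MeasurableForm η)
    (hη : HasMajorant (coneMetric c g.inner) η) (hw : c * (Module.finrank ℝ E - 2 * k) ≤ -1)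
    (x : F) {K : Set E} (hK : K ⊆ coordDomain 𝓘(ℝ, E) x) (hKc : IsCompact K) (v : Fin k → E) :
    IntegrableOn (fun p : ℝ × E => p.1⁻¹ * sliceForm (coordForm η (half, x) p) v ^ 2)
        (Set.Ioo 0 1 ×ˢ K) (volume.prod (modelMeasure E)) := by
  have hu := aestronglyMeasurable_coordForm_cyl hm x hK (fun j => (0, v j))
  have h1 := integrableOn_weighted_sq (k := k) (m := k) hη x hK hKc v hu
    (C := (k ! : ℝ≥0∞)) (by finiteness) fun p hp => by
      have hp' : p ∈ cyl (coordDomain 𝓘(ℝ, E) x) := ⟨hp.1, hK hp.2⟩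
      rw [coneMetric_eq, ← sliceForm_apply, sliceForm_coordForm_apply η half hp']
      have := slice_sq_le (Real.rpow_pos_of_pos hp.1.1 (2 * c))
        (isInnerForm_inner g ((extChartAt 𝓘(ℝ, E) x).symm p.2))
        (prodValue η (clip p.1) ((extChartAt 𝓘(ℝ, E) x).symm p.2))
        (fun j => (coordFrame 𝓘(ℝ, E) x p.2 : E →L[ℝ] E) (v j))
      simp only [coe_clip hp.1]
      exact this
  refine Integrable.mono' h1 ?_ ?_
  · exact (measurable_fst.inv.aestronglyMeasurable).mul (hu.pow 2)
  · filter_upwards [ae_restrict_mem (measurableSet_Ioo.prod hKc.measurableSet)] with p hp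
    have h0 := hp.1.1
    rw [sliceForm_apply, Real.norm_of_nonneg (by positivity)]
    refine mul_le_mul_of_nonneg_right ?_ (sq_nonneg _)
    rw [← Real.rpow_neg_one]
    exact Real.rpow_le_rpow_of_exponent_ge h0 hp.1.2.le hw

end Local

/-! ### Cohomology in terms of representatives -/

section Cohomology

variable {G : Type*} [NormedAddCommGroup G] [NormedSpace ℝ G] [FiniteDimensional ℝ G]
  [MeasurableSpace G] [BorelSpace G] {H : Type*} [TopologicalSpace H] {I : ModelWithCorners ℝ G H}
  [I.Boundaryless] {M : Type*} [TopologicalSpace M] [ChartedSpace H M]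
  [MeasurableSpace M] [BorelSpace M]

/-- The volume has a positive measurable density in all charts. -/
def RegularDensity (g : BilinField I M) : Prop := ∀ x : M,
  AEMeasurable (coordDensity g x) ((modelMeasure G).restrict (coordDomain I x)) ∧
    ∀ y ∈ coordDomain I x, 0 < coordDensity g x y

theorem IsWeakExtDeriv.congr_ae {g : BilinField I M} (hg : RegularDensity g) {k : ℕ}
    {α α' : Form I M k} {β β' : Form I M (k + 1)} (h : IsWeakExtDeriv α β)
    (hα : ∀ᵐ x ∂(volumeMeasure g), α x = α' x) (hβ : ∀ᵐ x ∂(volumeMeasure g), β x = β' x) :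
    IsWeakExtDeriv α' β' := by
  have h' : ∀ x : M, WeakDeriv (modelMeasure G) (coordDomain I x) (coordForm α' x)
      (coordForm β' x) := fun x => by
    have hw : WeakDeriv (modelMeasure G) (coordDomain I x) (coordForm α x) (coordForm β x) :=
      ⟨h.1 x, h.2.1 x, fun ψ hψ v => h.2.2 x ψ hψ.smooth hψ.compact hψ.supp v⟩
    refine hw.congr_ae (measurableSet_coordDomain I x) ?_ ?_
    · filter_upwards [ae_coordDomain_of_ae_volumeMeasure g x (hg x).1 (hg x).2 hα] with y hy hyU
      simp only [coordForm, hy hyU]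
    · filter_upwards [ae_coordDomain_of_ae_volumeMeasure g x (hg x).1 (hg x).2 hβ] with y hy hyU
      simp only [coordForm, hy hyU]
  exact ⟨fun x => (h' x).1, fun x => (h' x).2.1, fun x ψ h1 h2 h3 v => (h' x).2.2 ψ ⟨h1, h2, h3⟩ v⟩

/-- The square integrable closed forms. -/
def closedForms (g : BilinField I M) (k : ℕ) : Submodule ℝ (squareIntegrableForms g k) :=
  (weakDerivPairs g k).comap (LinearMap.inl ℝ _ _)

/-- `α` is almost everywhere the derivative of a square integrable form. -/
def IsExactForm (g : BilinField I M) : ∀ {k : ℕ}, Form I M k → Prop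
  | 0, α => ∀ᵐ x ∂(volumeMeasure g), α x = 0
  | k + 1, α => ∃ η ∈ squareIntegrableForms g k, IsWeakExtDeriv η α

theorem mem_nullForms {g : BilinField I M} {k : ℕ} {α : squareIntegrableForms g k} :
    α ∈ nullForms g k ↔ ∀ᵐ x ∂(volumeMeasure g), α.1 x = 0 := Iff.rfl

/-- Weak derivatives do not see null sets when the density is regular, so exactness of a class may
be tested on any representative. -/
theorem mk_mem_dMaxRange_iff {g : BilinField I M} (hg : RegularDensity g) {k : ℕ}
    (α : squareIntegrableForms g k) :
    (nullForms g k).mkQ α ∈ dMaxRange g k ↔ IsExactForm g α.1 := by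
  cases k with
  | zero =>
    change (nullForms g 0).mkQ α = 0 ↔ _
    rw [Submodule.mkQ_apply, Submodule.Quotient.mk_eq_zero]
    rfl
  | succ k =>
    constructor
    · rintro ⟨⟨u, w⟩, ⟨⟨η, β⟩, hp, he⟩, rfl⟩
      refine ⟨η.1, η.2, ?_⟩
      have h1 : (nullForms g (k + 1)).mkQ β = (nullForms g (k + 1)).mkQ α := congr_arg Prod.snd he
      have h2 := mem_nullForms.1 ((Submodule.Quotient.eq _).1 h1)
      refine IsWeakExtDeriv.congr_ae hg hp (Filter.Eventually.of_forall fun _ => rfl) ?_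
      filter_upwards [h2] with x hx
      exact sub_eq_zero.1 hx
    · rintro ⟨η, hη, h⟩
      exact ⟨(_, (nullForms g (k + 1)).mkQ α), ⟨(⟨η, hη⟩, α), h, rfl⟩, rfl⟩

/-- The cohomology is presented as closed forms modulo exact ones, before passing to classes almost
everywhere. The operators on the cone need then be defined only on forms. -/
theorem exists_closedForms_map {g : BilinField I M} (hg : RegularDensity g) (k : ℕ) :
    ∃ q : closedForms g k →ₗ[ℝ] MaxL2Cohomology g k, Function.Surjective q ∧
      ∀ α, q α = 0 ↔ IsExactForm g α.1.1 := by
  have hz : ∀ α : closedForms g k, (nullForms g k).mkQ α.1 ∈ dMaxKer g k := fun α =>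
    ⟨(α.1, 0), α.2, by simp⟩
  let q0 : closedForms g k →ₗ[ℝ] dMaxKer g k :=
    LinearMap.codRestrict _ ((nullForms g k).mkQ ∘ₗ (closedForms g k).subtype) hz
  have hq0 : Function.Surjective q0 := by
    rintro ⟨u, ⟨⟨α, β⟩, hp, he⟩⟩
    have h1 : (nullForms g k).mkQ α = u := congr_arg Prod.fst he
    have h2 : (nullForms g (k + 1)).mkQ β = 0 := congr_arg Prod.snd he
    rw [Submodule.mkQ_apply, Submodule.Quotient.mk_eq_zero] at h2
    refine ⟨⟨α, ?_⟩, Subtype.ext h1⟩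
    exact IsWeakExtDeriv.congr_ae hg hp (Filter.Eventually.of_forall fun _ => rfl)
      (mem_nullForms.1 h2)
  refine ⟨((dMaxRange g k).submoduleOf (dMaxKer g k)).mkQ ∘ₗ q0,
    (Submodule.mkQ_surjective _).comp hq0, fun α => ?_⟩
  rw [LinearMap.comp_apply, Submodule.mkQ_apply, Submodule.Quotient.mk_eq_zero]
  exact mk_mem_dMaxRange_iff hg α.1

end Cohomology

/-! ### Averages of pullbacks and null sets of the cone -/

section Cone

variable {E : Type*} [NormedAddCommGroup E] [NormedSpace ℝ E] [FiniteDimensional ℝ E]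
  [MeasurableSpace E] [BorelSpace E] {F : Type*} [TopologicalSpace F] [ChartedSpace E F]
  [IsManifold 𝓘(ℝ, E) ∞ F] [MeasurableSpace F] [BorelSpace F] [SecondCountableTopology F]
  {c : ℝ} {g : Bundle.ContMDiffRiemannianMetric 𝓘(ℝ, E) ∞ E
      (fun x : F => TangentSpace 𝓘(ℝ, E) x)}

variable (g) in
theorem regularDensity_inner : RegularDensity g.inner := fun x =>
  ⟨aemeasurable_coordDensity g x, fun _ hy => coordDensity_pos g hy⟩

variable (c g) in
theorem regularDensity_coneMetric : RegularDensity (coneMetric c g.inner) := fun q =>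
  ⟨aemeasurable_coordDensity_coneMetric c g q, coordDensity_coneMetric_pos c g q⟩

theorem avgForm_zero {k : ℕ} (χ : ℝ → ℝ) :
    avgForm χ (0 : Form (𝓘(ℝ, ℝ).prod 𝓘(ℝ, E)) (interval01 × F) k) = 0 := by
  funext x
  have h : ∀ s, χ s • sliceForm (E := E) (prodValue (0 : Form (𝓘(ℝ, ℝ).prod 𝓘(ℝ, E))
      (interval01 × F) k) (clip s) x) = 0 := fun s => by
    rw [show sliceForm (E := E) (prodValue (0 : Form (𝓘(ℝ, ℝ).prod 𝓘(ℝ, E))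
      (interval01 × F) k) (clip s) x) = 0 from rfl, smul_zero]
  change intForm _ _ = _
  simp only [h]
  ext v
  rw [intForm_apply fun v => by simp]
  exact integral_zero _ _

theorem avgForm_pull {k : ℕ} {χ : ℝ → ℝ} (hχ : IsTest (Set.Ioo (0 : ℝ) 1) χ)
    (h1 : ∫ s in Set.Ioo (0 : ℝ) 1, χ s = 1) (ξ : Form 𝓘(ℝ, E) F k) :
    avgForm χ (pull ξ) = ξ := by
  funext x
  let θ : E [⋀^Fin k]→L[ℝ] ℝ := ξ x
  change intForm (E := E) (volume.restrict (Set.Ioo (0 : ℝ) 1)) (fun s => χ s • θ) = θ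
  have hi : Integrable χ := hχ.smooth.continuous.integrable_of_hasCompactSupport hχ.compact
  ext v
  rw [intForm_apply fun v => by
    simpa using (hi.integrableOn (s := Set.Ioo 0 1)).mul_const (θ v)]
  simp only [ContinuousAlternatingMap.smul_apply, smul_eq_mul]
  rw [integral_mul_const, h1, one_mul]

/-- A bump function on `(0, 1)` with integral one. -/
def stdBump (s : ℝ) : ℝ := -deriv stdCutoff s

theorem isTest_stdBump : IsTest (Set.Ioo (0 : ℝ) 1) stdBump :=
  isCutoff_stdCutoff.isTest_deriv (by norm_num) (by norm_num)

theorem integral_stdBump : ∫ s in Set.Ioo (0 : ℝ) 1, stdBump s = 1 := by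
  have h := intervalIntegral.integral_deriv_eq_sub (f := stdCutoff) (a := 0) (b := 1)
    (fun s _ => (contDiff_stdCutoff.differentiable (by simp)) s)
    ((contDiff_stdCutoff.continuous_deriv (by simp)).intervalIntegrable _ _)
  rw [intervalIntegral.integral_of_le zero_le_one, integral_Ioc_eq_integral_Ioo,
    isCutoff_stdCutoff.eq_one 0 (by norm_num), isCutoff_stdCutoff.eq_zero 1 (by norm_num)] at h
  unfold stdBump
  rw [integral_neg, h]
  norm_num

theorem mem_squareIntegrableForms_of_locIntegrable {G : Type*} [NormedAddCommGroup G]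
    [NormedSpace ℝ G] [FiniteDimensional ℝ G] [MeasurableSpace G] [BorelSpace G] {H : Type*}
    [TopologicalSpace H] {I : ModelWithCorners ℝ G H} {M : Type*} [TopologicalSpace M]
    [ChartedSpace H M] [MeasurableSpace M] {g : BilinField I M} {k : ℕ} {α : Form I M k}
    (h : LocIntegrableForm α) (hα : HasMajorant g α) : α ∈ squareIntegrableForms g k :=
  ⟨h.measurableForm, hα⟩

/-- The exceptional set is a cylinder over the one on `F`, and the radial factor of the measure is
not zero. In degree zero this is the injectivity of the pullback. -/
theorem ae_pull_eq_zero_iff {k : ℕ} (ξ : Form 𝓘(ℝ, E) F k) :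
    (∀ᵐ q ∂(volumeMeasure (coneMetric c g.inner)), pull ξ q = 0) ↔
      ∀ᵐ x ∂(volumeMeasure g.inner), ξ x = 0 := by
  have := sFinite_volumeMeasure g
  obtain ⟨K, h0, h1, -, h2⟩ := exists_volumeMeasure_coneMetric c g
  have e : {q : interval01 × F | ¬ pull ξ q = 0} = Set.univ ×ˢ {x | ¬ ξ x = 0} := by
    ext q
    simp only [Set.mem_ofPred_eq, Set.mem_prod, Set.mem_univ, true_and, not_iff_not]
    constructor
    · intro h
      have h3 := congr_arg (fun θ : (ℝ × E) [⋀^Fin k]→L[ℝ] ℝ => sliceForm θ) h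
      exact h3
    · intro h
      change cylForm (E := E) (ξ q.2) = 0
      rw [h]
      rfl
  have hρ : radialMeasure (c * Module.finrank ℝ E) Set.univ ≠ 0 := by
    rw [← lintegral_one, lintegral_radialMeasure (h := fun _ => 1) _ measurable_const]
    simp only [mul_one]
    rw [← pos_iff_ne_zero, setLIntegral_pos_iff (by fun_prop)]
    have h4 : Set.Ioo (0 : ℝ) 1 ⊆ (Function.support fun s : ℝ =>
        ENNReal.ofReal (s ^ (c * Module.finrank ℝ E))) ∩ Set.Ioo 0 1 := fun s hs =>
      ⟨by simpa using Real.rpow_pos_of_pos hs.1 _, hs⟩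
    exact lt_of_lt_of_le (by simp) (measure_mono h4)
  rw [ae_iff, ae_iff, e, h2, Measure.smul_apply, Measure.prod_prod, smul_eq_mul, mul_eq_zero,
    mul_eq_zero]
  simp [h0, hρ]

theorem ae_coneMetric_of_chart {P : interval01 × F → Prop}
    (h : ∀ x : F, ∀ᵐ p ∂((volume : Measure ℝ).prod (modelMeasure E)),
      p ∈ cyl (coordDomain 𝓘(ℝ, E) x) → P (clip p.1, (extChartAt 𝓘(ℝ, E) x).symm p.2)) :
    ∀ᵐ q ∂(volumeMeasure (coneMetric c g.inner)), P q := by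
  obtain ⟨K, h0, h1, h2, -⟩ := exists_volumeMeasure_coneMetric c g
  obtain ⟨κ, hκ0, hκ1, hκ⟩ := exists_modelMeasure_prod E
  obtain ⟨s, hs, hcov⟩ := exists_countable_cover E F
  have hcov' : ⋃ x ∈ s, (Set.univ : Set interval01) ×ˢ (extChartAt 𝓘(ℝ, E) x).source = Set.univ :=
      by
    refine Set.eq_univ_of_forall fun q => ?_
    obtain ⟨x, hx, hq⟩ := Set.mem_iUnion₂.1 (hcov.symm ▸ Set.mem_univ q.2)
    exact Set.mem_iUnion₂.2 ⟨x, hx, trivial, hq⟩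
  rw [← Measure.restrict_univ (μ := volumeMeasure (coneMetric c g.inner)), ← hcov',
    ae_restrict_biUnion_iff _ hs]
  intro x _
  rw [h2 (half, x)]
  refine ae_localVolume _ _ ?_
  rw [hκ]
  refine Measure.ae_smul_measure ?_ κ
  filter_upwards [h x] with p hp hpU
  rw [coordDomain_prod] at hpU
  rw [extChartAt_prod_symm]
  exact hp hpU

end Cone

/-! ### The two cases of the theorem -/

section Main

variable {E : Type*} [NormedAddCommGroup E] [NormedSpace ℝ E] [FiniteDimensional ℝ E]
  [MeasurableSpace E] [BorelSpace E] {F : Type*} [TopologicalSpace F] [ChartedSpace E F]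
  [IsManifold 𝓘(ℝ, E) ∞ F] [MeasurableSpace F] [BorelSpace F] [SecondCountableTopology F]
  {c : ℝ} {g : Bundle.ContMDiffRiemannianMetric 𝓘(ℝ, E) ∞ E
      (fun x : F => TangentSpace 𝓘(ℝ, E) x)}

theorem pull_mem_squareIntegrableForms {k : ℕ} {ξ : Form 𝓘(ℝ, E) F k}
    {ξ' : Form 𝓘(ℝ, E) F (k + 1)} (hξ : ξ ∈ squareIntegrableForms g.inner k)
    (h : IsWeakExtDeriv ξ ξ')
    (hw : -1 < c * (Module.finrank ℝ E - 2 * k)) :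
    pull ξ ∈ squareIntegrableForms (coneMetric c g.inner) k :=
  mem_squareIntegrableForms_of_locIntegrable (isWeakExtDeriv_pull h).1
    (hasMajorant_pull hξ.2 hw)

theorem avgForm_mem_squareIntegrableForms {k : ℕ}
    {η : Form (𝓘(ℝ, ℝ).prod 𝓘(ℝ, E)) (interval01 × F) k}
    {η' : Form (𝓘(ℝ, ℝ).prod 𝓘(ℝ, E)) (interval01 × F) (k + 1)}
    (hη : η ∈ squareIntegrableForms (coneMetric c g.inner) k) (h : IsWeakExtDeriv η η') :
    avgForm stdBump η ∈ squareIntegrableForms g.inner k :=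
  mem_squareIntegrableForms_of_locIntegrable (isWeakExtDeriv_avgForm isTest_stdBump h).1
    (hasMajorant_avgForm hη.2 isTest_stdBump)

/-- A primitive on `F` is pulled back, and a primitive on the cone is averaged; the average of `π^*
ξ` is `ξ`. -/
theorem isExactForm_pull_iff (hc : 0 < c) {k : ℕ} (hw : -1 < c * (Module.finrank ℝ E - 2 * k))
    (ξ : Form 𝓘(ℝ, E) F k) :
    IsExactForm (coneMetric c g.inner) (pull ξ) ↔ IsExactForm g.inner ξ := by
  cases k with
  | zero => exact ae_pull_eq_zero_iff ξ
  | succ k =>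
    constructor
    · rintro ⟨η, hη, h⟩
      refine ⟨avgForm stdBump η, avgForm_mem_squareIntegrableForms hη h, ?_⟩
      have := isWeakExtDeriv_avgForm isTest_stdBump h
      rwa [avgForm_pull isTest_stdBump integral_stdBump] at this
    · rintro ⟨η, hη, h⟩
      refine ⟨pull η, pull_mem_squareIntegrableForms hη h ?_, isWeakExtDeriv_pull h⟩
      -- The primitive has one degree less, which raises the exponent by `2c`, so the condition `>
      -- -1` persists.
      push_cast at hw
      nlinarith

/-- The homotopy formula with the standard cutoff provides the primitive. In degree zero exact means
zero almost everywhere, and the difference does vanish. -/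
theorem isExactForm_sub_pull_avgForm (hc : 0 < c) {k : ℕ}
    (hw : -1 < c * (Module.finrank ℝ E - 2 * k))
    {η : Form (𝓘(ℝ, ℝ).prod 𝓘(ℝ, E)) (interval01 × F) k}
    (hη : η ∈ squareIntegrableForms (coneMetric c g.inner) k) (h : IsWeakExtDeriv η 0) :
    IsExactForm (coneMetric c g.inner) (η - pull (avgForm stdBump η)) := by
  have h3 : (0 : ℝ) < 1 / 3 := by norm_num
  have h23 : (2 / 3 : ℝ) < 1 := by norm_num
  cases k with
  | zero =>
    refine ae_coneMetric_of_chart fun x => ?_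
    filter_upwards [ae_coordForm_eq_zero_of_degree_zero h3 h23 isCutoff_stdCutoff h x]
      with p hp hpU
    have h1 := congr_arg (fun θ : (ℝ × E) [⋀^Fin 0]→L[ℝ] ℝ => θ 0) (hp hpU)
    refine ContinuousAlternatingMap.ext fun v => ?_
    rw [Subsingleton.elim v 0]
    refine Eq.trans ?_ h1
    simp only [coordForm, ContinuousAlternatingMap.compContinuousLinearMap_apply]
    exact congr_arg _ (Subsingleton.elim _ _)
  | succ k =>
    have hX := isCutoff_stdCutoff
    have hXm : Measurable stdCutoff := hX.smooth.continuous.measurable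
    have hd := isWeakExtDeriv_homForm h3 h23 hX h fun x =>
      radialInt_of_hasMajorant (c := c) (g := g) hη.1 hη.2 hXm (hX.integrableOn_one_sub_sq h3 _) x
    refine ⟨homForm stdCutoff η, mem_squareIntegrableForms_of_locIntegrable hd.1
      (hasMajorant_homForm hη.2 hXm (hX.lintegral_kernSq_lt_top h3 (by norm_num) ?_)), hd⟩
    push_cast at hw
    nlinarith

/-- The primitive is the integral from the tip. `hw` removes the boundary term at `r = 0`; `hw'`
makes the integral converge and square integrable. -/
theorem isExactForm_of_le {k : ℕ} (hw : c * (Module.finrank ℝ E - 2 * (k + 1)) ≤ -1)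
    (hw' : c * (Module.finrank ℝ E - 2 * k) < 1)
    {η : Form (𝓘(ℝ, ℝ).prod 𝓘(ℝ, E)) (interval01 × F) (k + 1)}
    (hη : η ∈ squareIntegrableForms (coneMetric c g.inner) (k + 1)) (h : IsWeakExtDeriv η 0) :
    IsExactForm (coneMetric c g.inner) η := by
  have hd := isWeakExtDeriv_homForm_zero h (fun x =>
    radialInt_of_hasMajorant (c := c) (g := g) hη.1 hη.2 measurable_const (by
      simp only [sub_zero, one_pow, one_mul]
      exact integrableOn_rpow_Ioo (by linarith)) x)
    fun x K hK hKc v => integrableOn_inv_mul_slice_sq (c := c) (g := g) hη.1 hη.2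
      (by push_cast; exact hw) x hK hKc v
  exact ⟨homForm (fun _ => 0) η, mem_squareIntegrableForms_of_locIntegrable hd.1
    (hasMajorant_homForm hη.2 measurable_const (lintegral_kernSq_zero_lt_top hw')), hd⟩

/-- The pullback of closed square integrable forms to the cone. -/
def pullClosed {k : ℕ} (hw : -1 < c * (Module.finrank ℝ E - 2 * k)) :
    closedForms g.inner k →ₗ[ℝ] closedForms (coneMetric c g.inner) k where
  toFun ξ := ⟨⟨pull ξ.1.1, pull_mem_squareIntegrableForms ξ.1.2 ξ.2 hw⟩,
    isWeakExtDeriv_pull ξ.2⟩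
  map_add' _ _ := rfl
  map_smul' _ _ := rfl

/-- The composite `f` of the pullback with the class map of the cone is surjective, since every
closed form differs from the pullback of its average by an exact one. Its kernel is that of the
class map of `F`, so the two quotients agree. -/
theorem nonempty_linearEquiv_coneMetric (hc : 0 < c) {k : ℕ}
    (hw : -1 < c * (Module.finrank ℝ E - 2 * k)) :
    Nonempty (MaxL2Cohomology (coneMetric c g.inner) k ≃ₗ[ℝ] MaxL2Cohomology g.inner k) := by
  obtain ⟨q, hq, hqk⟩ := exists_closedForms_map (regularDensity_inner g) k
  obtain ⟨q', hq', hqk'⟩ := exists_closedForms_map (regularDensity_coneMetric c g) k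
  set f := q' ∘ₗ pullClosed (g := g) hw
  have hf : Function.Surjective f := by
    intro u
    obtain ⟨η, rfl⟩ := hq' u
    have hcl : IsWeakExtDeriv (avgForm stdBump η.1.1) 0 := by
      have := isWeakExtDeriv_avgForm isTest_stdBump η.2
      rwa [show (((LinearMap.inl ℝ (squareIntegrableForms (coneMetric c g.inner) k)
        (squareIntegrableForms (coneMetric c g.inner) (k + 1))) η.1).2.1) = 0 from rfl,
        avgForm_zero] at this
    refine ⟨⟨⟨avgForm stdBump η.1.1, avgForm_mem_squareIntegrableForms η.1.2 η.2⟩, hcl⟩, ?_⟩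
    refine (sub_eq_zero.1 ?_).symm
    rw [LinearMap.comp_apply, ← map_sub, hqk']
    exact isExactForm_sub_pull_avgForm hc hw η.1.2 η.2
  have hk : LinearMap.ker f = LinearMap.ker q := by
    ext ξ
    rw [LinearMap.mem_ker, LinearMap.mem_ker, LinearMap.comp_apply, hqk', hqk]
    exact isExactForm_pull_iff hc hw ξ.1.1
  exact ⟨(f.quotKerEquivOfSurjective hf).symm.trans ((Submodule.quotEquivOfEq _ _ hk).trans
    (q.quotKerEquivOfSurjective hq))⟩

theorem subsingleton_coneMetric {k : ℕ}
    (hw : c * (Module.finrank ℝ E - 2 * (k + 1)) ≤ -1)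
    (hw' : c * (Module.finrank ℝ E - 2 * k) < 1) :
    Subsingleton (MaxL2Cohomology (coneMetric c g.inner) (k + 1)) := by
  obtain ⟨q, hq, hqk⟩ := exists_closedForms_map (regularDensity_coneMetric c g) (k + 1)
  refine subsingleton_of_forall_eq 0 fun u => ?_
  obtain ⟨η, rfl⟩ := hq u
  exact (hqk η).2 (isExactForm_of_le hw hw' η.1.2 η.2)

end Main

end L2deRham

end

theorem mainTheorem3 (f : ℕ) (F : Type*) [TopologicalSpace F] [T2Space F]
    [SecondCountableTopology F] [ChartedSpace (EuclideanSpace ℝ (Fin f)) F]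
    [IsManifold 𝓘(ℝ, EuclideanSpace ℝ (Fin f)) ∞ F] [MeasurableSpace F] [BorelSpace F]
    (g : Bundle.ContMDiffRiemannianMetric 𝓘(ℝ, EuclideanSpace ℝ (Fin f)) ∞
      (EuclideanSpace ℝ (Fin f))
      (fun x : F => TangentSpace 𝓘(ℝ, EuclideanSpace ℝ (Fin f)) x))
    (c : ℝ) (hc : 0 < c) (i : ℕ) :
    ((i : ℝ) < (f : ℝ) / 2 + 1 / (2 * c) →
      Nonempty (MaxL2Cohomology (coneMetric c g.inner) i ≃ₗ[ℝ] MaxL2Cohomology g.inner i)) ∧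
    ((f : ℝ) / 2 + 1 - 1 / (2 * c) < (i : ℝ) → (f : ℝ) / 2 + 1 / (2 * c) ≤ (i : ℝ) →
      Subsingleton (MaxL2Cohomology (coneMetric c g.inner) i)) := by
  have hf : (Module.finrank ℝ (EuclideanSpace ℝ (Fin f)) : ℝ) = f := by
    rw [finrank_euclideanSpace_fin]
  have e : c * (1 / (2 * c)) = 1 / 2 := by field_simp
  -- After multiplication by `2c` the first hypothesis is `c (f - 2i) > -1`. The second pair, for `i
  -- = k + 1`, becomes `c (f - 2k) < 1` and `c (f - 2(k+1)) ≤ -1`.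
  refine ⟨fun h => nonempty_linearEquiv_coneMetric hc ?_, fun h h' => ?_⟩
  · rw [hf]
    nlinarith [mul_lt_mul_of_pos_left h hc]
  · cases i with
    -- Degree zero cannot occur here, as `f / 2 + 1 / (2c)` is positive.
    | zero =>
      have h1 : 0 < 1 / (2 * c) := by positivity
      have h2 : (0 : ℝ) ≤ f := Nat.cast_nonneg f
      push_cast at h'
      linarith
    | succ k =>
      push_cast at h h'
      refine subsingleton_coneMetric ?_ ?_
      · rw [hf]
        nlinarith [mul_le_mul_of_nonneg_left h' hc.le]
      · rw [hf]
        nlinarith [mul_lt_mul_of_pos_left h hc]
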